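/- Let $\mathbb{R}^n$ ($n\ge 1$) carry the uniform norm, and let $\operatorname{diam}$ and $\|\nabla F\|$ be taken in it. A cube is a closed cube $Q=Q(x,r)$ with sides parallel to the axes, centre $x$ and side length $2r>0$, and $\gamma Q:=Q(x,\gamma r)$. Let $L^1_p(\mathbb{R}^n)$ be the homogeneous Sobolev space of all $F\in L_{p,\mathrm{loc}}(\mathbb{R}^n)$ whose first-order distributional partial derivatives belong to $L_p(\mathbb{R}^n)$, with the seminorm $\|F\|_{L^1_p}=\|\nabla F\|_{L_p(\mathbb{R}^n)}$; for $p>n$ each $F\in L^1_p(\mathbb{R}^n)$ is identified with its unique continuous representative. For a Borel measure $\mu$ on $\mathbb{R}^n$ let $\Sigma=L^1_p(\mathbb{R}^n)+L_p(\mathbb{R}^n;\mu)$, the space of all $f$ with $f=f_1+f_2$ $\mu$-almost everywhere for some $f_1\in L^1_p(\mathbb{R}^n)$ and $f_2\in L_p(\mathbb{R}^n;\mu)$, and let $\|f\|_\Sigma$ be the infimum of $\|f_1\|_{L^1_p}+\|f_2\|_{L_p(\mu)}$ over all such decompositions. **Theorem.** There is an absolute constant $\gamma>0$ such that for all $n\ge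 1$ and $n<p<\infty$ there is a constant $C=C(n,p)\ge 1$ with the following property. Let $\mu\neq 0$ be a non-negative Borel measure on $\mathbb{R}^n$ that is finite on bounded sets, and let $f\in L_{p,\mathrm{loc}}(\mathbb{R}^n;\mu)$ be real valued. Then $f\in\Sigma$ if and only if there is a $\lambda>0$ such that, for every finite family $\mathcal{Q}$ of pairwise disjoint cubes and every choice, for each $Q\in\mathcal{Q}$, of two cubes $Q',Q''\in\mathcal{Q}$ with $Q'\cup Q''\subset\gamma Q$, $$\sum_{Q\in\mathcal{Q}}\frac{(\operatorname{diam}Q)^{n-p}\iint_{Q'\times Q''}|f(x)-f(y)|^p\,d\mu(x)\,d\mu(y)}{\{(\operatorname{diam}Q')^{n-p}+\mu(Q')\}\,\{(\operatorname{diam}Q'')^{n-p}+\mu(Q'')\}}\le\lambda .$$ Moreover, $$C^{-1}\inf\lambda^{1/p}\le\|f\|_\Sigma\le C\inf\lambda^{1/p},$$ where the infimum is over all such $\lambda$ (and both quantities are $\infty$ if $f\notin\Sigma$). -/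

import Mathlib

open MeasureTheory
open scoped ENNReal ContDiff

namespace SobolevSum

/-! Throughout, `ℝⁿ` is `Fin n → ℝ` with the uniform norm, its Borel sets and Lebesgue measure
`volume`. Diameters and lengths of gradients are taken in the uniform norm. -/

variable {n : ℕ}

/-- `f ∈ L_{p,loc}(ℝⁿ; μ)`: `f` is in `L_p` with respect to `μ` on every compact set. -/
def MemLpLoc (p : ℝ) (μ : Measure (Fin n → ℝ)) (f : (Fin n → ℝ) → ℝ) : Prop :=
  ∀ K : Set (Fin n → ℝ), IsCompact K → MemLp f (ENNReal.ofReal p) (μ.restrict K)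

/-- `G` is the distributional gradient of `F`: both are locally integrable for Lebesgue measure
and `∫ F ∂ᵢφ = - ∫ Gᵢ φ` for every index `i` and every test function `φ`. -/
structure IsWeakGradient (F : (Fin n → ℝ) → ℝ) (G : (Fin n → ℝ) → (Fin n → ℝ)) : Prop where
  locallyIntegrable_left : LocallyIntegrable F volume
  locallyIntegrable_right : LocallyIntegrable G volume
  integral_eq : ∀ (i : Fin n) (φ : (Fin n → ℝ) → ℝ), ContDiff ℝ ∞ φ → HasCompactSupport φ →
    ∫ x, F x * fderiv ℝ φ x (Pi.single i 1) = - ∫ x, G x i * φ x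

/-- Membership in the homogeneous Sobolev space `L¹_p(ℝⁿ)`: the function is in `L_{p,loc}` for
Lebesgue measure and its distributional gradient is in `L_p(ℝⁿ)`. -/
def MemSobolev (p : ℝ) (F : (Fin n → ℝ) → ℝ) : Prop :=
  MemLpLoc p volume F ∧
    ∃ G : (Fin n → ℝ) → (Fin n → ℝ), IsWeakGradient F G ∧ MemLp G (ENNReal.ofReal p) volume

/-- The seminorm `‖∇F‖_{L_p(ℝⁿ)}`. The distributional gradient is unique up to null sets, so the
infimum is over a single value (and is `∞` if there is no gradient). -/
noncomputable def sobolevSeminorm (p : ℝ) (F : (Fin n → ℝ) → ℝ) : ℝ≥0∞ :=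
  ⨅ (G : (Fin n → ℝ) → (Fin n → ℝ)) (_ : IsWeakGradient F G),
    eLpNorm G (ENNReal.ofReal p) volume

/-- `f = f₁ + f₂` with `f₁ ∈ L¹_p(ℝⁿ)` and `f₂ ∈ L_p(ℝⁿ; μ)`. For `p > n` every element of
`L¹_p(ℝⁿ)` is identified with its unique continuous representative, so that it is a function
defined everywhere; the equality is that of elements of `L_{p,loc}(ℝⁿ; μ)`. -/
structure IsDecomposition (p : ℝ) (μ : Measure (Fin n → ℝ)) (f f₁ f₂ : (Fin n → ℝ) → ℝ) :
    Prop where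
  continuous_left : Continuous f₁
  memSobolev_left : MemSobolev p f₁
  memLp_right : MemLp f₂ (ENNReal.ofReal p) μ
  ae_eq : ∀ᵐ x ∂μ, f x = f₁ x + f₂ x

/-- `f ∈ Σ = L¹_p(ℝⁿ) + L_p(ℝⁿ; μ)`. -/
def MemSum (p : ℝ) (μ : Measure (Fin n → ℝ)) (f : (Fin n → ℝ) → ℝ) : Prop :=
  ∃ f₁ f₂ : (Fin n → ℝ) → ℝ, IsDecomposition p μ f f₁ f₂

/-- The norm of `Σ = L¹_p(ℝⁿ) + L_p(ℝⁿ; μ)` (equal to `∞` outside `Σ`). -/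
noncomputable def sumNorm (p : ℝ) (μ : Measure (Fin n → ℝ)) (f : (Fin n → ℝ) → ℝ) : ℝ≥0∞ :=
  ⨅ (f₁ : (Fin n → ℝ) → ℝ) (f₂ : (Fin n → ℝ) → ℝ) (_ : IsDecomposition p μ f f₁ f₂),
    sobolevSeminorm p f₁ + eLpNorm f₂ (ENNReal.ofReal p) μ

/-- A cube `Q(x, r)`, given by its centre `x` and half its side length `r > 0`. -/
structure Cube (n : ℕ) where
  center : Fin n → ℝ
  radius : ℝ
  radius_pos : 0 < radius

/-- The closed cube `a Q`, the dilation of `Q` by the factor `a` with respect to its centre. As the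
norm is the uniform one, a closed ball is a closed cube with sides parallel to the axes. -/
def Cube.dilate (a : ℝ) (Q : Cube n) : Set (Fin n → ℝ) :=
  Metric.closedBall Q.center (a * Q.radius)

/-- The closed cube `Q` as a set of points. -/
def Cube.toSet (Q : Cube n) : Set (Fin n → ℝ) :=
  Metric.closedBall Q.center Q.radius

/-- `(diam Q)^{n-p}`. -/
noncomputable def Cube.diamPow (p : ℝ) (Q : Cube n) : ℝ≥0∞ :=
  ENNReal.ofReal (Metric.diam Q.toSet ^ ((n : ℝ) - p))

/-- The summand
`(diam Q)^{n-p} ∬_{Q'×Q''} |f(x)-f(y)|^p dμ(x)dμ(y) /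
  ({(diam Q')^{n-p} + μ(Q')} {(diam Q'')^{n-p} + μ(Q'')})`. -/
noncomputable def oscTerm (p : ℝ) (μ : Measure (Fin n → ℝ)) (f : (Fin n → ℝ) → ℝ)
    (Q Q' Q'' : Cube n) : ℝ≥0∞ :=
  Q.diamPow p * (∫⁻ z in Q'.toSet ×ˢ Q''.toSet, ‖f z.1 - f z.2‖ₑ ^ p ∂(μ.prod μ)) /
    ((Q'.diamPow p + μ Q'.toSet) * (Q''.diamPow p + μ Q''.toSet))

/-- The condition on `lam`: for every finite family `𝒬` of pairwise disjoint cubes and all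
assignments `Q ↦ Q' = A Q ∈ 𝒬`, `Q ↦ Q'' = B Q ∈ 𝒬` with `Q' ∪ Q'' ⊆ γ Q`, the sum of the terms
`oscTerm` over `Q ∈ 𝒬` is at most `lam`. -/
def OscBound (γ p : ℝ) (μ : Measure (Fin n → ℝ)) (f : (Fin n → ℝ) → ℝ) (lam : ℝ) : Prop :=
  ∀ (𝒬 : Finset (Cube n)) (A B : Cube n → Cube n),
    (∀ Q ∈ 𝒬, ∀ K ∈ 𝒬, Q ≠ K → Disjoint Q.toSet K.toSet) →
    (∀ Q ∈ 𝒬, A Q ∈ 𝒬 ∧ B Q ∈ 𝒬 ∧ (A Q).toSet ∪ (B Q).toSet ⊆ Q.dilate γ) →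
    ∑ Q ∈ 𝒬, oscTerm p μ f Q (A Q) (B Q) ≤ ENNReal.ofReal lam

/-- `inf lam^{1/p}` over all `lam > 0` with the property `OscBound` (`∞` if there are none). -/
noncomputable def oscNorm (γ p : ℝ) (μ : Measure (Fin n → ℝ)) (f : (Fin n → ℝ) → ℝ) : ℝ≥0∞ :=
  ⨅ (lam : ℝ) (_ : 0 < lam) (_ : OscBound γ p μ f lam), ENNReal.ofReal (lam ^ (1 / p))

end SobolevSum

open MeasureTheory
open scoped ENNReal ContDiff

namespace SobolevSum

/-! Sufficiency. Let R(x) be the critical radius (`critRadius`), the scale at which μ(Q(x,r))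
overtakes r^(n-p). At this scale a unit change of a Sobolev function and a unit error in L_p(μ) cost
about the same. R is positive and 1-Lipschitz, so a net adapted to R exists (`ScaleNet`). Each net
point x gets a value c(x), the average of f over a cube near x whose measure dominates the power of
its diameter. Then f₁ is the smooth interpolation of these values and f₂ = f - f₁. On a cell, |∇f₁|
≤ C|c(x)-c(y)|/R(x) for the worst neighbour y, so both norms reduce to the sums of
R^(n-p)|c(x)-c(y)|^p and of the integrals of |f-c(x)|^p over cells. Jensen's inequality bounds each
summand by an `oscTerm`.

The difficulty is that the cubes Q, Q', Q'' must belong to one disjoint family with Q', Q'' in γQ.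
The net therefore has a set S of anchors whose hosts are disjoint from all other hosts. The
remaining hosts have bounded overlap, so an independent subfamily carries a fixed fraction of the
sum, and the anchors can be added to it without losing disjointness (`OscBound.sum_le_of_overlap`).
Anchors are selected with preference for small radii (`exists_disjoint_small_balls`), so an anchor
of x has scale at most 2R(x) and its host fits into a dilation of the host of x.

Necessity. Write f = u + h with u Sobolev and h in L_p(μ). Morrey's inequality with an exponent q
strictly between n and p bounds the oscillation of u on γQ by a mean of |∇u|^q over 2γQ; a discrete
maximal inequality with exponent p/q > 1 sums these bounds (`exists_sum_oscillation_le`). For h the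
summands are grouped by the partner cube K: disjoint cubes Q with K ⊆ γQ satisfy Σ(diam Q)^(n-p) ≤
C(diam K)^(n-p) because p > n (`sum_diamPow_le`). -/

variable {n : ℕ}

/-! ### Independent sets and packing. -/

/-- A finite graph of degree less than `N` has an independent set carrying at least the fraction
`1 / N` of any weight. The relation `adj` includes the diagonal. -/
theorem exists_independent_subset {ι : Type*} (adj : ι → ι → Prop) (hrefl : ∀ x, adj x x)
    (hsymm : ∀ x y, adj x y → adj y x) (N : ℕ) (w : ι → ℝ≥0∞) (F : Finset ι)
    (hdeg : ∀ x ∈ F, ∀ T ⊆ F, (∀ y ∈ T, adj x y) → T.card ≤ N) :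
    ∃ I ⊆ F, (∀ x ∈ I, ∀ y ∈ I, x ≠ y → ¬ adj x y) ∧
      ∑ x ∈ F, w x ≤ N * ∑ x ∈ I, w x := by
  classical
  induction F using Finset.strongInduction with
  | H F ih =>
    rcases F.eq_empty_or_nonempty with rfl | hne
    · exact ⟨∅, by simp, by simp, by simp⟩
    -- Greedy choice: the heaviest vertex pays for all its neighbours, at most `N` in number, which
    -- are then discarded.
    obtain ⟨x, hxF, hx⟩ := F.exists_max_image w hne
    set F' := F.filter (fun y => ¬ adj x y) with hF'
    have hss : F' ⊂ F :=
      Finset.filter_ssubset.2 ⟨x, hxF, by simpa using hrefl x⟩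
    obtain ⟨I, hIF, hI, hsum⟩ := ih F' hss fun y hy T hT hadj =>
      hdeg y (hss.1 hy) T (hT.trans hss.1) hadj
    have hxI : ∀ y ∈ I, ¬ adj x y := fun y hy => (Finset.mem_filter.1 (hIF hy)).2
    have hxn : x ∉ I := fun h => hxI x h (hrefl x)
    refine ⟨insert x I, Finset.insert_subset hxF (hIF.trans hss.1), ?_, ?_⟩
    · intro a ha b hb hab
      rcases Finset.mem_insert.1 ha with rfl | haI
      · rcases Finset.mem_insert.1 hb with rfl | hbI
        · exact absurd rfl hab
        · exact hxI b hbI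
      · rcases Finset.mem_insert.1 hb with rfl | hbI
        · exact fun h => hxI a haI (hsymm _ _ h)
        · exact hI a haI b hbI hab
    · rw [Finset.sum_insert hxn, mul_add, ← Finset.sum_filter_add_sum_filter_not F (adj x)]
      refine add_le_add ?_ hsum
      calc ∑ y ∈ F.filter (adj x), w y ≤ (F.filter (adj x)).card • w x :=
            Finset.sum_le_card_nsmul _ _ _ fun y hy => hx y (Finset.mem_filter.1 hy).1
        _ ≤ N * w x := by
            rw [nsmul_eq_mul]
            gcongr
            exact hdeg x hxF _ (Finset.filter_subset _ _) fun y hy => (Finset.mem_filter.1 hy).2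

/-- A packing bound: disjoint balls of radii at least `a` inside a ball of radius `b`. -/
theorem card_mul_pow_le_of_pairwiseDisjoint (F : Finset (Fin n → ℝ)) (r : (Fin n → ℝ) → ℝ)
    (x₀ : Fin n → ℝ) {a b : ℝ} (ha : 0 ≤ a) (hab : 0 ≤ b)
    (hdisj : ∀ x ∈ F, ∀ y ∈ F, x ≠ y →
      Disjoint (Metric.closedBall x (r x)) (Metric.closedBall y (r y)))
    (har : ∀ x ∈ F, a ≤ r x)
    (hb : ∀ x ∈ F, Metric.closedBall x (r x) ⊆ Metric.closedBall x₀ b) :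
    (F.card : ℝ) * a ^ n ≤ b ^ n := by
  have h1 : ∑ x ∈ F, volume (Metric.closedBall x a) ≤ volume (Metric.closedBall x₀ b) := by
    rw [← measure_biUnion_finset]
    · exact measure_mono (Set.iUnion₂_subset fun x hx =>
        (Metric.closedBall_subset_closedBall (har x hx)).trans (hb x hx))
    · intro x hx y hy hxy
      exact (hdisj x hx y hy hxy).mono (Metric.closedBall_subset_closedBall (har x hx))
        (Metric.closedBall_subset_closedBall (har y hy))
    · exact fun x _ => measurableSet_closedBall
  simp only [Real.volume_pi_closedBall _ ha, Real.volume_pi_closedBall _ hab, Fintype.card_fin,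
    Finset.sum_const, nsmul_eq_mul] at h1
  rw [← ENNReal.ofReal_natCast, ← ENNReal.ofReal_mul (by positivity),
    ENNReal.ofReal_le_ofReal_iff (by positivity), mul_pow, mul_pow] at h1
  have h2 : (0 : ℝ) < 2 ^ n := by positivity
  nlinarith

/-! ### Oscillation sums over indexed and overlapping families of cubes. -/

theorem Cube.diam_toSet (hn : 0 < n) (Q : Cube n) : Metric.diam Q.toSet = 2 * Q.radius := by
  have : Nonempty (Fin n) := ⟨⟨0, hn⟩⟩
  exact Metric.diam_closedBall_eq _ Q.radius_pos.le

theorem Cube.diamPow_eq (hn : 0 < n) (p : ℝ) (Q : Cube n) :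
    Q.diamPow p = ENNReal.ofReal ((2 * Q.radius) ^ ((n : ℝ) - p)) := by
  rw [Cube.diamPow, Q.diam_toSet hn]

theorem Cube.center_mem (Q : Cube n) : Q.center ∈ Q.toSet :=
  Metric.mem_closedBall_self Q.radius_pos.le

/-- The sums in `OscBound`, indexed by an arbitrary type. -/
theorem OscBound.sum_le {ι : Type*} {γ p lam : ℝ} {μ : Measure (Fin n → ℝ)}
    {f : (Fin n → ℝ) → ℝ} (h : OscBound γ p μ f lam) (I : Finset ι) (q : ι → Cube n) (A B : ι → ι)
    (hdisj : ∀ i ∈ I, ∀ j ∈ I, i ≠ j → Disjoint (q i).toSet (q j).toSet)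
    (hAB : ∀ i ∈ I, A i ∈ I ∧ B i ∈ I ∧ (q (A i)).toSet ∪ (q (B i)).toSet ⊆ (q i).dilate γ) :
    ∑ i ∈ I, oscTerm p μ f (q i) (q (A i)) (q (B i)) ≤ ENNReal.ofReal lam := by
  classical
  rcases I.eq_empty_or_nonempty with rfl | ⟨i₀, hi₀⟩
  · simp
  have : Nonempty ι := ⟨i₀⟩
  -- Cubes with distinct indices are disjoint and nonempty, hence distinct, so the assignments on
  -- indices transfer to cubes.
  have hinj : Set.InjOn q (I : Set ι) := by
    intro i hi j hj hij
    by_contra hne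
    have := hdisj i hi j hj hne
    rw [hij] at this
    exact Set.disjoint_left.1 this (q j).center_mem (q j).center_mem
  set g := Function.invFunOn q (I : Set ι)
  have hg : ∀ i ∈ I, g (q i) = i := fun i hi => hinj.leftInvOn_invFunOn hi
  have := h (I.image q) (fun Q => q (A (g Q))) (fun Q => q (B (g Q))) ?_ ?_
  · rw [Finset.sum_image hinj] at this
    refine le_trans (le_of_eq (Finset.sum_congr rfl fun i hi => ?_)) this
    rw [hg i hi]
  · simp only [Finset.mem_image, forall_exists_index, and_imp, forall_apply_eq_imp_iff₂]
    intro i hi j hj hij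
    exact hdisj i hi j hj fun h => hij (by rw [h])
  · simp only [Finset.mem_image, forall_exists_index, and_imp, forall_apply_eq_imp_iff₂]
    intro i hi
    rw [hg i hi]
    exact ⟨⟨_, (hAB i hi).1, rfl⟩, ⟨_, (hAB i hi).2.1, rfl⟩, (hAB i hi).2.2⟩

/-- The sums in `OscBound` for a family of cubes with bounded overlap; the indices in `S` have
cubes disjoint from all others, and `A i`, `B i` are either in `S` or equal to `i`. -/
theorem OscBound.sum_le_of_overlap {ι : Type*} {γ p lam : ℝ} {μ : Measure (Fin n → ℝ)}
    {f : (Fin n → ℝ) → ℝ} (h : OscBound γ p μ f lam) (hγ : 1 ≤ γ) (q : ι → Cube n) (P S : Set ι)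
    (hS : ∀ i ∈ P, ∀ j ∈ S, i ≠ j → Disjoint (q i).toSet (q j).toSet) (hSP : S ⊆ P)
    (N : ℕ) (F : Finset ι) (hF : ∀ i ∈ F, i ∈ P)
    (hdeg : ∀ i ∈ F, ∀ T ⊆ F, (∀ j ∈ T, ¬ Disjoint (q i).toSet (q j).toSet) → T.card ≤ N)
    (A B : ι → ι) (hA : ∀ i ∈ F, A i = i ∨ A i ∈ S) (hB : ∀ i ∈ F, B i = i ∨ B i ∈ S)
    (hAB : ∀ i ∈ F, (q (A i)).toSet ∪ (q (B i)).toSet ⊆ (q i).dilate γ) :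
    ∑ i ∈ F, oscTerm p μ f (q i) (q (A i)) (q (B i)) ≤ N * ENNReal.ofReal lam := by
  classical
  obtain ⟨I, hIF, hI, hsum⟩ := exists_independent_subset
    (fun i j => ¬ Disjoint (q i).toSet (q j).toSet)
    (fun i => Set.not_disjoint_iff.2 ⟨_, (q i).center_mem, (q i).center_mem⟩)
    (fun i j hij => by rwa [disjoint_comm]) N
    (fun i => oscTerm p μ f (q i) (q (A i)) (q (B i))) F hdeg
  refine hsum.trans ?_
  gcongr
  -- Closing `I` under `A` and `B` adds only indices of `S`, so disjointness survives. Added indices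
  -- become their own partners, which is allowed since `γ ≥ 1`.
  set J := I ∪ (I.image A ∪ I.image B)
  set A' : ι → ι := fun i => if i ∈ I then A i else i with hA'
  set B' : ι → ι := fun i => if i ∈ I then B i else i with hB'
  have hIJ : I ⊆ J := Finset.subset_union_left
  have hJ : ∀ i ∈ J, i ∈ I ∨ i ∈ S := by
    intro i hi
    simp only [J, Finset.mem_union, Finset.mem_image] at hi
    rcases hi with hi | ⟨j, hj, rfl⟩ | ⟨j, hj, rfl⟩
    · exact Or.inl hi
    · rcases hA j (hIF hj) with h | h
      · rw [h]; exact Or.inl hj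
      · exact Or.inr h
    · rcases hB j (hIF hj) with h | h
      · rw [h]; exact Or.inl hj
      · exact Or.inr h
  have hJP : ∀ i ∈ J, i ∈ P := fun i hi => (hJ i hi).elim (fun h => hF i (hIF h)) fun h => hSP h
  have key := h.sum_le J q A' B' ?_ ?_
  · refine le_trans ?_ ((Finset.sum_le_sum_of_subset hIJ).trans key)
    refine le_of_eq (Finset.sum_congr rfl fun i hi => ?_)
    simp [hA', hB', hi]
  · intro i hi j hj hij
    rcases hJ j hj with hj' | hj'
    · rcases hJ i hi with hi' | hi'
      · exact not_not.1 (hI i hi' j hj' hij)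
      · exact (hS j (hJP j hj) i hi' hij.symm).symm
    · exact hS i (hJP i hi) j hj' hij
  · intro i hi
    by_cases hiI : i ∈ I
    · simp only [hA', hB', hiI, if_true]
      refine ⟨?_, ?_, hAB i (hIF hiI)⟩ <;> simp only [J, Finset.mem_union, Finset.mem_image]
      · exact Or.inr (Or.inl ⟨i, hiI, rfl⟩)
      · exact Or.inr (Or.inr ⟨i, hiI, rfl⟩)
    · simp only [hA', hB', hiI, if_false, Set.union_self]
      refine ⟨hi, hi, Metric.closedBall_subset_closedBall ?_⟩
      nlinarith [(q i).radius_pos]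



/-! ### Selection of separated families by Zorn's lemma. -/

/-- A family of pairwise separated elements extends to a maximal one. -/
theorem exists_maximal_separated {α : Type*} (adj : α → α → Prop) (hrefl : ∀ x, adj x x)
    (hsymm : ∀ x y, adj x y → adj y x) (S : Set α) (hS : ∀ s ∈ S, ∀ t ∈ S, s ≠ t → ¬ adj s t) :
    ∃ X, S ⊆ X ∧ (∀ s ∈ X, ∀ t ∈ X, s ≠ t → ¬ adj s t) ∧ ∀ z, ∃ x ∈ X, adj z x := by
  obtain ⟨X, hSX, hX⟩ := zorn_subset_nonempty
    {X : Set α | ∀ s ∈ X, ∀ t ∈ X, s ≠ t → ¬ adj s t}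
    (fun c hc hchain _ => ⟨⋃₀ c, by
      rintro s ⟨a, ha, hs⟩ t ⟨a', ha', ht⟩ hst
      rcases hchain.total ha ha' with h | h
      · exact hc ha' s (h hs) t ht hst
      · exact hc ha s hs t (h ht) hst, fun s hs => Set.subset_sUnion_of_mem hs⟩) S hS
  refine ⟨X, hSX, hX.1, fun z => ?_⟩
  by_contra! hcon
  have hzX : z ∉ X := fun hz => hcon z hz (hrefl z)
  refine hzX (hX.2 (y := insert z X) ?_ (Set.subset_insert z X) (Set.mem_insert z X))
  rintro s (rfl | hs) t (rfl | ht) hst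
  · exact absurd rfl hst
  · exact hcon t ht
  · exact fun h => hcon s hs (hsymm _ _ h)
  · exact hX.1 s hs t ht hst

/-- Selection of disjoint balls that prefers small radii: if the radii vary slowly, then every ball
of the family meets a selected ball which is not much larger. -/
theorem exists_disjoint_small_balls {E : Type*} [MetricSpace E] [CompleteSpace E] (R : E → ℝ)
    (hpos : ∀ x, 0 < R x) (hlip : ∀ x y, R x ≤ R y + dist x y) (b : ℝ) (hb : 0 ≤ b) :
    ∃ S : Set E,
      (∀ s ∈ S, ∀ t ∈ S, s ≠ t → b * R s + b * R t < dist s t) ∧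
      ∀ x, ∃ s ∈ S, dist x s ≤ b * R x + b * R s ∧ R s ≤ 2 * R x := by
  -- The second condition records that whoever meets the family already meets a small member. It
  -- survives unions of chains, and a new member only has to serve the balls not met before.
  obtain ⟨S, -, hS⟩ := zorn_subset_nonempty {S : Set E |
      (∀ s ∈ S, ∀ t ∈ S, s ≠ t → b * R s + b * R t < dist s t) ∧
      ∀ x, (∃ s ∈ S, dist x s ≤ b * R x + b * R s) →
        ∃ s ∈ S, dist x s ≤ b * R x + b * R s ∧ R s ≤ 2 * R x}
    (fun c hc hchain _ => ⟨⋃₀ c, ⟨by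
        rintro s ⟨a, ha, hs⟩ t ⟨a', ha', ht⟩ hst
        rcases hchain.total ha ha' with h | h
        · exact (hc ha').1 s (h hs) t ht hst
        · exact (hc ha).1 s hs t (h ht) hst, by
        rintro x ⟨s, ⟨a, ha, hs⟩, hxs⟩
        obtain ⟨t, ht, h⟩ := (hc ha).2 x ⟨s, hs, hxs⟩
        exact ⟨t, ⟨a, ha, ht⟩, h⟩⟩, fun s hs => Set.subset_sUnion_of_mem hs⟩) ∅
    ⟨by simp, by simp⟩
  obtain ⟨⟨hdisj, hsmall⟩, hmax⟩ := hS
  refine ⟨S, hdisj, fun x => hsmall x ?_⟩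
  by_contra hx
  -- the points whose balls meet no selected ball
  let Y := {y : E // ¬ ∃ s ∈ S, dist y s ≤ b * R y + b * R s}
  -- An almost smallest ball among the unmet ones. Otherwise each could be replaced by one it
  -- touches of less than half its radius; the centres would form a Cauchy sequence, and slow
  -- variation would force `R` to vanish at the limit.
  obtain ⟨y, hy⟩ : ∃ y : Y, ∀ z : Y, dist z.1 y.1 ≤ b * R z + b * R y → R y ≤ 2 * R z := by
    by_contra! hcon
    choose g hg1 hg2 using hcon
    let u : ℕ → Y := fun k => g^[k] ⟨x, hx⟩
    have hu : ∀ k, u (k + 1) = g (u k) := fun k => Function.iterate_succ_apply' _ _ _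
    have hR : ∀ k, R (u k) ≤ R x * (1 / 2) ^ k := by
      intro k
      induction k with
      | zero => simp [u]
      | succ k ih =>
        have := hg2 (u k)
        rw [← hu] at this
        rw [pow_succ]
        linarith
    have hdist : ∀ k, dist (u k).1 (u (k + 1)).1 ≤ (2 * b * R x) * (1 / 2) ^ k := by
      intro k
      have h1 := hg1 (u k)
      have h2 := hg2 (u k)
      rw [← hu] at h1 h2
      rw [dist_comm]
      have h3 := hpos (u (k + 1))
      have h4 : R (u (k+1)) + R (u k) ≤ 2 * (R x * (1 / 2) ^ k) := by linarith [hR k]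
      nlinarith
    obtain ⟨z, hz⟩ := cauchySeq_tendsto_of_complete
      (cauchySeq_of_le_geometric (1 / 2) (2 * b * R x) (by norm_num) hdist)
    have h0 : Filter.Tendsto (fun k => R x * (1 / 2 : ℝ) ^ k + dist z (u k).1) Filter.atTop
        (nhds (R x * 0 + dist z z)) :=
      ((tendsto_pow_atTop_nhds_zero_of_lt_one (by norm_num) (by norm_num)).const_mul _).add
        (tendsto_const_nhds.dist hz)
    have := ge_of_tendsto' h0 (fun k => (hlip z (u k)).trans (by linarith [hR k]))
    simp only [mul_zero, dist_self, add_zero] at this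
    exact absurd (hpos z) (not_lt.2 this)
  have hyS : y.1 ∉ S := fun h => y.2 ⟨y.1, h, by
    rw [dist_self]; nlinarith [hpos y]⟩
  have hyd : ∀ s ∈ S, b * R s + b * R y < dist s y := fun s hs => by
    have := y.2
    push Not at this
    have := this s hs
    rw [dist_comm]
    linarith
  refine hyS (hmax (y := insert y.1 S) ⟨?_, ?_⟩ (Set.subset_insert _ _) (Set.mem_insert _ _))
  · rintro s (rfl | hs) t (rfl | ht) hst
    · exact absurd rfl hst
    · rw [dist_comm, add_comm]; exact hyd t ht
    · exact hyd s hs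
    · exact hdisj s hs t ht hst
  · rintro w ⟨s, hs, hws⟩
    by_cases hw : ∃ s ∈ S, dist w s ≤ b * R w + b * R s
    · obtain ⟨t, ht, h⟩ := hsmall w hw
      exact ⟨t, Set.mem_insert_of_mem _ ht, h⟩
    · rcases hs with rfl | hs
      · exact ⟨y, Set.mem_insert _ _, hws, hy ⟨w, hw⟩ hws⟩
      · exact absurd ⟨s, hs, hws⟩ hw

/-! ### The critical radius. -/

/-- The scale at which the `μ`-measure of a cube with centre `x` starts to dominate the power
`r ^ (n - p)` of its radius. -/
noncomputable def critRadius (p : ℝ) (μ : Measure (Fin n → ℝ)) (x : Fin n → ℝ) : ℝ :=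
  sInf {r : ℝ | 0 < r ∧ ENNReal.ofReal (r ^ ((n : ℝ) - p)) ≤ μ (Metric.closedBall x r)}

section CritRadius

theorem bddBelow_setOf_pos_and (P : ℝ → Prop) : BddBelow {r : ℝ | 0 < r ∧ P r} :=
  ⟨0, fun _ h => h.1.le⟩

variable {p : ℝ} (μ : Measure (Fin n → ℝ))

theorem ofReal_rpow_le_of_le (hp : (n : ℝ) < p) {r s : ℝ} (hr : 0 < r) (hrs : r ≤ s) :
    ENNReal.ofReal (s ^ ((n : ℝ) - p)) ≤ ENNReal.ofReal (r ^ ((n : ℝ) - p)) :=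
  ENNReal.ofReal_le_ofReal (Real.rpow_le_rpow_of_nonpos hr hrs (by linarith))

/-- Since μ ≠ 0, some ball about `x` has positive measure, while `r ^ (n - p)` tends to 0 as `r`
grows. -/
theorem exists_ball_heavy (hp : (n : ℝ) < p) (hμ : μ ≠ 0) (x : Fin n → ℝ) :
    {r : ℝ | 0 < r ∧ ENNReal.ofReal (r ^ ((n : ℝ) - p)) ≤ μ (Metric.closedBall x r)}.Nonempty := by
  have h1 : ∃ k : ℕ, μ (Metric.closedBall x k) ≠ 0 := by
    by_contra! h
    apply hμ
    rw [← Measure.measure_univ_eq_zero, ← Metric.iUnion_closedBall_nat x]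
    exact measure_iUnion_null h
  obtain ⟨k, hk⟩ := h1
  have h2 : Filter.Tendsto (fun r : ℝ => ENNReal.ofReal (r ^ ((n : ℝ) - p))) Filter.atTop
      (nhds 0) := by
    have := tendsto_rpow_neg_atTop (y := p - n) (by linarith)
    simpa using ENNReal.tendsto_ofReal this
  have h3 := (h2.eventually (gt_mem_nhds (pos_iff_ne_zero.2 hk))).and
    ((Filter.eventually_ge_atTop (k : ℝ)).and (Filter.eventually_gt_atTop (0 : ℝ)))
  obtain ⟨r, hr1, hr2, hr3⟩ := h3.exists
  exact ⟨r, hr3, hr1.le.trans (measure_mono (Metric.closedBall_subset_closedBall hr2))⟩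

/-- As `r` tends to 0 the power blows up, while the measure stays below that of the unit ball. -/
theorem critRadius_pos [IsLocallyFiniteMeasure μ] (hp : (n : ℝ) < p) (hμ : μ ≠ 0) (x : Fin n → ℝ) :
    0 < critRadius p μ x := by
  have h2 : Filter.Tendsto (fun r : ℝ => r ^ ((n : ℝ) - p)) (nhdsWithin 0 (Set.Ioi 0))
      Filter.atTop := tendsto_rpow_neg_nhdsGT_zero (by linarith)
  obtain ⟨M, hM⟩ : ∃ M : ℝ, μ (Metric.closedBall x 1) ≤ ENNReal.ofReal M :=
    ⟨_, (ENNReal.ofReal_toReal measure_closedBall_lt_top.ne).ge⟩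
  have h3 := (h2.eventually (Filter.eventually_gt_atTop (max M 0))).and
    (self_mem_nhdsWithin (s := Set.Ioi (0:ℝ)) (a := 0))
  obtain ⟨r₀, hr₀, hr₀pos⟩ := h3.exists
  have hr₀pos : 0 < r₀ := hr₀pos
  refine lt_of_lt_of_le (lt_min hr₀pos one_pos) (le_csInf (exists_ball_heavy μ hp hμ x) ?_)
  rintro r ⟨hr, hle⟩
  by_contra! hlt
  have h4 : ENNReal.ofReal (r₀ ^ ((n : ℝ) - p)) ≤ ENNReal.ofReal M :=
    (ofReal_rpow_le_of_le hp hr (hlt.le.trans (min_le_left _ _))).trans <| hle.trans <|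
      (measure_mono (Metric.closedBall_subset_closedBall (hlt.le.trans (min_le_right _ _)))).trans hM
  rw [ENNReal.ofReal_le_ofReal_iff'] at h4
  have := lt_of_le_of_lt (le_max_left _ _) hr₀
  have := lt_of_le_of_lt (le_max_right _ _) hr₀
  rcases h4 with h | h <;> linarith

theorem measure_closedBall_le_of_lt_critRadius (x : Fin n → ℝ) {r : ℝ} (hr : 0 < r)
    (h : r < critRadius p μ x) :
    μ (Metric.closedBall x r) ≤ ENNReal.ofReal (r ^ ((n : ℝ) - p)) := by
  by_contra! hlt
  exact absurd (csInf_le (bddBelow_setOf_pos_and _) ⟨hr, hlt.le⟩) (not_le.2 h)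

/-- Doubling the radius avoids the question whether the infimum is attained. -/
theorem le_measure_closedBall_critRadius [IsLocallyFiniteMeasure μ] (hp : (n : ℝ) < p) (hμ : μ ≠ 0) (x : Fin n → ℝ) :
    ENNReal.ofReal ((2 * critRadius p μ x) ^ ((n : ℝ) - p)) ≤
      μ (Metric.closedBall x (2 * critRadius p μ x)) := by
  have h0 := critRadius_pos μ hp hμ x
  obtain ⟨r, hr, hlt⟩ := exists_lt_of_csInf_lt (exists_ball_heavy μ hp hμ x)
    (show critRadius p μ x < 2 * critRadius p μ x by linarith)
  exact (ofReal_rpow_le_of_le hp hr.1 hlt.le).trans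
    (hr.2.trans (measure_mono (Metric.closedBall_subset_closedBall hlt.le)))

/-- If the ball of radius `r` about `y` is heavy, so is the larger ball of radius `r + dist x y`
about `x`: the measure increases and the power decreases. -/
theorem critRadius_le_add_dist (hp : (n : ℝ) < p) (hμ : μ ≠ 0) (x y : Fin n → ℝ) :
    critRadius p μ x ≤ critRadius p μ y + dist x y := by
  rw [← sub_le_iff_le_add]
  refine le_csInf (exists_ball_heavy μ hp hμ y) ?_
  rintro r ⟨hr, hle⟩
  rw [sub_le_iff_le_add]
  refine csInf_le (bddBelow_setOf_pos_and _) ⟨by positivity, ?_⟩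
  refine (ofReal_rpow_le_of_le hp hr (by linarith [dist_nonneg (x := x) (y := y)])).trans
    (hle.trans (measure_mono ?_))
  refine Metric.closedBall_subset_closedBall' ?_
  rw [dist_comm]

end CritRadius



/-! ### Nets adapted to a scale: cells, hosts and anchors. -/

/-- A net adapted to a slowly varying scale `R`: the points of `X` are separated at scale `R` and
`R`-dense, and the distinguished points of `S` have widely separated balls and are selected such
that each point sees one of them which is not of larger scale. -/
structure ScaleNet (R : (Fin n → ℝ) → ℝ) where
  S : Set (Fin n → ℝ)
  X : Set (Fin n → ℝ)
  pos : ∀ x, 0 < R x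
  lip : ∀ x y, R x ≤ R y + dist x y
  subset : S ⊆ X
  sep_S : ∀ s ∈ S, ∀ t ∈ S, s ≠ t → 16 * R s + 16 * R t < dist s t
  select : ∀ x, ∃ s ∈ S, dist x s ≤ 16 * R x + 16 * R s ∧ R s ≤ 2 * R x
  sep_X : ∀ x ∈ X, ∀ y ∈ X, x ≠ y → R x / 32 + R y / 32 < dist x y
  cover_X : ∀ z, ∃ x ∈ X, dist z x ≤ R z / 32 + R x / 32

theorem exists_scaleNet (R : (Fin n → ℝ) → ℝ) (hpos : ∀ x, 0 < R x)
    (hlip : ∀ x y, R x ≤ R y + dist x y) : Nonempty (ScaleNet R) := by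
  obtain ⟨S, hS, hsel⟩ := exists_disjoint_small_balls R hpos hlip 16 (by norm_num)
  obtain ⟨X, hSX, hX, hcov⟩ := exists_maximal_separated
    (fun x y => dist x y ≤ R x / 32 + R y / 32) (fun x => by
      rw [dist_self]; linarith [hpos x]) (fun x y h => by rw [dist_comm]; linarith) S
    (fun s hs t ht hst h => by linarith [hS s hs t ht hst, hpos s, hpos t])
  exact ⟨⟨S, X, hpos, hlip, hSX, hS, hsel, fun x hx y hy hxy => not_le.1 (hX x hx y hy hxy), hcov⟩⟩

namespace ScaleNet

variable {R : (Fin n → ℝ) → ℝ} (W : ScaleNet R)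

open Classical in
/-- The radius of the covering ball at a point of the net. -/
noncomputable def rad (x : Fin n → ℝ) : ℝ := if x ∈ W.S then 4 * R x else R x / 8

open Classical in
/-- The radius of the host ball at a point of the net. -/
noncomputable def hostRad (x : Fin n → ℝ) : ℝ := if x ∈ W.S then 2 * R x else R x / 8

/-- The points of the net whose host ball meets no host ball of another distinguished point. -/
def index : Set (Fin n → ℝ) := {x ∈ W.X | x ∈ W.S ∨ ∀ t ∈ W.S, R x / 8 + 2 * R t < dist x t}

open Classical in
/-- The distinguished point that is attached to a point. -/
noncomputable def anchor (x : Fin n → ℝ) : Fin n → ℝ :=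
  if x ∈ W.S then x else (W.select x).choose

theorem S_subset_index : W.S ⊆ W.index := fun _ hs => ⟨W.subset hs, Or.inl hs⟩

theorem index_subset : W.index ⊆ W.X := fun _ hs => hs.1

theorem rad_of_mem {x : Fin n → ℝ} (h : x ∈ W.S) : W.rad x = 4 * R x := if_pos h
theorem rad_of_notMem {x : Fin n → ℝ} (h : x ∉ W.S) : W.rad x = R x / 8 := if_neg h
theorem hostRad_of_mem {x : Fin n → ℝ} (h : x ∈ W.S) : W.hostRad x = 2 * R x := if_pos h
theorem hostRad_of_notMem {x : Fin n → ℝ} (h : x ∉ W.S) : W.hostRad x = R x / 8 := if_neg h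

theorem le_rad (x : Fin n → ℝ) : R x / 8 ≤ W.rad x := by
  by_cases h : x ∈ W.S
  · rw [W.rad_of_mem h]; linarith [W.pos x]
  · rw [W.rad_of_notMem h]

theorem rad_le (x : Fin n → ℝ) : W.rad x ≤ 4 * R x := by
  by_cases h : x ∈ W.S
  · rw [W.rad_of_mem h]
  · rw [W.rad_of_notMem h]; linarith [W.pos x]

theorem rad_pos (x : Fin n → ℝ) : 0 < W.rad x := by linarith [W.pos x, W.le_rad x]

theorem le_hostRad (x : Fin n → ℝ) : R x / 8 ≤ W.hostRad x := by
  by_cases h : x ∈ W.S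
  · rw [W.hostRad_of_mem h]; linarith [W.pos x]
  · rw [W.hostRad_of_notMem h]

theorem hostRad_le (x : Fin n → ℝ) : W.hostRad x ≤ 2 * R x := by
  by_cases h : x ∈ W.S
  · rw [W.hostRad_of_mem h]
  · rw [W.hostRad_of_notMem h]; linarith [W.pos x]

theorem hostRad_le_rad (x : Fin n → ℝ) : W.hostRad x ≤ W.rad x := by
  by_cases h : x ∈ W.S
  · rw [W.hostRad_of_mem h, W.rad_of_mem h]; linarith [W.pos x]
  · rw [W.hostRad_of_notMem h, W.rad_of_notMem h]

theorem hostRad_pos (x : Fin n → ℝ) : 0 < W.hostRad x := by linarith [W.pos x, W.le_hostRad x]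

theorem anchor_of_mem {x : Fin n → ℝ} (h : x ∈ W.S) : W.anchor x = x := if_pos h

theorem anchor_spec (x : Fin n → ℝ) :
    W.anchor x ∈ W.S ∧ dist x (W.anchor x) ≤ 48 * R x ∧ R (W.anchor x) ≤ 2 * R x := by
  by_cases h : x ∈ W.S
  · rw [W.anchor_of_mem h, dist_self]
    have := W.pos x
    exact ⟨h, by positivity, by linarith⟩
  · rw [anchor, if_neg h]
    obtain ⟨h1, h2, h3⟩ := (W.select x).choose_spec
    exact ⟨h1, by linarith, h3⟩

/-- Near a distinguished point the scale does not drop. -/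
theorem le_of_dist_le {s x : Fin n → ℝ} (hs : s ∈ W.S) (hx : dist x s ≤ 8 * R s) :
    R s ≤ 6 * R x := by
  by_contra! hlt
  -- A point of much smaller scale would see a small distinguished point `t`, different from `s` and
  -- closer to it than the separation of `S` allows.
  obtain ⟨t, ht, h1, h2⟩ := W.select x
  have hst : s ≠ t := by
    rintro rfl
    linarith [W.pos x]
  have h3 := W.sep_S s hs t ht hst
  have h4 := dist_triangle_left s t x
  linarith [W.pos x, W.pos t]

/-- The doubled cell of a distinguished point has radius `8 * R x`, too large for the Lipschitz
property to give the lower bound; `le_of_dist_le` supplies it. -/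
theorem comparable {x z : Fin n → ℝ} (hz : dist z x ≤ 2 * W.rad x) :
    R x ≤ 6 * R z ∧ R z ≤ 9 * R x := by
  have hp := W.pos x
  by_cases h : x ∈ W.S
  · rw [W.rad_of_mem h] at hz
    exact ⟨W.le_of_dist_le h (by linarith), by linarith [W.lip z x]⟩
  · rw [W.rad_of_notMem h] at hz
    have h1 := W.lip x z
    rw [dist_comm] at h1
    exact ⟨by linarith, by linarith [W.lip z x]⟩

theorem exists_mem_X (z : Fin n → ℝ) : ∃ x ∈ W.X, dist z x ≤ R x / 8 := by
  obtain ⟨x, hx, h⟩ := W.cover_X z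
  exact ⟨x, hx, by linarith [W.lip z x, W.pos x]⟩

/-- A net point excluded from `index` is within `R x / 8 + 2 * R t` of some distinguished `t`, and
then `R x ≤ 24 / 7 * R t`, so the cell of `t` covers what the excluded point covered. This is why
cells at `S` have twice the radius of hosts. -/
theorem exists_mem_index (z : Fin n → ℝ) : ∃ x ∈ W.index, dist z x ≤ W.rad x := by
  obtain ⟨x, hx, hzx⟩ := W.exists_mem_X z
  by_cases hxI : x ∈ W.index
  · exact ⟨x, hxI, hzx.trans (W.le_rad x)⟩
  · have h1 : ∃ t ∈ W.S, dist x t ≤ R x / 8 + 2 * R t := by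
      by_contra! h
      exact hxI ⟨hx, Or.inr h⟩
    obtain ⟨t, ht, h2⟩ := h1
    refine ⟨t, W.S_subset_index ht, ?_⟩
    rw [W.rad_of_mem ht]
    linarith [W.lip x t, dist_triangle z x t, W.pos t]

/-- The number of points of the net of a given scale in a ball. -/
theorem card_le (T : Finset (Fin n → ℝ)) (hT : ∀ y ∈ T, y ∈ W.X) (x₀ : Fin n → ℝ) {a b : ℝ}
    (ha : 0 < a) (hb : 0 ≤ b) (haR : ∀ y ∈ T, a ≤ R y)
    (hdist : ∀ y ∈ T, dist y x₀ + R y / 32 ≤ b) (hab : 32 * b ≤ 1000000 * a) :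
    T.card ≤ 1000000 ^ n := by
  have h := card_mul_pow_le_of_pairwiseDisjoint T (fun y => R y / 32) x₀ (a := a / 32) (b := b)
    (by positivity) hb (fun x hx y hy hxy => Metric.closedBall_disjoint_closedBall
      (W.sep_X x (hT x hx) y (hT y hy) hxy)) (fun x hx => by linarith [haR x hx])
      (fun x hx => Metric.closedBall_subset_closedBall' (by linarith [hdist x hx]))
  have h2 : b ^ n ≤ (1000000 * (a / 32)) ^ n := pow_le_pow_left₀ hb (by linarith) n
  rw [mul_pow] at h2
  have h3 : (T.card : ℝ) ≤ 1000000 ^ n :=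
    le_of_mul_le_mul_right (h.trans h2) (by positivity)
  exact_mod_cast h3

/-- Two points of the net with a common point in their supports. -/
theorem comparable_of_common {x y z : Fin n → ℝ} (hx : dist z x ≤ 2 * W.rad x)
    (hy : dist z y ≤ 2 * W.rad y) : R x ≤ 54 * R y ∧ dist x y ≤ 8 * R x + 8 * R y := by
  refine ⟨by linarith [(W.comparable hx).1, (W.comparable hy).2], ?_⟩
  linarith [dist_triangle_left x y z, W.rad_le x, W.rad_le y]

/-- The host cube at a point of the net. -/
noncomputable def host (x : Fin n → ℝ) : Cube n := ⟨x, W.hostRad x, W.hostRad_pos x⟩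

/-- The covering cube at a point of the net. -/
noncomputable def cell (x : Fin n → ℝ) : Cube n := ⟨x, W.rad x, W.rad_pos x⟩

theorem card_le_of_host_inter (x : Fin n → ℝ) (T : Finset (Fin n → ℝ))
    (hT : ∀ y ∈ T, y ∈ W.index)
    (h : ∀ y ∈ T, ¬ Disjoint (W.host x).toSet (W.host y).toSet) :
    T.card ≤ 1000000 ^ n := by
  have hx := W.pos x
  have key : ∀ y ∈ T, R x ≤ 54 * R y ∧ R y ≤ 54 * R x ∧ dist x y ≤ 8 * R x + 8 * R y := by
    intro y hy
    obtain ⟨z, hz1, hz2⟩ := Set.not_disjoint_iff.1 (h y hy)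
    have h1 : dist z x ≤ W.hostRad x := hz1
    have h2 : dist z y ≤ W.hostRad y := hz2
    have h1 : dist z x ≤ 2 * W.rad x := by linarith [W.hostRad_le_rad x, W.rad_pos x]
    have h2 : dist z y ≤ 2 * W.rad y := by linarith [W.hostRad_le_rad y, W.rad_pos y]
    exact ⟨(W.comparable_of_common h1 h2).1, (W.comparable_of_common h2 h1).1,
      (W.comparable_of_common h1 h2).2⟩
  have key' : ∀ y ∈ T, dist x y ≤ 220 * R x := by
    intro y hy
    obtain ⟨z, hz1, hz2⟩ := Set.not_disjoint_iff.1 (h y hy)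
    have h1 : dist z x ≤ W.hostRad x := hz1
    have h2 : dist z y ≤ W.hostRad y := hz2
    linarith [dist_triangle_left x y z, W.hostRad_le x, W.hostRad_le y, (key y hy).2.1]
  refine W.card_le T (fun y hy => W.index_subset (hT y hy)) x (a := R x / 54) (b := 222 * R x)
    (by positivity) (by positivity) (fun y hy => ?_) (fun y hy => ?_) (by linarith)
  · linarith [(key y hy).1]
  · have := key' y hy
    rw [dist_comm] at this
    linarith [(key y hy).2.1]

theorem host_disjoint {x t : Fin n → ℝ} (hx : x ∈ W.index) (ht : t ∈ W.S) (hxt : x ≠ t) :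
    Disjoint (W.host x).toSet (W.host t).toSet := by
  refine Metric.closedBall_disjoint_closedBall ?_
  change W.hostRad x + W.hostRad t < dist x t
  rw [W.hostRad_of_mem ht]
  by_cases h : x ∈ W.S
  · rw [W.hostRad_of_mem h]
    linarith [W.sep_S x h t ht hxt, W.pos x, W.pos t]
  · rw [W.hostRad_of_notMem h]
    exact hx.2.resolve_left h t ht

theorem countable_X : W.X.Countable := by
  refine Set.PairwiseDisjoint.countable_of_nonempty_interior
    (s := fun x => Metric.closedBall x (R x / 32)) (fun x hx y hy hxy =>
      Metric.closedBall_disjoint_closedBall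
        (W.sep_X x hx y hy hxy)) fun x _ => ?_
  have := W.pos x
  exact ⟨x, Metric.ball_subset_interior_closedBall (Metric.mem_ball_self (by positivity))⟩

theorem countable_index : W.index.Countable := W.countable_X.mono W.index_subset

/-- The cubes of a family of hosts fit into dilations. -/
theorem host_anchor_subset {x y : Fin n → ℝ} (hy : R y ≤ 54 * R x)
    (hd : dist x y ≤ 8 * R x + 8 * R y) :
    (W.host (W.anchor y)).toSet ⊆ (W.host x).dilate 100000 := by
  -- The host of the anchor has radius at most `4 * R y` and its centre is within `56 * R y + 8 * R
  -- x` of `x`; together at most `3248 * R x`, against a host radius of at least `R x / 8`. The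
  -- dilation factor 100000 is more than enough.
  refine Metric.closedBall_subset_closedBall' ?_
  change W.hostRad (W.anchor y) + dist (W.anchor y) x ≤ 100000 * W.hostRad x
  obtain ⟨-, h1, h2⟩ := W.anchor_spec y
  linarith [W.hostRad_le (W.anchor y), W.le_hostRad x, dist_triangle_left (W.anchor y) x y,
    dist_comm x y, W.pos x]

end ScaleNet



/-! ### Jensen's inequality and averages over cubes. -/

/-- Jensen's inequality in the form of Hölder's inequality. -/
theorem lintegral_rpow_le {α : Type*} [MeasurableSpace α] {ν : Measure α} {h : α → ℝ≥0∞}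
    (hh : AEMeasurable h ν) {p : ℝ} (hp : 1 ≤ p) :
    (∫⁻ x, h x ∂ν) ^ p ≤ ν Set.univ ^ (p - 1) * ∫⁻ x, h x ^ p ∂ν := by
  have h0 : 0 < p := by linarith
  have := eLpNorm'_le_eLpNorm'_mul_rpow_measure_univ (μ := ν) one_pos hp
    hh.aestronglyMeasurable
  simp only [eLpNorm', enorm_eq_self, ENNReal.rpow_one, div_one, one_div] at this
  refine (ENNReal.rpow_le_rpow this h0.le).trans (le_of_eq ?_)
  rw [ENNReal.mul_rpow_of_nonneg _ _ h0.le, ← ENNReal.rpow_mul, ← ENNReal.rpow_mul, mul_comm]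
  congr 2
  · field_simp
  · rw [inv_mul_cancel₀ h0.ne', ENNReal.rpow_one]

/-- Jensen's inequality for the deviation of an average from a constant. -/
theorem enorm_sub_average_rpow_mul_le {α : Type*} [MeasurableSpace α] {ν : Measure α}
    [IsFiniteMeasure ν] (hν : ν ≠ 0) {f : α → ℝ} {p : ℝ} (hp : 1 ≤ p)
    (hf : MemLp f (ENNReal.ofReal p) ν) (a : ℝ) :
    ‖a - ⨍ y, f y ∂ν‖ₑ ^ p * ν Set.univ ≤ ∫⁻ y, ‖a - f y‖ₑ ^ p ∂ν := by
  have h0 : 0 < p := by linarith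
  set m := ν Set.univ with hm
  have hm0 : m ≠ 0 := by rwa [hm, Ne, Measure.measure_univ_eq_zero]
  have hmt : m ≠ ⊤ := measure_ne_top _ _
  have hfi : Integrable f ν := hf.integrable (by simpa using hp)
  have h1 : ‖a - ⨍ y, f y ∂ν‖ₑ * m ≤ ∫⁻ y, ‖a - f y‖ₑ ∂ν := by
    have h2 : (a - ⨍ y, f y ∂ν) * ν.real Set.univ = ∫ y, (a - f y) ∂ν := by
      rw [integral_sub (integrable_const a) hfi, sub_mul, mul_comm (⨍ y, f y ∂ν)]
      have := measure_smul_average ν f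
      rw [smul_eq_mul] at this
      rw [this, integral_const, smul_eq_mul, mul_comm]
    have h3 : m = ‖ν.real Set.univ‖ₑ := by
      rw [Real.enorm_eq_ofReal measureReal_nonneg, Measure.real, ENNReal.ofReal_toReal hmt]
    rw [h3, ← enorm_mul, h2]
    exact enorm_integral_le_lintegral_enorm _
  have h4 : (‖a - ⨍ y, f y ∂ν‖ₑ * m) ^ p ≤ m ^ (p - 1) * ∫⁻ y, ‖a - f y‖ₑ ^ p ∂ν :=
    (ENNReal.rpow_le_rpow h1 h0.le).trans (lintegral_rpow_le
      ((aestronglyMeasurable_const.sub hf.1).enorm) hp)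
  rw [ENNReal.mul_rpow_of_nonneg _ _ h0.le] at h4
  have h5 : m ^ p = m ^ (p - 1) * m := by
    conv_rhs => rw [← ENNReal.rpow_one m, ← ENNReal.rpow_mul, one_mul,
      ← ENNReal.rpow_add _ _ hm0 hmt]
    congr 1; ring
  rw [h5, mul_left_comm] at h4
  exact (ENNReal.mul_le_mul_iff_right (by simp [ENNReal.rpow_eq_zero_iff, hm0, hmt])
    (ENNReal.rpow_ne_top_of_ne_zero hm0 hmt)).1 h4

theorem MemLpLoc.aemeasurable {p : ℝ} {μ : Measure (Fin n → ℝ)} {f : (Fin n → ℝ) → ℝ}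
    (hf : MemLpLoc p μ f) : AEMeasurable f μ := by
  have h : ∀ k : ℕ, AEMeasurable f (μ.restrict (Metric.closedBall 0 k)) := fun k =>
    (hf _ (isCompact_closedBall _ _)).1.aemeasurable
  have := aemeasurable_iUnion_iff.2 h
  rwa [Metric.iUnion_closedBall_nat, Measure.restrict_univ] at this

section Averages

variable {p : ℝ} {μ : Measure (Fin n → ℝ)} {f : (Fin n → ℝ) → ℝ}

theorem Cube.isCompact_toSet (K : Cube n) : IsCompact K.toSet := isCompact_closedBall _ _

theorem Cube.measurableSet_toSet (K : Cube n) : MeasurableSet K.toSet := measurableSet_closedBall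

theorem Cube.measure_ne_top (μ : Measure (Fin n → ℝ)) [IsLocallyFiniteMeasure μ] (K : Cube n) :
    μ K.toSet ≠ ⊤ := K.isCompact_toSet.measure_lt_top.ne

/-- Tonelli's theorem for the double integrals in `oscTerm`. -/
theorem lintegral_prod_diff [SFinite μ] (hf : AEMeasurable f μ) (W K : Set (Fin n → ℝ)) :
    ∫⁻ z in W ×ˢ K, ‖f z.1 - f z.2‖ₑ ^ p ∂(μ.prod μ) =
      ∫⁻ x in W, ∫⁻ y in K, ‖f x - f y‖ₑ ^ p ∂μ ∂μ := by
  rw [← Measure.prod_restrict, lintegral_prod]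
  have h1 : AEMeasurable (fun z : (Fin n → ℝ) × (Fin n → ℝ) => f z.1)
      ((μ.restrict W).prod (μ.restrict K)) := (hf.mono_measure Measure.restrict_le_self).comp_fst
  have h2 : AEMeasurable (fun z : (Fin n → ℝ) × (Fin n → ℝ) => f z.2)
      ((μ.restrict W).prod (μ.restrict K)) := (hf.mono_measure Measure.restrict_le_self).comp_snd
  exact (h1.sub h2).enorm.pow_const p

/-- The average of `f` over a cube. -/
noncomputable def cubeAverage (μ : Measure (Fin n → ℝ)) (f : (Fin n → ℝ) → ℝ) (K : Cube n) : ℝ :=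
  ⨍ y in K.toSet, f y ∂μ

theorem enorm_sub_cubeAverage_le [IsLocallyFiniteMeasure μ] (hp : 1 ≤ p) (hf : MemLpLoc p μ f) {K : Cube n}
    (hK : μ K.toSet ≠ 0) (a : ℝ) :
    ‖a - cubeAverage μ f K‖ₑ ^ p * μ K.toSet ≤ ∫⁻ y in K.toSet, ‖a - f y‖ₑ ^ p ∂μ := by
  have : IsFiniteMeasure (μ.restrict K.toSet) :=
    ⟨by rw [Measure.restrict_apply_univ]; exact K.isCompact_toSet.measure_lt_top⟩
  have h := enorm_sub_average_rpow_mul_le (ν := μ.restrict K.toSet)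
    (by rwa [Ne, Measure.restrict_eq_zero]) hp (hf _ K.isCompact_toSet) a
  rwa [Measure.restrict_apply_univ] at h

theorem lintegral_sub_cubeAverage_mul_le [IsLocallyFiniteMeasure μ] (hp : 1 ≤ p) (hf : MemLpLoc p μ f) {K : Cube n}
    (hK : μ K.toSet ≠ 0) (W : Set (Fin n → ℝ)) :
    (∫⁻ x in W, ‖f x - cubeAverage μ f K‖ₑ ^ p ∂μ) * μ K.toSet ≤
      ∫⁻ z in W ×ˢ K.toSet, ‖f z.1 - f z.2‖ₑ ^ p ∂(μ.prod μ) := by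
  rw [lintegral_prod_diff hf.aemeasurable, ← lintegral_mul_const' _ _ (K.measure_ne_top μ)]
  exact lintegral_mono fun x => enorm_sub_cubeAverage_le hp hf hK (f x)

/-- Jensen's inequality in each of the two variables turns a difference of averages into the double
integral of `oscTerm`. -/
theorem enorm_cubeAverage_sub_le [IsLocallyFiniteMeasure μ] (hp : 1 ≤ p) (hf : MemLpLoc p μ f) {K L : Cube n}
    (hK : μ K.toSet ≠ 0) (hL : μ L.toSet ≠ 0) :
    ‖cubeAverage μ f K - cubeAverage μ f L‖ₑ ^ p * (μ K.toSet * μ L.toSet) ≤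
      ∫⁻ z in K.toSet ×ˢ L.toSet, ‖f z.1 - f z.2‖ₑ ^ p ∂(μ.prod μ) := by
  refine le_trans ?_ (lintegral_sub_cubeAverage_mul_le hp hf hL K.toSet)
  rw [← mul_assoc]
  refine mul_le_mul_left (le_trans ?_ ((enorm_sub_cubeAverage_le hp hf hK
    (cubeAverage μ f L)).trans (le_of_eq ?_))) _
  · rw [← enorm_neg, neg_sub]
  · refine lintegral_congr fun y => ?_
    rw [← enorm_neg, neg_sub]

theorem Cube.diamPow_ne_top (p : ℝ) (Q : Cube n) : Q.diamPow p ≠ ⊤ := ENNReal.ofReal_ne_top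

theorem Cube.diamPow_ne_zero (hn : 0 < n) (p : ℝ) (Q : Cube n) : Q.diamPow p ≠ 0 := by
  rw [Q.diamPow_eq hn]
  have := Q.radius_pos
  simp only [ne_eq, ENNReal.ofReal_eq_zero, not_le]
  positivity

theorem oscTerm_denom_ne_zero (hn : 0 < n) (Q Q' : Cube n) :
    (Q.diamPow p + μ Q.toSet) * (Q'.diamPow p + μ Q'.toSet) ≠ 0 := by
  simp [Q.diamPow_ne_zero hn, Q'.diamPow_ne_zero hn]

theorem oscTerm_denom_ne_top [IsLocallyFiniteMeasure μ] (Q Q' : Cube n) :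
    (Q.diamPow p + μ Q.toSet) * (Q'.diamPow p + μ Q'.toSet) ≠ ⊤ :=
  ENNReal.mul_ne_top (ENNReal.add_ne_top.2 ⟨Q.diamPow_ne_top p, Q.measure_ne_top μ⟩)
    (ENNReal.add_ne_top.2 ⟨Q'.diamPow_ne_top p, Q'.measure_ne_top μ⟩)

/-- A lower bound for `oscTerm` by bounds of the denominators. -/
theorem le_mul_oscTerm [IsLocallyFiniteMeasure μ] (hn : 0 < n) {Q Q' Q'' : Cube n} {a C₁ C₂ c₁ c₂ : ℝ≥0∞}
    (h₁ : Q'.diamPow p + μ Q'.toSet ≤ C₁ * c₁) (h₂ : Q''.diamPow p + μ Q''.toSet ≤ C₂ * c₂)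
    (ha : a * (c₁ * c₂) ≤
      Q.diamPow p * ∫⁻ z in Q'.toSet ×ˢ Q''.toSet, ‖f z.1 - f z.2‖ₑ ^ p ∂(μ.prod μ)) :
    a ≤ C₁ * C₂ * oscTerm p μ f Q Q' Q'' := by
  rw [oscTerm, ← mul_div_assoc, ENNReal.le_div_iff_mul_le (Or.inl (oscTerm_denom_ne_zero hn Q' Q''))
    (Or.inl (oscTerm_denom_ne_top Q' Q''))]
  calc a * ((Q'.diamPow p + μ Q'.toSet) * (Q''.diamPow p + μ Q''.toSet))
      ≤ a * ((C₁ * c₁) * (C₂ * c₂)) := by gcongr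
    _ = C₁ * C₂ * (a * (c₁ * c₂)) := by ring
    _ ≤ _ := by gcongr

end Averages



/-! ### Estimates on single cells and their sums over the net. -/

theorem tsum_subtype_le_of_sum_le {α : Type*} {S : Set α} {g : α → ℝ≥0∞} {B : ℝ≥0∞}
    (h : ∀ F : Finset α, (∀ x ∈ F, x ∈ S) → ∑ x ∈ F, g x ≤ B) : ∑' x : S, g x ≤ B := by
  rw [ENNReal.tsum_eq_iSup_sum]
  refine iSup_le fun F => ?_
  have := h (F.map (Function.Embedding.subtype _)) (by simp +contextual)
  rwa [Finset.sum_map] at this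

theorem ofReal_rpow_le_mul {p : ℝ} (hp : (n : ℝ) < p) {r s a : ℝ} (hr : 0 < r)
    (ha : 0 < a) (h : r ≤ a * s) :
    ENNReal.ofReal (s ^ ((n : ℝ) - p)) ≤
      ENNReal.ofReal (a⁻¹ ^ ((n : ℝ) - p)) * ENNReal.ofReal (r ^ ((n : ℝ) - p)) := by
  rw [← ENNReal.ofReal_mul (by positivity), ← Real.mul_rpow (by positivity) hr.le]
  refine ofReal_rpow_le_of_le hp (by positivity) ?_
  rw [inv_mul_le_iff₀ ha]
  exact h

section Cells

variable {p : ℝ} {μ : Measure (Fin n → ℝ)} {f : (Fin n → ℝ) → ℝ}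
  (W : ScaleNet (critRadius p μ : (Fin n → ℝ) → ℝ))

/-- The values of `f` that are attached to the points of the net. -/
noncomputable def netValue (f : (Fin n → ℝ) → ℝ) (x : Fin n → ℝ) : ℝ :=
  cubeAverage μ f (W.host (W.anchor x))

/-- At `S` the host has twice the critical radius, so its measure dominates. The corresponding
bracket in the denominator of `oscTerm` is then comparable with the measure, as averaging requires.
-/
theorem diamPow_host_le [IsLocallyFiniteMeasure μ] (hn : 0 < n) (hp : (n : ℝ) < p) (hμ : μ ≠ 0) {s : Fin n → ℝ}
    (hs : s ∈ W.S) : (W.host s).diamPow p ≤ μ (W.host s).toSet := by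
  rw [(W.host s).diamPow_eq hn]
  have h1 : (W.host s).radius = 2 * critRadius p μ s := W.hostRad_of_mem hs
  have h2 : (W.host s).toSet = Metric.closedBall s (2 * critRadius p μ s) := by
    rw [← h1]; rfl
  have := W.pos s
  rw [h2, h1]
  exact (ofReal_rpow_le_of_le hp (by positivity) (by linarith)).trans
    (le_measure_closedBall_critRadius μ hp hμ s)

theorem measure_host_ne_zero [IsLocallyFiniteMeasure μ] (hn : 0 < n) (hp : (n : ℝ) < p) (hμ : μ ≠ 0) {s : Fin n → ℝ}
    (hs : s ∈ W.S) : μ (W.host s).toSet ≠ 0 := fun h => by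
  have := diamPow_host_le W hn hp hμ hs
  rw [h] at this
  exact (W.host s).diamPow_ne_zero hn p (le_antisymm this bot_le)

theorem host_denom_le [IsLocallyFiniteMeasure μ] (hn : 0 < n) (hp : (n : ℝ) < p) (hμ : μ ≠ 0) {s : Fin n → ℝ}
    (hs : s ∈ W.S) : (W.host s).diamPow p + μ (W.host s).toSet ≤ 2 * μ (W.host s).toSet := by
  rw [two_mul]
  gcongr
  exact diamPow_host_le W hn hp hμ hs

/-- Both values are averages over heavy hosts, so Jensen's inequality cancels the brackets up to a
factor 2 each. The factor with `4⁻¹` compares the critical radius with the diameter of the host, at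
most four times as large. -/
theorem netValue_sub_le [IsLocallyFiniteMeasure μ] (hn : 0 < n) (hp : (n : ℝ) < p) (hp1 : 1 ≤ p) (hμ : μ ≠ 0)
    (hf : MemLpLoc p μ f) (x y : Fin n → ℝ) :
    ENNReal.ofReal (critRadius p μ x ^ ((n : ℝ) - p)) * ‖netValue W f x - netValue W f y‖ₑ ^ p ≤
      ENNReal.ofReal (4⁻¹ ^ ((n : ℝ) - p)) * (2 * 2) *
        oscTerm p μ f (W.host x) (W.host (W.anchor x)) (W.host (W.anchor y)) := by
  have hx := (W.anchor_spec x).1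
  have hy := (W.anchor_spec y).1
  have h1 : ENNReal.ofReal (critRadius p μ x ^ ((n : ℝ) - p)) ≤
      ENNReal.ofReal (4⁻¹ ^ ((n : ℝ) - p)) * (W.host x).diamPow p := by
    rw [(W.host x).diamPow_eq hn]
    have h2 : (W.host x).radius ≤ 2 * critRadius p μ x := W.hostRad_le x
    exact ofReal_rpow_le_mul hp (by linarith [(W.host x).radius_pos]) (by norm_num)
      (by linarith)
  refine (mul_le_mul_left h1 _).trans ?_
  rw [mul_assoc, mul_assoc]
  refine mul_le_mul_right (le_mul_oscTerm hn (host_denom_le W hn hp hμ hx)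
    (host_denom_le W hn hp hμ hy) ?_) _
  rw [mul_assoc]
  exact mul_le_mul_right (enorm_cubeAverage_sub_le hp1 hf (measure_host_ne_zero W hn hp hμ hx)
    (measure_host_ne_zero W hn hp hμ hy)) _

theorem measure_cell_le {x : Fin n → ℝ} (hx : x ∉ W.S) :
    μ (W.cell x).toSet ≤ ENNReal.ofReal ((critRadius p μ x / 8) ^ ((n : ℝ) - p)) := by
  have h2 : (W.cell x).toSet = Metric.closedBall x (critRadius p μ x / 8) := by
    rw [← W.rad_of_notMem hx]; rfl
  have := W.pos x
  rw [h2]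
  exact measure_closedBall_le_of_lt_critRadius μ x (by linarith) (by linarith)

/-- Off `S` host and cell coincide and have subcritical radius, so the bracket of the cell is
comparable with its `diamPow` and cancels the factor in front of the integral; the bracket of the
anchor cancels by averaging. -/
theorem lintegral_cell_le_of_notMem [IsLocallyFiniteMeasure μ] (hn : 0 < n) (hp : (n : ℝ) < p) (hp1 : 1 ≤ p) (hμ : μ ≠ 0)
    (hf : MemLpLoc p μ f) {x : Fin n → ℝ} (hx : x ∉ W.S) :
    ∫⁻ z in (W.cell x).toSet, ‖f z - netValue W f x‖ₑ ^ p ∂μ ≤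
      (1 + ENNReal.ofReal (2⁻¹ ^ ((n : ℝ) - p))) * 2 *
        oscTerm p μ f (W.host x) (W.host x) (W.host (W.anchor x)) := by
  have hs := (W.anchor_spec x).1
  have hset : (W.host x).toSet = (W.cell x).toSet := by
    change Metric.closedBall x (W.hostRad x) = Metric.closedBall x (W.rad x)
    rw [W.hostRad_of_notMem hx, W.rad_of_notMem hx]
  have hpos := W.pos x
  refine le_mul_oscTerm hn (c₁ := (W.host x).diamPow p) ?_ (host_denom_le W hn hp hμ hs) ?_
  · rw [add_mul, one_mul]
    gcongr
    rw [hset]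
    refine (measure_cell_le W hx).trans ?_
    rw [(W.host x).diamPow_eq hn]
    refine ofReal_rpow_le_mul hp (by linarith [(W.host x).radius_pos])
      (by norm_num) ?_
    rw [← W.hostRad_of_notMem hx]
    exact le_rfl
  · rw [mul_left_comm, hset]
    exact mul_le_mul_right (lintegral_sub_cubeAverage_mul_le hp1 hf
      (measure_host_ne_zero W hn hp hμ hs) _) _

/-- The cell at `s` exceeds the critical radius of `s`, so no direct bound applies. It is covered by
subcritical balls of radius `R / 8` about net points; their scale is at least `R s / 6` by
`le_of_dist_le`, hence the number 48 and a packing bound on how many there are. -/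
theorem measure_cell_le_of_mem (hp : (n : ℝ) < p) {s : Fin n → ℝ} (hs : s ∈ W.S) :
    μ (W.cell s).toSet ≤ (1000000 ^ n : ℕ) *
      ENNReal.ofReal ((critRadius p μ s / 48) ^ ((n : ℝ) - p)) := by
  have hpos := W.pos s
  set T : Set (Fin n → ℝ) := {x ∈ W.X | dist x s ≤ 5 * critRadius p μ s} with hT
  have hTle : ∀ x ∈ T, critRadius p μ s ≤ 6 * critRadius p μ x ∧ critRadius p μ x ≤ 6 * critRadius p μ s := fun x hx =>
    ⟨W.le_of_dist_le hs (hx.2.trans (by linarith)), by linarith [W.lip x s, hx.2]⟩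
  have hcov : (W.cell s).toSet ⊆ ⋃ x ∈ T, Metric.closedBall x (critRadius p μ x / 8) := by
    intro z hz
    have hz : dist z s ≤ W.rad s := hz
    rw [W.rad_of_mem hs] at hz
    obtain ⟨x, hx, hzx⟩ := W.exists_mem_X z
    refine Set.mem_iUnion₂.2 ⟨x, ⟨hx, ?_⟩, hzx⟩
    linarith [dist_triangle_left x s z, W.lip x s]
  refine (measure_mono hcov).trans ((measure_biUnion_le μ
    (W.countable_X.mono fun x hx => hx.1) _).trans ?_)
  refine tsum_subtype_le_of_sum_le (g := fun x => μ (Metric.closedBall x (critRadius p μ x / 8))) fun F hF => ?_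
  have hterm : ∀ x ∈ F, μ (Metric.closedBall x (critRadius p μ x / 8)) ≤
      ENNReal.ofReal ((critRadius p μ s / 48) ^ ((n : ℝ) - p)) := fun x hx => by
    have := W.pos x
    exact (measure_closedBall_le_of_lt_critRadius μ x (by positivity)
      (by linarith)).trans
      (ofReal_rpow_le_of_le hp (by positivity) (by linarith [(hTle x (hF x hx)).1]))
  refine (Finset.sum_le_card_nsmul _ _ _ hterm).trans ?_
  rw [nsmul_eq_mul]
  gcongr
  refine W.card_le F (fun x hx => (hF x hx).1) s (a := critRadius p μ s / 6) (b := 6 * critRadius p μ s) (by positivity)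
    (by positivity) (fun x hx => by linarith [(hTle x (hF x hx)).1]) (fun x hx => ?_)
    (by linarith)
  linarith [(hF x hx).2, (hTle x (hF x hx)).2]

/-- All three cubes are the cell itself. One bracket cancels the prefactor; the other is bounded by
the measure of the host, over which the average is taken. The number 384 is the ratio of the
diameter `8 * R` to `R / 48`. -/
theorem lintegral_cell_le_of_mem [IsLocallyFiniteMeasure μ] (hn : 0 < n) (hp : (n : ℝ) < p) (hp1 : 1 ≤ p) (hμ : μ ≠ 0)
    (hf : MemLpLoc p μ f) {s : Fin n → ℝ} (hs : s ∈ W.S) :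
    ∫⁻ z in (W.cell s).toSet, ‖f z - netValue W f s‖ₑ ^ p ∂μ ≤
      (1 + (1000000 ^ n : ℕ) * ENNReal.ofReal (384⁻¹ ^ ((n : ℝ) - p))) *
      (1 + (1000000 ^ n : ℕ) * ENNReal.ofReal (384⁻¹ ^ ((n : ℝ) - p))) *
        oscTerm p μ f (W.cell s) (W.cell s) (W.cell s) := by
  have hpos := W.pos s
  have hden : (W.cell s).diamPow p + μ (W.cell s).toSet ≤
      (1 + (1000000 ^ n : ℕ) * ENNReal.ofReal (384⁻¹ ^ ((n : ℝ) - p))) * (W.cell s).diamPow p := by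
    rw [add_mul, one_mul]
    refine add_le_add_right ((measure_cell_le_of_mem W hp hs).trans ?_) _
    rw [mul_assoc]
    refine mul_le_mul_right ?_ _
    rw [(W.cell s).diamPow_eq hn]
    have : (W.cell s).radius = 4 * critRadius p μ s := W.rad_of_mem hs
    refine ofReal_rpow_le_mul hp (by linarith [(W.cell s).radius_pos])
      (by norm_num) ?_
    rw [this]; linarith
  have hsub : (W.host s).toSet ⊆ (W.cell s).toSet :=
    Metric.closedBall_subset_closedBall (W.hostRad_le_rad s)
  have hD : (W.cell s).diamPow p ≤ μ (W.host s).toSet := by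
    refine le_trans ?_ (diamPow_host_le W hn hp hμ hs)
    rw [(W.cell s).diamPow_eq hn, (W.host s).diamPow_eq hn]
    refine ofReal_rpow_le_of_le hp (by linarith [(W.host s).radius_pos]) ?_
    have : (W.host s).radius ≤ (W.cell s).radius := W.hostRad_le_rad s
    linarith
  refine le_mul_oscTerm hn hden hden ?_
  rw [mul_left_comm]
  refine mul_le_mul_right ((mul_le_mul_right hD _).trans ?_) _
  have h := lintegral_sub_cubeAverage_mul_le hp1 hf (measure_host_ne_zero W hn hp hμ hs)
    (W.cell s).toSet
  rw [netValue, W.anchor_of_mem hs]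
  exact h.trans (lintegral_mono_set (Set.prod_mono_right hsub))

variable {lam : ℝ}

/-- The family consists of the hosts, with the anchors of `x` and of `y x` as partners. A single map
`y` is enough because it will be the neighbour with the largest deviation. -/
theorem sum_netValue_sub_le [IsLocallyFiniteMeasure μ] (hn : 0 < n) (hp : (n : ℝ) < p) (hp1 : 1 ≤ p) (hμ : μ ≠ 0)
    (hf : MemLpLoc p μ f) (hosc : OscBound 100000 p μ f lam) (F : Finset (Fin n → ℝ))
    (hF : ∀ x ∈ F, x ∈ W.index) (y : (Fin n → ℝ) → (Fin n → ℝ))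
    (hy : ∀ x ∈ F, critRadius p μ (y x) ≤ 54 * critRadius p μ x ∧
      dist x (y x) ≤ 8 * critRadius p μ x + 8 * critRadius p μ (y x)) :
    ∑ x ∈ F, ENNReal.ofReal (critRadius p μ x ^ ((n : ℝ) - p)) *
        ‖netValue W f x - netValue W f (y x)‖ₑ ^ p ≤
      ENNReal.ofReal (4⁻¹ ^ ((n : ℝ) - p)) * (2 * 2) *
        ((1000000 ^ n : ℕ) * ENNReal.ofReal lam) := by
  refine (Finset.sum_le_sum fun x _ => netValue_sub_le W hn hp hp1 hμ hf x (y x)).trans ?_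
  rw [← Finset.mul_sum]
  refine mul_le_mul_right (hosc.sum_le_of_overlap (by norm_num) W.host W.index W.S
    (fun i hi j hj hij => W.host_disjoint hi hj hij) W.S_subset_index _ F hF
    (fun i hi T hT h => W.card_le_of_host_inter i T (fun j hj => hF j (hT hj)) h)
    W.anchor (fun x => W.anchor (y x)) (fun i _ => Or.inr (W.anchor_spec i).1)
    (fun i _ => Or.inr (W.anchor_spec _).1) fun i hi => Set.union_subset
      (W.host_anchor_subset ?_ ?_) (W.host_anchor_subset (hy i hi).1 (hy i hi).2)) _
  · linarith [W.pos i]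
  · rw [dist_self]; linarith [W.pos i]

/-- Cells at `S` are disjoint and are their own partners. The other cells are hosts of bounded
overlap, with themselves and their anchors as partners. -/
theorem sum_lintegral_cell_le [IsLocallyFiniteMeasure μ] (hn : 0 < n) (hp : (n : ℝ) < p) (hp1 : 1 ≤ p) (hμ : μ ≠ 0)
    (hf : MemLpLoc p μ f) (hosc : OscBound 100000 p μ f lam) (F : Finset (Fin n → ℝ))
    (hF : ∀ x ∈ F, x ∈ W.index) :
    ∑ x ∈ F, ∫⁻ z in (W.cell x).toSet, ‖f z - netValue W f x‖ₑ ^ p ∂μ ≤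
      (1 + (1000000 ^ n : ℕ) * ENNReal.ofReal (384⁻¹ ^ ((n : ℝ) - p))) *
      (1 + (1000000 ^ n : ℕ) * ENNReal.ofReal (384⁻¹ ^ ((n : ℝ) - p))) * ENNReal.ofReal lam +
      (1 + ENNReal.ofReal (2⁻¹ ^ ((n : ℝ) - p))) * 2 *
        ((1000000 ^ n : ℕ) * ENNReal.ofReal lam) := by
  classical
  rw [← Finset.sum_filter_add_sum_filter_not F (· ∈ W.S)]
  refine add_le_add ?_ ?_
  · refine (Finset.sum_le_sum fun x hx => lintegral_cell_le_of_mem W hn hp hp1 hμ hf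
      (Finset.mem_filter.1 hx).2).trans ?_
    rw [← Finset.mul_sum]
    refine mul_le_mul_right (hosc.sum_le _ W.cell id id ?_ fun i hi => ⟨hi, hi, ?_⟩) _
    · intro i hi j hj hij
      have hi := (Finset.mem_filter.1 hi).2
      have hj := (Finset.mem_filter.1 hj).2
      refine Metric.closedBall_disjoint_closedBall ?_
      change W.rad i + W.rad j < dist i j
      linarith [W.rad_le i, W.rad_le j, W.sep_S i hi j hj hij, W.pos i, W.pos j]
    · rw [Set.union_self]
      exact Metric.closedBall_subset_closedBall (by simp only [id]; linarith [(W.cell i).radius_pos])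
  · refine (Finset.sum_le_sum fun x hx => lintegral_cell_le_of_notMem W hn hp hp1 hμ hf
      (Finset.mem_filter.1 hx).2).trans ?_
    rw [← Finset.mul_sum]
    refine mul_le_mul_right (hosc.sum_le_of_overlap (by norm_num) W.host W.index W.S
      (fun i hi j hj hij => W.host_disjoint hi hj hij) W.S_subset_index _ _
      (fun i hi => hF i (Finset.mem_filter.1 hi).1)
      (fun i hi T hT h => W.card_le_of_host_inter i T
        (fun j hj => hF j (Finset.mem_filter.1 (hT hj)).1) h)
      id W.anchor (fun i _ => Or.inl rfl)
      (fun i _ => Or.inr (W.anchor_spec _).1) fun i hi => Set.union_subset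
      (Metric.closedBall_subset_closedBall ?_) (W.host_anchor_subset ?_ ?_)) _
    · simp only [id]; linarith [(W.host i).radius_pos]
    · linarith [W.pos i]
    · rw [dist_self]; linarith [W.pos i]

end Cells



/-! ### Smooth interpolation of the values on the net. -/

section WeightedAverage

variable {E ι : Type*} [NormedAddCommGroup E] [NormedSpace ℝ E]

theorem abs_weighted_average_sub_le (T : Finset ι) (w c : ι → ℝ) (hw : ∀ i ∈ T, 0 ≤ w i)
    (hsum : 1 ≤ ∑ i ∈ T, w i) {a M : ℝ} (hM : ∀ i ∈ T, w i ≠ 0 → |c i - a| ≤ M) :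
    |(∑ i ∈ T, w i * c i) / (∑ i ∈ T, w i) - a| ≤ M := by
  have hpos : 0 < ∑ i ∈ T, w i := by linarith
  have h1 : (∑ i ∈ T, w i * c i) / (∑ i ∈ T, w i) - a =
      (∑ i ∈ T, w i * (c i - a)) / (∑ i ∈ T, w i) := by
    simp only [mul_sub, Finset.sum_sub_distrib, ← Finset.sum_mul]
    field_simp
  rw [h1, abs_div, abs_of_pos hpos, div_le_iff₀ hpos, Finset.mul_sum]
  refine (Finset.abs_sum_le_sum_abs _ _).trans (Finset.sum_le_sum fun i hi => ?_)
  rw [abs_mul, abs_of_nonneg (hw i hi), mul_comm M]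
  by_cases h0 : w i = 0
  · simp [h0]
  · exact mul_le_mul_of_nonneg_left (hM i hi h0) (hw i hi)

/-- The gradient of a weighted average is controlled by the oscillation of the values. -/
theorem norm_fderiv_weighted_average_le (T : Finset ι) (w : ι → E → ℝ) (c : ι → ℝ) (z : E)
    (hd : ∀ i ∈ T, DifferentiableAt ℝ (w i) z) (hw : ∀ i ∈ T, 0 ≤ w i z)
    (hsum : 1 ≤ ∑ i ∈ T, w i z) {a M L : ℝ} (hM0 : 0 ≤ M) (hL0 : 0 ≤ L)
    (hL : ∀ i ∈ T, ‖fderiv ℝ (w i) z‖ ≤ L)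
    (hM : ∀ i ∈ T, w i z ≠ 0 ∨ fderiv ℝ (w i) z ≠ 0 → |c i - a| ≤ M) :
    ‖fderiv ℝ (fun y => (∑ i ∈ T, w i y * c i) / (∑ i ∈ T, w i y)) z‖ ≤ 2 * T.card * L * M := by
  set D := ∑ i ∈ T, w i z with hD
  set D' := ∑ i ∈ T, fderiv ℝ (w i) z with hD'
  set P := ∑ i ∈ T, w i z * (c i - a) with hP
  set P' := ∑ i ∈ T, (c i - a) • fderiv ℝ (w i) z with hP'
  have hpos : 0 < D := by linarith
  have h1 : HasFDerivAt (fun y => ∑ i ∈ T, w i y) D' z :=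
    HasFDerivAt.fun_sum fun i hi => (hd i hi).hasFDerivAt
  have h2 : HasFDerivAt (fun y => ∑ i ∈ T, w i y * c i)
      (∑ i ∈ T, c i • fderiv ℝ (w i) z) z :=
    HasFDerivAt.fun_sum fun i hi => (hd i hi).hasFDerivAt.mul_const (c i)
  have h3 : HasFDerivAt (fun y => (∑ i ∈ T, w i y)⁻¹) (-(D ^ 2)⁻¹ • D') z :=
    (hasDerivAt_inv hpos.ne').comp_hasFDerivAt z h1
  have e1 : (∑ i ∈ T, c i • fderiv ℝ (w i) z) = P' + a • D' := by
    simp only [hP', sub_smul, Finset.sum_sub_distrib, hD', Finset.smul_sum]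
    module
  have e2 : (∑ i ∈ T, w i z * c i) = P + a * D := by
    simp only [hP, mul_sub, Finset.sum_sub_distrib, hD, ← Finset.sum_mul]
    ring
  -- The numerator of the quotient rule is unchanged when `a` is subtracted from all values, so only
  -- the deviations `c i - a` enter.
  have h4 : fderiv ℝ (fun y => (∑ i ∈ T, w i y * c i) / (∑ i ∈ T, w i y)) z =
      (D ^ 2)⁻¹ • (D • P' - P • D') := by
    simp only [div_eq_mul_inv]
    rw [(h2.fun_mul h3).fderiv, e1, e2, ← hD]
    ext v
    simp only [add_apply, sub_apply,
      smul_apply, smul_eq_mul]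
    field_simp
    ring
  have hP'le : ‖P'‖ ≤ T.card * L * M := by
    refine (norm_sum_le_of_le T (f := fun i => (c i - a) • fderiv ℝ (w i) z)
      (n := fun _ => L * M) fun i hi => ?_).trans (le_of_eq ?_)
    · rw [norm_smul, mul_comm]
      by_cases h0 : fderiv ℝ (w i) z = 0
      · rw [h0, norm_zero, zero_mul]; positivity
      · exact mul_le_mul (hL i hi) (hM i hi (Or.inr h0)) (norm_nonneg _) hL0
    · simp [mul_assoc]
  have hD'le : ‖D'‖ ≤ T.card * L := by
    refine (norm_sum_le_of_le T hL).trans (le_of_eq ?_)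
    simp
  have hPle : |P| ≤ M * D := by
    have h6 := abs_weighted_average_sub_le T (fun i => w i z) c hw hsum
      (fun i hi h => hM i hi (Or.inl h))
    have h7 : (∑ i ∈ T, w i z * c i) / (∑ i ∈ T, w i z) - a = P / D := by
      simp only [hP, mul_sub, Finset.sum_sub_distrib, ← Finset.sum_mul]
      rw [← hD]
      field_simp
    rwa [h7, abs_div, abs_of_pos hpos, div_le_iff₀ hpos] at h6
  rw [h4, norm_smul, norm_inv, norm_pow, Real.norm_of_nonneg hpos.le,
    inv_mul_le_iff₀ (by positivity)]
  calc ‖D • P' - P • D'‖ ≤ ‖D • P'‖ + ‖P • D'‖ := norm_sub_le _ _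
    _ = D * ‖P'‖ + |P| * ‖D'‖ := by
        rw [norm_smul, norm_smul, Real.norm_of_nonneg hpos.le, Real.norm_eq_abs]
    _ ≤ D * (T.card * L * M) + (M * D) * (T.card * L) := by gcongr
    _ = D * (2 * T.card * L * M) := by ring
    _ ≤ D ^ 2 * (2 * T.card * L * M) := by
        refine mul_le_mul_of_nonneg_right ?_ (by positivity)
        nlinarith

end WeightedAverage

/-- A fixed smooth bump function at unit scale. -/
noncomputable def unitBump (n : ℕ) : ContDiffBump (0 : Fin n → ℝ) := ⟨1, 2, one_pos, one_lt_two⟩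

theorem exists_bound_fderiv_unitBump (n : ℕ) :
    ∃ L : ℝ, 0 ≤ L ∧ ∀ z, ‖fderiv ℝ (unitBump n) z‖ ≤ L := by
  have hc : ContDiff ℝ ∞ (unitBump n) := (unitBump n).contDiff
  obtain ⟨L, hL⟩ := (hc.continuous_fderiv (by simp)).bounded_above_of_compact_support
    ((unitBump n).hasCompactSupport.fderiv ℝ)
  exact ⟨L, (norm_nonneg _).trans (hL 0), hL⟩

namespace ScaleNet

variable {R : (Fin n → ℝ) → ℝ} (W : ScaleNet R)

/-- The bump function of a cell. -/
noncomputable def bump (x z : Fin n → ℝ) : ℝ := unitBump n ((W.rad x)⁻¹ • (z - x))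

theorem bump_nonneg (x z : Fin n → ℝ) : 0 ≤ W.bump x z := (unitBump n).nonneg

theorem norm_smul_sub (x z : Fin n → ℝ) : dist ((W.rad x)⁻¹ • (z - x)) 0 = dist z x / W.rad x := by
  rw [dist_zero_right, norm_smul, norm_inv, Real.norm_of_nonneg (W.rad_pos x).le, dist_eq_norm]
  ring

theorem bump_eq_one {x z : Fin n → ℝ} (h : dist z x ≤ W.rad x) : W.bump x z = 1 := by
  refine (unitBump n).one_of_mem_closedBall ?_
  rw [Metric.mem_closedBall, W.norm_smul_sub, div_le_iff₀ (W.rad_pos x)]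
  simpa [unitBump] using h

theorem bump_eq_zero {x z : Fin n → ℝ} (h : 2 * W.rad x ≤ dist z x) : W.bump x z = 0 := by
  refine (unitBump n).zero_of_le_dist ?_
  rw [W.norm_smul_sub, le_div_iff₀ (W.rad_pos x)]
  exact h

theorem contDiff_bump (x : Fin n → ℝ) : ContDiff ℝ ∞ (W.bump x) :=
  (unitBump n).contDiff.comp ((contDiff_id.sub contDiff_const).const_smul _)

theorem fderiv_bump (x z : Fin n → ℝ) :
    fderiv ℝ (W.bump x) z = (W.rad x)⁻¹ • fderiv ℝ (unitBump n) ((W.rad x)⁻¹ • (z - x)) := by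
  have h1 : HasFDerivAt (fun z : Fin n → ℝ => (W.rad x)⁻¹ • (z - x))
      ((W.rad x)⁻¹ • ContinuousLinearMap.id ℝ (Fin n → ℝ)) z :=
    ((hasFDerivAt_id z).sub_const x).fun_const_smul _
  have h2 : DifferentiableAt ℝ (unitBump n) ((W.rad x)⁻¹ • (z - x)) :=
    ((unitBump n).contDiff (n := 1)).differentiable (by simp) _
  have h3 := h2.hasFDerivAt.comp z h1
  have h4 : fderiv ℝ (W.bump x) z = _ := h3.fderiv
  rw [h4]
  ext v
  simp

theorem fderiv_bump_eq_zero {x z : Fin n → ℝ} (h : 2 * W.rad x < dist z x) :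
    fderiv ℝ (W.bump x) z = 0 := by
  have h1 : W.bump x =ᶠ[nhds z] fun _ => 0 := by
    have : ∀ᶠ y in nhds z, 2 * W.rad x < dist y x :=
      (continuous_id.dist continuous_const).continuousAt.eventually (lt_mem_nhds h)
    filter_upwards [this] with y hy using W.bump_eq_zero hy.le
  rw [h1.fderiv_eq]
  simp

/-- The points of the net that are relevant near a point. -/
def near (z : Fin n → ℝ) : Set (Fin n → ℝ) :=
  {x ∈ W.index | R z / 10 ≤ R x ∧ R x ≤ 7 * R z ∧ dist x z ≤ 57 * R z}

theorem finite_of_card_le {α : Type*} {S : Set α} {N : ℕ}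
    (h : ∀ T : Finset α, (∀ y ∈ T, y ∈ S) → T.card ≤ N) : S.Finite := by
  by_contra hinf
  obtain ⟨T, hT, hcard⟩ := Set.Infinite.exists_subset_card_eq hinf (N + 1)
  have := h T fun y hy => hT hy
  omega

theorem card_near_le (z : Fin n → ℝ) (T : Finset (Fin n → ℝ)) (hT : ∀ y ∈ T, y ∈ W.near z) :
    T.card ≤ 1000000 ^ n := by
  have hz := W.pos z
  exact W.card_le T (fun y hy => W.index_subset (hT y hy).1) z (a := R z / 10) (b := 58 * R z)
    (by positivity) (by positivity) (fun y hy => (hT y hy).2.1)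
    (fun y hy => by linarith [(hT y hy).2.2.2, (hT y hy).2.2.1]) (by linarith)

theorem finite_near (z : Fin n → ℝ) : (W.near z).Finite := finite_of_card_le (W.card_near_le z)

/-- The relevant points as a finite set. -/
noncomputable def nearFinset (z : Fin n → ℝ) : Finset (Fin n → ℝ) := (W.finite_near z).toFinset

theorem mem_nearFinset {x z : Fin n → ℝ} : x ∈ W.nearFinset z ↔ x ∈ W.near z := by
  simp [nearFinset]

/-- The constants in `near` come from here: `R y` differs from `R z` by at most a tenth, and
`comparable` relates `R x` to `R y`. -/
theorem bump_eq_zero_of_notMem_near {x y z : Fin n → ℝ} (hx : x ∈ W.index) (hn : x ∉ W.near z)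
    (hy : dist y z ≤ R z / 10) : W.bump x y = 0 := by
  by_contra h0
  have h1 : dist y x ≤ 2 * W.rad x := by
    by_contra! h
    exact h0 (W.bump_eq_zero h.le)
  obtain ⟨h2, h3⟩ := W.comparable h1
  have h4 := W.lip y z
  have h5 := W.lip z y
  rw [dist_comm] at h5
  have hz := W.pos z
  have h6 := W.rad_le x
  exact hn ⟨hx, by linarith, by linarith, by linarith [dist_triangle_left x z y]⟩

/-- The smooth interpolation of values prescribed on the net. -/
noncomputable def interp (c : (Fin n → ℝ) → ℝ) (z : Fin n → ℝ) : ℝ :=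
  (∑' x : W.index, W.bump x z * c x) / ∑' x : W.index, W.bump x z

/-- One finite index set serves a whole neighbourhood of `z`, so `interp` is locally a quotient of
finite smooth sums. -/
theorem tsum_bump_eq (c : (Fin n → ℝ) → ℝ) {y z : Fin n → ℝ} (hy : dist y z ≤ R z / 10) :
    ∑' x : W.index, W.bump x y * c x = ∑ x ∈ W.nearFinset z, W.bump x y * c x := by
  rw [tsum_subtype W.index (fun x => W.bump x y * c x), tsum_eq_sum (s := W.nearFinset z)]
  · refine Finset.sum_congr rfl fun x hx => ?_
    rw [Set.indicator_of_mem]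
    exact (W.mem_nearFinset.1 hx).1
  · intro x hx
    by_cases hxI : x ∈ W.index
    · rw [Set.indicator_of_mem hxI,
        W.bump_eq_zero_of_notMem_near hxI (fun h => hx (W.mem_nearFinset.2 h)) hy, zero_mul]
    · rw [Set.indicator_of_notMem hxI]

theorem interp_eq (c : (Fin n → ℝ) → ℝ) {y z : Fin n → ℝ} (hy : dist y z ≤ R z / 10) :
    W.interp c y =
      (∑ x ∈ W.nearFinset z, W.bump x y * c x) / ∑ x ∈ W.nearFinset z, W.bump x y := by
  have := W.tsum_bump_eq (fun _ => 1) hy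
  simp only [mul_one] at this
  rw [interp, W.tsum_bump_eq c hy, this]

theorem one_le_sum_bump {y z : Fin n → ℝ} (hy : dist y z ≤ R z / 10) :
    1 ≤ ∑ x ∈ W.nearFinset z, W.bump x y := by
  obtain ⟨x, hx, hyx⟩ := W.exists_mem_index y
  have h1 := W.bump_eq_one hyx
  have hmem : x ∈ W.nearFinset z := by
    rw [W.mem_nearFinset]
    by_contra h
    rw [W.bump_eq_zero_of_notMem_near hx h hy] at h1
    exact zero_ne_one h1
  rw [← h1]
  exact Finset.single_le_sum (f := fun x => W.bump x y) (fun i _ => W.bump_nonneg i y) hmem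

theorem interp_eventuallyEq (c : (Fin n → ℝ) → ℝ) (z : Fin n → ℝ) :
    W.interp c =ᶠ[nhds z] fun y =>
      (∑ x ∈ W.nearFinset z, W.bump x y * c x) / ∑ x ∈ W.nearFinset z, W.bump x y := by
  have hz := W.pos z
  filter_upwards [Metric.closedBall_mem_nhds z (show 0 < R z / 10 by positivity)] with y hy
    using W.interp_eq c hy

theorem contDiff_interp (c : (Fin n → ℝ) → ℝ) : ContDiff ℝ ∞ (W.interp c) := by
  rw [contDiff_iff_contDiffAt]
  intro z
  have hz := W.pos z
  refine ContDiffAt.congr_of_eventuallyEq ?_ (W.interp_eventuallyEq c z)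
  refine ContDiffAt.div ?_ ?_ ?_
  · exact ContDiffAt.sum fun x _ => (W.contDiff_bump x).contDiffAt.mul contDiffAt_const
  · exact ContDiffAt.sum fun x _ => (W.contDiff_bump x).contDiffAt
  · have := W.one_le_sum_bump (y := z) (z := z) (by rw [dist_self]; positivity)
    linarith

/-- Two points of the net are neighbours if the supports of their bump functions meet. -/
def nbrs (x : Fin n → ℝ) : Set (Fin n → ℝ) :=
  {y ∈ W.index | ∃ z, dist z x ≤ 2 * W.rad x ∧ dist z y ≤ 2 * W.rad y}

theorem finite_nbrs (x : Fin n → ℝ) : (W.nbrs x).Finite := by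
  refine finite_of_card_le (N := 1000000 ^ n) fun T hT => ?_
  have hx := W.pos x
  have key : ∀ y ∈ T, R x ≤ 54 * R y ∧ R y ≤ 54 * R x ∧ dist y x ≤ 8 * R x + 8 * R y := by
    intro y hy
    obtain ⟨-, z, h1, h2⟩ := hT y hy
    rw [dist_comm]
    exact ⟨(W.comparable_of_common h1 h2).1, (W.comparable_of_common h2 h1).1,
      (W.comparable_of_common h1 h2).2⟩
  exact W.card_le T (fun y hy => W.index_subset (hT y hy).1) x (a := R x / 54) (b := 442 * R x)
    (by positivity) (by positivity) (fun y hy => by linarith [(key y hy).1])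
    (fun y hy => by linarith [(key y hy).2.1, (key y hy).2.2]) (by linarith)

/-- There is a neighbour with the largest deviation. -/
theorem exists_extremal_nbr (c : (Fin n → ℝ) → ℝ) :
    ∃ y : (Fin n → ℝ) → (Fin n → ℝ), ∀ x ∈ W.index, y x ∈ W.nbrs x ∧
      ∀ t ∈ W.nbrs x, |c t - c x| ≤ |c x - c (y x)| := by
  have h : ∀ x, ∃ y, x ∈ W.index → y ∈ W.nbrs x ∧ ∀ t ∈ W.nbrs x, |c t - c x| ≤ |c x - c y| := by
    intro x
    by_cases hx : x ∈ W.index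
    · have hne : (W.nbrs x).Nonempty := ⟨x, hx, x, by
        have := W.rad_pos x
        rw [dist_self, and_self]
        positivity⟩
      obtain ⟨y, hy, hmax⟩ := Set.exists_max_image (W.nbrs x) (fun t => |c t - c x|)
        (W.finite_nbrs x) hne
      exact ⟨y, fun _ => ⟨hy, fun t ht => (hmax t ht).trans (by rw [abs_sub_comm])⟩⟩
    · exact ⟨x, fun h => absurd h hx⟩
  choose y hy using h
  exact ⟨y, hy⟩

theorem abs_interp_sub_le (c : (Fin n → ℝ) → ℝ) {x z : Fin n → ℝ} {M : ℝ}
    (hM : ∀ t ∈ W.nbrs x, |c t - c x| ≤ M) (hz : dist z x ≤ W.rad x) :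
    |W.interp c z - c x| ≤ M := by
  have hpos := W.pos z
  have hzz : dist z z ≤ R z / 10 := by rw [dist_self]; positivity
  rw [W.interp_eq c hzz]
  refine abs_weighted_average_sub_le _ (fun x => W.bump x z) c (fun t _ => W.bump_nonneg t z)
    (W.one_le_sum_bump hzz) fun t ht h0 => hM t ⟨(W.mem_nearFinset.1 ht).1, z, ?_, ?_⟩
  · linarith [W.rad_pos x]
  · by_contra! h
    exact h0 (W.bump_eq_zero h.le)

/-- A bump at `t` has gradient at most `8 * L / R t ≤ 72 * L / R z ≤ 432 * L / R x`; the factor 2 is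
that of the quotient rule and `1000000 ^ n` counts the relevant bumps. -/
theorem norm_fderiv_interp_le (c : (Fin n → ℝ) → ℝ) {x z : Fin n → ℝ} {M L : ℝ}
    (hL0 : 0 ≤ L) (hL : ∀ z, ‖fderiv ℝ (unitBump n) z‖ ≤ L) (hM0 : 0 ≤ M)
    (hM : ∀ t ∈ W.nbrs x, |c t - c x| ≤ M) (hz : dist z x ≤ W.rad x) :
    ‖fderiv ℝ (W.interp c) z‖ ≤ 864 * 1000000 ^ n * L * M / R x := by
  have hpos := W.pos z
  have hposx := W.pos x
  have hzz : dist z z ≤ R z / 10 := by rw [dist_self]; positivity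
  rw [(W.interp_eventuallyEq c z).fderiv_eq]
  have hzx : dist z x ≤ 2 * W.rad x := by linarith [W.rad_pos x]
  have key := norm_fderiv_weighted_average_le (W.nearFinset z) W.bump c z
    (fun t _ => ((W.contDiff_bump t).differentiable (by simp)).differentiableAt)
    (fun t _ => W.bump_nonneg t z) (W.one_le_sum_bump hzz) (a := c x) (M := M) (L := 72 * L / R z)
    hM0 (by positivity) ?_ ?_
  · refine key.trans ?_
    have hcard : ((W.nearFinset z).card : ℝ) ≤ 1000000 ^ n := by
      exact_mod_cast W.card_near_le z _ fun y hy => W.mem_nearFinset.1 hy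
    have h1 : 72 * L / R z ≤ 432 * L / R x := by
      rw [div_le_div_iff₀ hpos hposx]
      nlinarith [(W.comparable hzx).1]
    calc 2 * ((W.nearFinset z).card : ℝ) * (72 * L / R z) * M
        ≤ 2 * 1000000 ^ n * (432 * L / R x) * M := by gcongr
      _ = _ := by ring
  · intro t ht
    by_cases h0 : 2 * W.rad t < dist z t
    · rw [W.fderiv_bump_eq_zero h0, norm_zero]; positivity
    · rw [W.fderiv_bump, norm_smul, norm_inv, Real.norm_of_nonneg (W.rad_pos t).le,
        inv_mul_le_iff₀ (W.rad_pos t)]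
      refine (hL _).trans ?_
      rw [← mul_div_assoc, le_div_iff₀ hpos]
      nlinarith [(W.comparable (not_lt.1 h0)).2, W.le_rad t]
  · intro t ht h
    refine hM t ⟨(W.mem_nearFinset.1 ht).1, z, hzx, ?_⟩
    by_contra! h'
    exact h.elim (fun h0 => h0 (W.bump_eq_zero h'.le)) fun h0 => h0 (W.fderiv_bump_eq_zero h')

end ScaleNet



/-! ### The decomposition of f. -/

theorem isWeakGradient_of_contDiff {u : (Fin n → ℝ) → ℝ} (hu : ContDiff ℝ ∞ u) :
    IsWeakGradient u fun z i => fderiv ℝ u z (Pi.single i 1) := by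
  have hf : Continuous (fderiv ℝ u) := hu.continuous_fderiv (by simp)
  have hc : Continuous fun (z : Fin n → ℝ) (i : Fin n) => fderiv ℝ u z (Pi.single i 1) :=
    continuous_pi fun i => hf.clm_apply continuous_const
  refine ⟨hu.continuous.locallyIntegrable, hc.locallyIntegrable, fun i φ hφ hsupp => ?_⟩
  have hφ' : Continuous (fderiv ℝ φ) := hφ.continuous_fderiv (by simp)
  refine integral_mul_fderiv_eq_neg_fderiv_mul_of_integrable ?_ ?_ ?_ ?_ ?_
  · exact ((hf.clm_apply continuous_const).mul hφ.continuous).integrable_of_hasCompactSupport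
      hsupp.mul_left
  · exact (hu.continuous.mul (hφ'.clm_apply continuous_const)).integrable_of_hasCompactSupport
      ((hsupp.fderiv_apply ℝ _).mul_left)
  · exact (hu.continuous.mul hφ.continuous).integrable_of_hasCompactSupport hsupp.mul_left
  · exact fun x _ => hu.differentiable (by simp) x
  · exact fun x _ => hφ.differentiable (by simp) x

theorem memLpLoc_of_continuous {p : ℝ} {u : (Fin n → ℝ) → ℝ} (hu : Continuous u)
    (μ : Measure (Fin n → ℝ)) [IsLocallyFiniteMeasure μ] : MemLpLoc p μ u := by
  intro K hK
  have : IsFiniteMeasure (μ.restrict K) :=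
    ⟨by rw [Measure.restrict_apply_univ]; exact hK.measure_lt_top⟩
  obtain ⟨C, hC⟩ := hK.exists_bound_of_continuousOn hu.continuousOn
  refine MemLp.of_bound hu.aestronglyMeasurable C ?_
  exact (ae_restrict_iff' hK.measurableSet).2 (Filter.Eventually.of_forall hC)

/-- The operator norm is dual to the uniform norm, and each coordinate vector has uniform norm one.
-/
theorem norm_gradient_le (A : (Fin n → ℝ) →L[ℝ] ℝ) :
    ‖fun i => A (Pi.single i 1)‖ ≤ ‖A‖ := by
  rw [pi_norm_le_iff_of_nonneg (norm_nonneg _)]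
  intro i
  refine (A.le_opNorm _).trans ?_
  rw [Pi.norm_single, norm_one, mul_one]

theorem eLpNorm_eq_lintegral {E : Type*} [NormedAddCommGroup E] {α : Type*} [MeasurableSpace α]
    {ν : Measure α} {p : ℝ} (hp : 0 < p) (g : α → E) :
    eLpNorm g (ENNReal.ofReal p) ν = (∫⁻ x, ‖g x‖ₑ ^ p ∂ν) ^ (1 / p) := by
  rw [eLpNorm_eq_lintegral_rpow_enorm_toReal (by simpa using hp) ENNReal.ofReal_ne_top,
    ENNReal.toReal_ofReal hp.le]

section Decomposition

variable {p : ℝ} {μ : Measure (Fin n → ℝ)} {f : (Fin n → ℝ) → ℝ}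
  (W : ScaleNet (critRadius p μ : (Fin n → ℝ) → ℝ))

theorem lintegral_le_tsum_cell (ν : Measure (Fin n → ℝ)) (g : (Fin n → ℝ) → ℝ≥0∞) :
    ∫⁻ z, g z ∂ν ≤ ∑' x : W.index, ∫⁻ z in (W.cell x).toSet, g z ∂ν := by
  have : Countable W.index := W.countable_index.to_subtype
  refine le_trans (le_of_eq ?_) (lintegral_iUnion_le (fun x : W.index => (W.cell x).toSet) g)
  rw [← setLIntegral_univ]
  congr 2
  symm
  rw [Set.eq_univ_iff_forall]
  intro z
  obtain ⟨x, hx, h⟩ := W.exists_mem_index z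
  exact Set.mem_iUnion.2 ⟨⟨x, hx⟩, h⟩

theorem measure_cell_le_const (hp : (n : ℝ) < p) (x : Fin n → ℝ) :
    μ (W.cell x).toSet ≤ (1000000 ^ n : ℕ) * ENNReal.ofReal ((48 : ℝ)⁻¹ ^ ((n : ℝ) - p)) *
      ENNReal.ofReal (critRadius p μ x ^ ((n : ℝ) - p)) := by
  have hpos := W.pos x
  rw [mul_assoc, ← ENNReal.ofReal_mul (by positivity), ← Real.mul_rpow (by positivity) hpos.le,
    inv_mul_eq_div]
  by_cases h : x ∈ W.S
  · exact measure_cell_le_of_mem W hp h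
  · refine (measure_cell_le W h).trans ((ofReal_rpow_le_of_le (s := critRadius p μ x / 8)
      (r := critRadius p μ x / 48) hp (by positivity) (by linarith)).trans ?_)
    refine le_mul_of_one_le_left zero_le ?_
    exact_mod_cast Nat.one_le_pow _ _ (by norm_num)

/-- The gradient is of order `|c x - c t| / R x` on a cell of volume of order `R x ^ n`; this
produces the power `n - p`. -/
theorem lintegral_cell_gradient_le (hp0 : 0 < p) {L : ℝ} (hL0 : 0 ≤ L)
    (hL : ∀ z, ‖fderiv ℝ (unitBump n) z‖ ≤ L) (c : (Fin n → ℝ) → ℝ)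
    {x t : Fin n → ℝ} (ht : ∀ y ∈ W.nbrs x, |c y - c x| ≤ |c x - c t|) :
    ∫⁻ z in (W.cell x).toSet,
        ‖fun i => fderiv ℝ (W.interp c) z (Pi.single i 1)‖ₑ ^ p ≤
      ENNReal.ofReal ((864 * 1000000 ^ n * L) ^ p * 8 ^ n) *
        (ENNReal.ofReal (critRadius p μ x ^ ((n : ℝ) - p)) * ‖c x - c t‖ₑ ^ p) := by
  have hpos := W.pos x
  have h1 : ∀ z ∈ (W.cell x).toSet,
      ‖fun i => fderiv ℝ (W.interp c) z (Pi.single i 1)‖ₑ ^ p ≤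
        ENNReal.ofReal (((864 * 1000000 ^ n * L) * |c x - c t| / critRadius p μ x) ^ p) := by
    intro z hz
    rw [← ofReal_norm, ENNReal.ofReal_rpow_of_nonneg (norm_nonneg _) hp0.le]
    refine ENNReal.ofReal_le_ofReal (Real.rpow_le_rpow (norm_nonneg _) ?_ hp0.le)
    exact (norm_gradient_le _).trans
      (W.norm_fderiv_interp_le c hL0 hL (abs_nonneg _) ht hz)
  refine (setLIntegral_mono measurable_const h1).trans ?_
  rw [setLIntegral_const, show (W.cell x).toSet = Metric.closedBall x (W.rad x) from rfl,
    Real.volume_pi_closedBall _ (W.rad_pos x).le, Fintype.card_fin, ← ofReal_norm (c x - c t),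
    Real.norm_eq_abs, ENNReal.ofReal_rpow_of_nonneg (abs_nonneg _) hp0.le,
    ← ENNReal.ofReal_mul (by positivity), ← ENNReal.ofReal_mul (by positivity),
    ← ENNReal.ofReal_mul (by positivity)]
  refine ENNReal.ofReal_le_ofReal ?_
  have h2 : (2 * W.rad x) ^ n ≤ (8 * critRadius p μ x) ^ n :=
    pow_le_pow_left₀ (by linarith [W.rad_pos x]) (by linarith [W.rad_le x]) n
  refine (mul_le_mul_of_nonneg_left h2 (by positivity)).trans (le_of_eq ?_)
  rw [Real.div_rpow (by positivity) hpos.le, Real.mul_rpow (by positivity) (abs_nonneg _),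
    mul_pow, Real.rpow_sub hpos, Real.rpow_natCast]
  ring

/-- On the cell the interpolation stays within `|c x - c t|` of `c x`, and the measure of the cell
is at most of order `R x ^ (n - p)`. -/
theorem lintegral_cell_sub_interp_le (hp : (n : ℝ) < p) (hp1 : 1 ≤ p) (c : (Fin n → ℝ) → ℝ)
    {x t : Fin n → ℝ} (ht : ∀ y ∈ W.nbrs x, |c y - c x| ≤ |c x - c t|) :
    ∫⁻ z in (W.cell x).toSet, ‖f z - W.interp c z‖ₑ ^ p ∂μ ≤
      2 ^ (p - 1) * (∫⁻ z in (W.cell x).toSet, ‖f z - c x‖ₑ ^ p ∂μ) +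
      2 ^ (p - 1) * ((1000000 ^ n : ℕ) * ENNReal.ofReal ((48 : ℝ)⁻¹ ^ ((n : ℝ) - p))) *
        (ENNReal.ofReal (critRadius p μ x ^ ((n : ℝ) - p)) * ‖c x - c t‖ₑ ^ p) := by
  have h1 : ∀ z ∈ (W.cell x).toSet, ‖f z - W.interp c z‖ₑ ^ p ≤
      2 ^ (p - 1) * ‖f z - c x‖ₑ ^ p + 2 ^ (p - 1) * ‖c x - c t‖ₑ ^ p := by
    intro z hz
    rw [← mul_add]
    refine le_trans (ENNReal.rpow_le_rpow ?_ (by linarith))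
      (ENNReal.rpow_add_le_mul_rpow_add_rpow _ _ hp1)
    have h2 := W.abs_interp_sub_le c ht hz
    rw [← ofReal_norm, ← ofReal_norm, ← ofReal_norm, ← ENNReal.ofReal_add (norm_nonneg _)
      (norm_nonneg _)]
    refine ENNReal.ofReal_le_ofReal ?_
    simp only [Real.norm_eq_abs]
    have h3 := abs_sub_le (f z) (c x) (W.interp c z)
    rw [abs_sub_comm (c x) (W.interp c z)] at h3
    linarith
  refine (setLIntegral_mono' (W.cell x).measurableSet_toSet h1).trans ?_
  have h2pos : (2 : ℝ≥0∞) ^ (p - 1) ≠ ⊤ :=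
    ENNReal.rpow_ne_top_of_nonneg (by linarith) ENNReal.ofNat_ne_top
  rw [lintegral_add_right _ measurable_const, lintegral_const_mul' _ _ h2pos, setLIntegral_const]
  refine add_le_add_right ?_ _
  rw [mul_assoc, mul_assoc]
  refine mul_le_mul_right ?_ _
  rw [mul_comm, ← mul_assoc]
  exact mul_le_mul_left (measure_cell_le_const W hp x) _

end Decomposition

/-- The sufficiency of the oscillation condition: there is a decomposition with the right bound. -/
theorem exists_decomposition (hn : 0 < n) {p : ℝ} (hp : (n : ℝ) < p) :
    ∃ C : ℝ≥0∞, C ≠ ⊤ ∧ ∀ μ : Measure (Fin n → ℝ), IsLocallyFiniteMeasure μ → μ ≠ 0 →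
      ∀ f : (Fin n → ℝ) → ℝ, MemLpLoc p μ f → ∀ lam : ℝ, 0 < lam → OscBound 100000 p μ f lam →
        ∃ f₁ f₂ : (Fin n → ℝ) → ℝ, IsDecomposition p μ f f₁ f₂ ∧
          sobolevSeminorm p f₁ + eLpNorm f₂ (ENNReal.ofReal p) μ ≤
            C * ENNReal.ofReal (lam ^ (1 / p)) := by
  have hp1 : 1 ≤ p := le_trans (by exact_mod_cast hn) hp.le
  have hp0 : 0 < p := by linarith
  obtain ⟨L, hL0, hL⟩ := exists_bound_fderiv_unitBump n
  obtain ⟨A₁, hA₁, hA₁t⟩ : ∃ A : ℝ≥0∞, A = ENNReal.ofReal ((4 : ℝ)⁻¹ ^ ((n : ℝ) - p)) * (2 * 2) *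
      (1000000 ^ n : ℕ) ∧ A ≠ ⊤ := ⟨_, rfl, by finiteness⟩
  obtain ⟨A₂, hA₂, hA₂t⟩ : ∃ A : ℝ≥0∞, A =
      (1 + (1000000 ^ n : ℕ) * ENNReal.ofReal ((384 : ℝ)⁻¹ ^ ((n : ℝ) - p))) *
      (1 + (1000000 ^ n : ℕ) * ENNReal.ofReal ((384 : ℝ)⁻¹ ^ ((n : ℝ) - p))) +
      (1 + ENNReal.ofReal ((2 : ℝ)⁻¹ ^ ((n : ℝ) - p))) * 2 * (1000000 ^ n : ℕ) ∧ A ≠ ⊤ :=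
    ⟨_, rfl, by finiteness⟩
  obtain ⟨K₁, hK₁, hK₁t⟩ : ∃ A : ℝ≥0∞, A = ENNReal.ofReal ((864 * 1000000 ^ n * L) ^ p * 8 ^ n) ∧
      A ≠ ⊤ := ⟨_, rfl, ENNReal.ofReal_ne_top⟩
  have h2t : (2 : ℝ≥0∞) ^ (p - 1) ≠ ⊤ :=
    ENNReal.rpow_ne_top_of_nonneg (by linarith) ENNReal.ofNat_ne_top
  obtain ⟨K₂, hK₂, hK₂t⟩ : ∃ A : ℝ≥0∞, A = 2 ^ (p - 1) *
      ((1000000 ^ n : ℕ) * ENNReal.ofReal ((48 : ℝ)⁻¹ ^ ((n : ℝ) - p))) ∧ A ≠ ⊤ :=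
    ⟨_, rfl, ENNReal.mul_ne_top h2t (by finiteness)⟩
  refine ⟨(K₁ * A₁) ^ (1 / p) + (2 ^ (p - 1) * A₂ + K₂ * A₁) ^ (1 / p), ?_, ?_⟩
  · refine ENNReal.add_ne_top.2 ⟨?_, ?_⟩ <;>
    refine ENNReal.rpow_ne_top_of_nonneg (by positivity) ?_
    · exact ENNReal.mul_ne_top hK₁t hA₁t
    · exact ENNReal.add_ne_top.2 ⟨ENNReal.mul_ne_top h2t hA₂t, ENNReal.mul_ne_top hK₂t hA₁t⟩
  intro μ _ hμ f hf lam hlam hosc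
  obtain ⟨W⟩ := exists_scaleNet (critRadius p μ : (Fin n → ℝ) → ℝ) (critRadius_pos μ hp hμ)
    (critRadius_le_add_dist μ hp hμ)
  set c := netValue W f with hc
  -- The extremal neighbour lets one choice of partners control the differences with all neighbours.
  obtain ⟨y, hy⟩ := W.exists_extremal_nbr c
  set u := W.interp c with hu
  have hus : ContDiff ℝ ∞ u := W.contDiff_interp c
  have hsum₁ : ∑' x : W.index, ENNReal.ofReal (critRadius p μ (x : Fin n → ℝ) ^ ((n : ℝ) - p)) *
      ‖c x - c (y x)‖ₑ ^ p ≤ A₁ * ENNReal.ofReal lam := by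
    refine tsum_subtype_le_of_sum_le (g := fun x => ENNReal.ofReal (critRadius p μ x ^ ((n : ℝ) - p))
      * ‖c x - c (y x)‖ₑ ^ p) fun F hF => ?_
    rw [hA₁, mul_assoc]
    refine sum_netValue_sub_le W hn hp hp1 hμ hf hosc F hF y fun x hx => ?_
    obtain ⟨-, z, h1, h2⟩ := (hy x (hF x hx)).1
    exact ⟨(W.comparable_of_common h2 h1).1, (W.comparable_of_common h1 h2).2⟩
  have hsum₂ : ∑' x : W.index, ∫⁻ z in (W.cell x).toSet, ‖f z - c x‖ₑ ^ p ∂μ ≤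
      A₂ * ENNReal.ofReal lam := by
    refine tsum_subtype_le_of_sum_le
      (g := fun x => ∫⁻ z in (W.cell x).toSet, ‖f z - c x‖ₑ ^ p ∂μ) fun F hF => ?_
    rw [hA₂, add_mul, mul_assoc (_ * 2)]
    exact sum_lintegral_cell_le W hn hp hp1 hμ hf hosc F hF
  have hgrad : ∫⁻ z, ‖fun i => fderiv ℝ u z (Pi.single i 1)‖ₑ ^ p ≤
      K₁ * A₁ * ENNReal.ofReal lam := by
    refine (lintegral_le_tsum_cell W _ _).trans ?_
    refine (ENNReal.tsum_le_tsum fun x : W.index =>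
      lintegral_cell_gradient_le W hp0 hL0 hL c (hy x x.2).2).trans ?_
    rw [ENNReal.tsum_mul_left, ← hK₁, mul_assoc]
    exact mul_le_mul_right hsum₁ _
  have hrest : ∫⁻ z, ‖f z - u z‖ₑ ^ p ∂μ ≤
      (2 ^ (p - 1) * A₂ + K₂ * A₁) * ENNReal.ofReal lam := by
    refine (lintegral_le_tsum_cell W _ _).trans ?_
    refine (ENNReal.tsum_le_tsum fun x : W.index =>
      lintegral_cell_sub_interp_le W hp hp1 c (hy x x.2).2).trans ?_
    rw [ENNReal.tsum_add, ENNReal.tsum_mul_left, ENNReal.tsum_mul_left, ← hK₂, add_mul, mul_assoc,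
      mul_assoc]
    gcongr
  have hroot : ∀ {I A : ℝ≥0∞}, I ≤ A * ENNReal.ofReal lam →
      I ^ (1 / p) ≤ A ^ (1 / p) * ENNReal.ofReal (lam ^ (1 / p)) := fun {I A} h => by
    rw [← ENNReal.ofReal_rpow_of_nonneg hlam.le (by positivity),
      ← ENNReal.mul_rpow_of_nonneg _ _ (by positivity)]
    exact ENNReal.rpow_le_rpow h (by positivity)
  have hgradn := hroot hgrad
  have hrestn := hroot hrest
  rw [← eLpNorm_eq_lintegral hp0] at hgradn hrestn
  have hw := isWeakGradient_of_contDiff hus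
  refine ⟨u, fun z => f z - u z, ⟨hus.continuous, ⟨memLpLoc_of_continuous hus.continuous _, _, hw,
    hw.locallyIntegrable_right.aestronglyMeasurable, ?_⟩, ⟨?_, ?_⟩, ?_⟩, ?_⟩
  · refine hgradn.trans_lt (ENNReal.mul_lt_top ?_ ENNReal.ofReal_lt_top)
    exact (ENNReal.rpow_ne_top_of_nonneg (by positivity) (ENNReal.mul_ne_top hK₁t hA₁t)).lt_top
  · exact hf.aemeasurable.aestronglyMeasurable.sub hus.continuous.aestronglyMeasurable
  · refine hrestn.trans_lt (ENNReal.mul_lt_top ?_ ENNReal.ofReal_lt_top)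
    exact (ENNReal.rpow_ne_top_of_nonneg (by positivity) (ENNReal.add_ne_top.2
      ⟨ENNReal.mul_ne_top h2t hA₂t, ENNReal.mul_ne_top hK₂t hA₁t⟩)).lt_top
  · exact Filter.Eventually.of_forall fun z => by ring
  · rw [add_mul]
    exact add_le_add ((iInf₂_le _ hw).trans hgradn) hrestn



/-! ### Morrey's inequality for smooth functions. -/

/-- Integration over the contraction of a convex set towards one of its points. -/
theorem lintegral_contraction_le {D : Set (Fin n → ℝ)} (hD : MeasurableSet D) (hconv : Convex ℝ D)
    {x : Fin n → ℝ} (hx : x ∈ D) {t : ℝ} (ht : 0 < t) (ht1 : t ≤ 1) {H : (Fin n → ℝ) → ℝ≥0∞}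
    (hH : Measurable H) :
    ∫⁻ w in D, H (x + t • (w - x)) ≤ ENNReal.ofReal ((t ^ n)⁻¹) * ∫⁻ w in D, H w := by
  set F : (Fin n → ℝ) → ℝ≥0∞ := D.indicator H with hF
  have hFm : Measurable F := hH.indicator hD
  -- Convexity keeps the contracted set inside `D`, so `H` may be cut off outside `D` before the
  -- substitution on the whole space.
  calc ∫⁻ w in D, H (x + t • (w - x)) ≤ ∫⁻ w in D, F (x + t • (w - x)) := by
        refine setLIntegral_mono' hD fun w hw => ?_
        rw [hF, Set.indicator_of_mem]
        have := hconv hx hw (sub_nonneg.2 ht1) ht.le (by ring)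
        convert this using 1
        module
    _ ≤ ∫⁻ w, F (x + t • (w - x)) := setLIntegral_le_lintegral _ _
    _ = ∫⁻ w, F (x + t • w) := lintegral_sub_right_eq_self (fun w => F (x + t • w)) x
    _ = ∫⁻ w, F (x + w) ∂(volume.map fun w : Fin n → ℝ => t • w) :=
        (lintegral_map (hFm.comp (measurable_const_add x)) (measurable_const_smul t)).symm
    _ = ENNReal.ofReal ((t ^ n)⁻¹) * ∫⁻ w, F (x + w) := by
        rw [Measure.map_addHaar_smul _ ht.ne', lintegral_smul_measure, Module.finrank_fin_fun,
          abs_of_pos (by positivity), smul_eq_mul]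
    _ = ENNReal.ofReal ((t ^ n)⁻¹) * ∫⁻ w in D, H w := by
        rw [lintegral_add_left_eq_self F x, hF, lintegral_indicator hD]

/-- The fundamental theorem of calculus along a segment. -/
theorem enorm_sub_le_lintegral_segment {v : (Fin n → ℝ) → ℝ} (hv : ContDiff ℝ 1 v)
    (x w : Fin n → ℝ) :
    ‖v x - v w‖ₑ ≤ ∫⁻ t in Set.Ioc (0 : ℝ) 1, ‖fderiv ℝ v (x + t • (w - x))‖ₑ * ‖w - x‖ₑ := by
  have hc : Continuous (fderiv ℝ v) := hv.continuous_fderiv (by simp)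
  have hline : Continuous fun t : ℝ => x + t • (w - x) := by fun_prop
  have hd : ∀ t ∈ Set.uIcc (0 : ℝ) 1, HasDerivAt (fun t : ℝ => v (x + t • (w - x)))
      (fderiv ℝ v (x + t • (w - x)) (w - x)) t := by
    intro t _
    have h1 : HasDerivAt (fun t : ℝ => x + t • (w - x)) (w - x) t := by
      have := ((hasDerivAt_id t).smul_const (w - x)).const_add x
      simpa using this
    exact ((hv.differentiable (by simp)) _).hasFDerivAt.comp_hasDerivAt t h1
  have hint := intervalIntegral.integral_eq_sub_of_hasDerivAt hd
    ((((hc.comp hline).clm_apply continuous_const)).intervalIntegrable 0 1)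
  have h2 : v x - v w = -∫ t in Set.Ioc (0 : ℝ) 1, fderiv ℝ v (x + t • (w - x)) (w - x) := by
    rw [← intervalIntegral.integral_of_le zero_le_one, hint]
    simp
  rw [h2, enorm_neg]
  refine (enorm_integral_le_lintegral_enorm _).trans (lintegral_mono fun t => ?_)
  exact ContinuousLinearMap.le_opENorm _ _

/-- The integral in time that appears in Morrey's inequality. -/
noncomputable def morreyIntegral (n : ℕ) (q : ℝ) : ℝ≥0∞ :=
  ∫⁻ t in Set.Ioc (0 : ℝ) 1, ENNReal.ofReal (t ^ (-(n / q)))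

theorem morreyIntegral_ne_top (hn : 0 < n) {q : ℝ} (hq : (n : ℝ) < q) :
    morreyIntegral n q ≠ ⊤ := by
  have hn0 : (0 : ℝ) < n := by exact_mod_cast hn
  have h : (-1 : ℝ) < -(n / q) := by
    rw [neg_lt_neg_iff, div_lt_one (by linarith)]
    exact hq
  exact ((intervalIntegral.intervalIntegrable_rpow' h (a := 0) (b := 1)).1).lintegral_lt_top.ne

/-- Integrate along segments from `x`, exchange the integrals, and apply Hölder's inequality for
fixed `t`. Contraction by `t` costs `t ^ (-n)`, which becomes `t ^ (-n / q)` after the root and is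
integrable for `q > n`. -/
theorem lintegral_enorm_sub_le {q : ℝ} (hq1 : 1 ≤ q) {v : (Fin n → ℝ) → ℝ}
    (hv : ContDiff ℝ 1 v) (x₀ : Fin n → ℝ) {r : ℝ} {x : Fin n → ℝ}
    (hx : x ∈ Metric.closedBall x₀ r) :
    ∫⁻ w in Metric.closedBall x₀ r, ‖v x - v w‖ₑ ≤
      ENNReal.ofReal (2 * r) * ((volume (Metric.closedBall x₀ r) ^ (q - 1) *
        ∫⁻ w in Metric.closedBall x₀ r, ‖fderiv ℝ v w‖ₑ ^ q) ^ (1 / q) * morreyIntegral n q) := by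
  set D := Metric.closedBall x₀ r with hD
  set I := ∫⁻ w in D, ‖fderiv ℝ v w‖ₑ ^ q with hI
  have hq0 : 0 < q := by linarith
  have hc : Continuous (fderiv ℝ v) := hv.continuous_fderiv (by simp)
  have hmeas : Measurable (Function.uncurry fun (w : Fin n → ℝ) (t : ℝ) =>
      ‖fderiv ℝ v (x + t • (w - x))‖ₑ) := by
    refine Continuous.measurable ?_
    exact (hc.comp (by fun_prop)).enorm
  have hJ : ∀ t ∈ Set.Ioc (0 : ℝ) 1, ∫⁻ w in D, ‖fderiv ℝ v (x + t • (w - x))‖ₑ ≤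
      (volume D ^ (q - 1) * I) ^ (1 / q) * ENNReal.ofReal (t ^ (-(n / q))) := by
    intro t ht
    have hline : Continuous fun w : Fin n → ℝ => x + t • (w - x) := by fun_prop
    have h1 := lintegral_rpow_le (ν := volume.restrict D)
      (h := fun w => ‖fderiv ℝ v (x + t • (w - x))‖ₑ)
      (hc.comp hline).enorm.measurable.aemeasurable hq1
    rw [Measure.restrict_apply_univ] at h1
    have h2 := h1.trans (mul_le_mul_right (lintegral_contraction_le
      (H := fun w => ‖fderiv ℝ v w‖ₑ ^ q) measurableSet_closedBall (convex_closedBall x₀ r) hx ht.1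
      ht.2 (hc.enorm.measurable.pow_const q)) _)
    have h3 := ENNReal.rpow_le_rpow h2 (show 0 ≤ 1 / q by positivity)
    rw [← ENNReal.rpow_mul, mul_one_div_cancel hq0.ne', ENNReal.rpow_one] at h3
    refine h3.trans (le_of_eq ?_)
    rw [← hI, mul_left_comm, mul_comm, ENNReal.mul_rpow_of_nonneg _ _ (by positivity)]
    congr 1
    rw [ENNReal.ofReal_rpow_of_nonneg (inv_nonneg.2 (pow_nonneg ht.1.le n)) (by positivity)]
    congr 1
    rw [← Real.rpow_natCast, ← Real.rpow_neg ht.1.le, ← Real.rpow_mul ht.1.le]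
    congr 1
    ring
  calc ∫⁻ w in D, ‖v x - v w‖ₑ
      ≤ ∫⁻ w in D, ∫⁻ t in Set.Ioc (0 : ℝ) 1,
          ‖fderiv ℝ v (x + t • (w - x))‖ₑ * ENNReal.ofReal (2 * r) := by
        refine setLIntegral_mono' measurableSet_closedBall fun w hw => ?_
        refine (enorm_sub_le_lintegral_segment hv x w).trans (lintegral_mono fun t => ?_)
        refine mul_le_mul_right ?_ _
        rw [← ofReal_norm, ← dist_eq_norm]
        refine ENNReal.ofReal_le_ofReal ?_
        have h1 : dist w x₀ ≤ r := hw
        have h2 : dist x x₀ ≤ r := hx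
        linarith [dist_triangle_right w x x₀]
    _ = ENNReal.ofReal (2 * r) * ∫⁻ w in D, ∫⁻ t in Set.Ioc (0 : ℝ) 1,
          ‖fderiv ℝ v (x + t • (w - x))‖ₑ := by
        rw [mul_comm (ENNReal.ofReal (2 * r)), ← lintegral_mul_const' _ _ ENNReal.ofReal_ne_top]
        refine lintegral_congr fun w => ?_
        rw [lintegral_mul_const' _ _ ENNReal.ofReal_ne_top]
    _ = ENNReal.ofReal (2 * r) * ∫⁻ t in Set.Ioc (0 : ℝ) 1, ∫⁻ w in D,
          ‖fderiv ℝ v (x + t • (w - x))‖ₑ := by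
        rw [lintegral_lintegral_swap hmeas.aemeasurable]
    _ ≤ _ := by
        gcongr
        refine (setLIntegral_mono' measurableSet_Ioc hJ).trans ?_
        rw [lintegral_const_mul _ (by fun_prop)]
        rfl

/-- Morrey's inequality for continuously differentiable functions. -/
theorem morrey_of_contDiff (hn : 0 < n) {q : ℝ} (hq : (n : ℝ) < q) {v : (Fin n → ℝ) → ℝ}
    (hv : ContDiff ℝ 1 v) (x₀ : Fin n → ℝ) {r : ℝ} (hr : 0 < r) {x y : Fin n → ℝ}
    (hx : x ∈ Metric.closedBall x₀ r) (hy : y ∈ Metric.closedBall x₀ r) :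
    ‖v x - v y‖ₑ ^ q ≤ (4 * morreyIntegral n q) ^ q * ENNReal.ofReal (r ^ (q - n)) *
      ∫⁻ w in Metric.closedBall x₀ r, ‖fderiv ℝ v w‖ₑ ^ q := by
  have hq1 : 1 ≤ q := le_trans (by exact_mod_cast hn) hq.le
  have hq0 : 0 < q := by linarith
  set D := Metric.closedBall x₀ r with hD
  set I := ∫⁻ w in D, ‖fderiv ℝ v w‖ₑ ^ q with hI
  set κ := morreyIntegral n q
  have hvol : volume D = ENNReal.ofReal ((2 * r) ^ n) := by
    rw [hD, Real.volume_pi_closedBall _ hr.le, Fintype.card_fin]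
  have hV0 : volume D ≠ 0 := by
    rw [hvol]
    simp only [ne_eq, ENNReal.ofReal_eq_zero, not_le]
    positivity
  have hVt : volume D ≠ ⊤ := by rw [hvol]; exact ENNReal.ofReal_ne_top
  -- Both values are compared with `v w` and the comparison is integrated over `w` in `D`.
  have h1 : volume D * ‖v x - v y‖ₑ ≤
      4 * ENNReal.ofReal r * κ * (volume D ^ (q - 1) * I) ^ (1 / q) := by
    calc volume D * ‖v x - v y‖ₑ = ∫⁻ _ in D, ‖v x - v y‖ₑ := by
          rw [setLIntegral_const, mul_comm]
      _ ≤ ∫⁻ w in D, (‖v x - v w‖ₑ + ‖v y - v w‖ₑ) := by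
          refine lintegral_mono fun w => ?_
          have : v x - v y = (v x - v w) - (v y - v w) := by ring
          rw [this]
          exact enorm_sub_le
      _ = (∫⁻ w in D, ‖v x - v w‖ₑ) + ∫⁻ w in D, ‖v y - v w‖ₑ := by
          refine lintegral_add_left ?_ _
          exact (continuous_const.sub hv.continuous).enorm.measurable
      _ ≤ _ := add_le_add (lintegral_enorm_sub_le hq1 hv x₀ hx) (lintegral_enorm_sub_le hq1 hv x₀ hy)
      _ = _ := by
          rw [ENNReal.ofReal_mul (by norm_num), ENNReal.ofReal_ofNat]
          ring
  have h2 := ENNReal.rpow_le_rpow h1 hq0.le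
  rw [ENNReal.mul_rpow_of_nonneg _ _ hq0.le, ENNReal.mul_rpow_of_nonneg _ _ hq0.le,
    ← ENNReal.rpow_mul, one_div_mul_cancel hq0.ne', ENNReal.rpow_one] at h2
  have h3 : volume D ^ q = volume D ^ (q - 1) * volume D := by
    conv_rhs => rw [← ENNReal.rpow_one (volume D), ← ENNReal.rpow_mul, one_mul,
      ← ENNReal.rpow_add _ _ hV0 hVt]
    congr 1; ring
  rw [h3, mul_assoc, mul_left_comm _ (volume D ^ (q - 1)) I] at h2
  have h4 := (ENNReal.mul_le_mul_iff_right (by simp [ENNReal.rpow_eq_zero_iff, hV0, hVt])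
    (ENNReal.rpow_ne_top_of_ne_zero hV0 hVt)).1 h2
  rw [mul_comm, ← ENNReal.le_div_iff_mul_le (Or.inl hV0) (Or.inl hVt)] at h4
  refine h4.trans ?_
  rw [mul_right_comm 4, ENNReal.mul_rpow_of_nonneg _ _ hq0.le, ENNReal.div_eq_inv_mul, hvol,
    ENNReal.ofReal_rpow_of_nonneg hr.le hq0.le, ← ENNReal.ofReal_inv_of_pos (by positivity)]
  calc ENNReal.ofReal (((2 * r) ^ n)⁻¹) * ((4 * κ) ^ q * ENNReal.ofReal (r ^ q) * I)
      = (4 * κ) ^ q * (ENNReal.ofReal (((2 * r) ^ n)⁻¹) * ENNReal.ofReal (r ^ q)) * I := by ring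
    _ ≤ (4 * κ) ^ q * ENNReal.ofReal (r ^ (q - n)) * I := by
        gcongr
        rw [← ENNReal.ofReal_mul (by positivity)]
        refine ENNReal.ofReal_le_ofReal ?_
        rw [Real.rpow_sub hr, Real.rpow_natCast, inv_mul_eq_div]
        have : r ^ n ≤ (2 * r) ^ n := pow_le_pow_left₀ hr.le (by linarith) n
        gcongr



/-! ### Mollification and Morrey's inequality for weak gradients. -/

theorem enorm_le_sum_enorm_single (A : (Fin n → ℝ) →L[ℝ] ℝ) :
    ‖A‖ₑ ≤ ∑ i, ‖A (Pi.single i 1)‖ₑ := by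
  have h : ‖A‖ ≤ ∑ i, ‖A (Pi.single i 1)‖ := by
    refine A.opNorm_le_bound (by positivity) fun w => ?_
    have hw : A w = ∑ i, w i * A (Pi.single i 1) := by
      conv_lhs => rw [pi_eq_sum_univ' w, map_sum]
      simp
    rw [hw, Finset.sum_mul]
    refine norm_sum_le_of_le _ fun i _ => ?_
    rw [norm_mul, mul_comm]
    gcongr
    exact norm_le_pi_norm w i
  simp only [← ofReal_norm]
  rw [← ENNReal.ofReal_sum_of_nonneg fun i _ => norm_nonneg _]
  exact ENNReal.ofReal_le_ofReal h

section Mollification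

variable (φ : ContDiffBump (0 : Fin n → ℝ)) {u : (Fin n → ℝ) → ℝ}
  {G : (Fin n → ℝ) → (Fin n → ℝ)}

/-- The convolution of a function with a bump function of integral one. -/
noncomputable def mollify (u : (Fin n → ℝ) → ℝ) : (Fin n → ℝ) → ℝ :=
  convolution (φ.normed volume) u (ContinuousLinearMap.lsmul ℝ ℝ) volume

theorem contDiff_mollify (hu : LocallyIntegrable u) : ContDiff ℝ 1 (mollify φ u) :=
  φ.hasCompactSupport_normed.contDiff_convolution_left (n := 1) _ φ.contDiff_normed hu

/-- The derivative falls on the kernel, whose reflected translate is a test function for the weak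
gradient; the reflection cancels the sign. -/
theorem fderiv_mollify_apply (h : IsWeakGradient u G) (z : Fin n → ℝ) (i : Fin n) :
    fderiv ℝ (mollify φ u) z (Pi.single i 1) = ∫ y, G y i * φ.normed volume (z - y) := by
  set k := φ.normed (volume : Measure (Fin n → ℝ)) with hk
  have hk1 : ContDiff ℝ ∞ k := φ.contDiff_normed
  have hks : HasCompactSupport k := φ.hasCompactSupport_normed
  have hu := h.locallyIntegrable_left
  have h1 := hks.hasFDerivAt_convolution_left (ContinuousLinearMap.lsmul ℝ ℝ)
    (hk1.of_le (by simp)) hu z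
  have h2 : fderiv ℝ (mollify φ u) z = _ := h1.fderiv
  have hconv := (hks.fderiv ℝ).convolutionExists_left
    (ContinuousLinearMap.precompL (Fin n → ℝ) (ContinuousLinearMap.lsmul ℝ ℝ))
    (hk1.continuous_fderiv (by simp)) hu z
  have hint : Integrable fun y => ContinuousLinearMap.precompL (Fin n → ℝ)
      (ContinuousLinearMap.lsmul ℝ ℝ) (fderiv ℝ k (z - y)) (u y) := hconv.integrable_swap
  rw [h2, convolution_eq_swap, ContinuousLinearMap.integral_apply hint]
  simp only [ContinuousLinearMap.precompL_apply, ContinuousLinearMap.lsmul_apply, smul_eq_mul]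
  have hψ : ContDiff ℝ ∞ fun y => k (z - y) := hk1.comp (contDiff_const.sub contDiff_id)
  have hψs : HasCompactSupport fun y => k (z - y) :=
    hks.comp_homeomorph (Homeomorph.subLeft z)
  have h3 := h.integral_eq i _ hψ hψs
  have h4 : ∀ y, fderiv ℝ (fun y => k (z - y)) y (Pi.single i 1) =
      - fderiv ℝ k (z - y) (Pi.single i 1) := by
    intro y
    have h5 : HasFDerivAt (fun y => k (z - y))
        ((fderiv ℝ k (z - y)).comp (-ContinuousLinearMap.id ℝ (Fin n → ℝ))) y :=
      ((hk1.differentiable (by simp)) _).hasFDerivAt.comp y ((hasFDerivAt_id y).const_sub z)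
    rw [h5.fderiv]
    simp
  simp only [h4, mul_neg, integral_neg] at h3
  rw [neg_inj] at h3
  rw [← h3]
  exact integral_congr_ae (Filter.Eventually.of_forall fun y => mul_comm _ _)

theorem lintegral_ofReal_normed_sub_left (z : Fin n → ℝ) :
    ∫⁻ y, ENNReal.ofReal (φ.normed volume (z - y)) = 1 := by
  rw [lintegral_sub_left_eq_self (fun y => ENNReal.ofReal (φ.normed volume y)) z,
    ← ofReal_integral_eq_lintegral_ofReal φ.integrable_normed
    (Filter.Eventually.of_forall φ.nonneg_normed), φ.integral_normed, ENNReal.ofReal_one]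

/-- Jensen's inequality for the probability measure with the mollifier as density; `n ^ q` comes
from summing over coordinates. -/
theorem enorm_fderiv_mollify_rpow_le {q : ℝ} (hq : 1 ≤ q) (h : IsWeakGradient u G)
    (z : Fin n → ℝ) :
    ‖fderiv ℝ (mollify φ u) z‖ₑ ^ q ≤
      (n : ℝ≥0∞) ^ q * ∫⁻ y, ENNReal.ofReal (φ.normed volume (z - y)) * ‖G y‖ₑ ^ q := by
  have hq0 : 0 ≤ q := by linarith
  set k : (Fin n → ℝ) → ℝ≥0∞ := fun y => ENNReal.ofReal (φ.normed volume (z - y)) with hk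
  have hkm : Measurable k :=
    (φ.continuous_normed.comp (continuous_const.sub continuous_id)).measurable.ennreal_ofReal
  have hGm : AEMeasurable (fun y => ‖G y‖ₑ) volume :=
    h.locallyIntegrable_right.aestronglyMeasurable.enorm
  have h1 : ‖fderiv ℝ (mollify φ u) z‖ₑ ≤ n * ∫⁻ y, k y * ‖G y‖ₑ := by
    refine (enorm_le_sum_enorm_single _).trans ?_
    refine (Finset.sum_le_card_nsmul _ _ (∫⁻ y, k y * ‖G y‖ₑ) fun i _ => ?_).trans
      (le_of_eq (by simp))
    rw [fderiv_mollify_apply φ h]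
    refine (enorm_integral_le_lintegral_enorm _).trans (lintegral_mono fun y => ?_)
    rw [enorm_mul, mul_comm, hk]
    have h5 : ‖φ.normed volume (z - y)‖ₑ = ENNReal.ofReal (φ.normed volume (z - y)) :=
      Real.enorm_of_nonneg (φ.nonneg_normed _)
    rw [h5]
    gcongr
    simp only [← ofReal_norm]
    exact ENNReal.ofReal_le_ofReal (norm_le_pi_norm _ _)
  have hac : volume.withDensity k ≪ (volume : Measure (Fin n → ℝ)) :=
    withDensity_absolutelyContinuous _ _
  have h2 := lintegral_rpow_le (ν := volume.withDensity k) (hGm.mono_ac hac) hq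
  rw [withDensity_apply _ MeasurableSet.univ, setLIntegral_univ,
    lintegral_ofReal_normed_sub_left, ENNReal.one_rpow, one_mul,
    lintegral_withDensity_eq_lintegral_mul₀ hkm.aemeasurable hGm,
    lintegral_withDensity_eq_lintegral_mul₀ hkm.aemeasurable (hGm.pow_const q)] at h2
  refine (ENNReal.rpow_le_rpow h1 hq0).trans ?_
  rw [ENNReal.mul_rpow_of_nonneg _ _ hq0]
  gcongr
  exact h2

/-- The mollifier vanishes beyond distance `r`, so only the doubled ball contributes; integrating it
out first leaves mass one. -/
theorem lintegral_fderiv_mollify_le {q : ℝ} (hq : 1 ≤ q) (h : IsWeakGradient u G)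
    (x₀ : Fin n → ℝ) {r : ℝ} (hφ : φ.rOut ≤ r) :
    ∫⁻ z in Metric.closedBall x₀ r, ‖fderiv ℝ (mollify φ u) z‖ₑ ^ q ≤
      (n : ℝ≥0∞) ^ q * ∫⁻ y in Metric.closedBall x₀ (2 * r), ‖G y‖ₑ ^ q := by
  have hnq : (n : ℝ≥0∞) ^ q ≠ ⊤ :=
    ENNReal.rpow_ne_top_of_nonneg (by linarith) (ENNReal.natCast_ne_top n)
  have hGm : AEMeasurable (fun y => ‖G y‖ₑ ^ q) volume :=
    h.locallyIntegrable_right.aestronglyMeasurable.enorm.pow_const q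
  have hkm : Measurable (fun y => ENNReal.ofReal (φ.normed volume y)) :=
    φ.continuous_normed.measurable.ennreal_ofReal
  have hloc : ∀ z ∈ Metric.closedBall x₀ r,
      ‖fderiv ℝ (mollify φ u) z‖ₑ ^ q ≤ (n : ℝ≥0∞) ^ q *
        ∫⁻ y in Metric.closedBall x₀ (2 * r),
          ENNReal.ofReal (φ.normed volume (z - y)) * ‖G y‖ₑ ^ q := by
    intro z hz
    refine (enorm_fderiv_mollify_rpow_le φ hq h z).trans ?_
    refine mul_le_mul_right ?_ _
    rw [← lintegral_indicator measurableSet_closedBall]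
    refine lintegral_mono fun y => ?_
    by_cases hy : y ∈ Metric.closedBall x₀ (2 * r)
    · rw [Set.indicator_of_mem hy]
    · have : φ.normed volume (z - y) = 0 := by
        rw [← Function.notMem_support, φ.support_normed_eq, Metric.mem_ball, dist_zero_right,
          ← dist_eq_norm, not_lt]
        have h1 : 2 * r < dist y x₀ := not_le.1 hy
        have h2 : dist z x₀ ≤ r := hz
        linarith [dist_triangle_left y x₀ z]
      rw [this]
      simp
  refine (setLIntegral_mono' measurableSet_closedBall hloc).trans ?_
  rw [lintegral_const_mul' _ _ hnq]
  refine mul_le_mul_right ?_ _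
  rw [lintegral_lintegral_swap]
  · refine lintegral_mono fun y => ?_
    refine (setLIntegral_le_lintegral _ _).trans ?_
    have hm : Measurable fun z => ENNReal.ofReal (φ.normed volume (z - y)) :=
      hkm.comp (measurable_id.sub_const y)
    rw [lintegral_mul_const _ hm]
    rw [lintegral_sub_right_eq_self (fun z => ENNReal.ofReal (φ.normed volume z)) y]
    have := lintegral_ofReal_normed_sub_left φ 0
    rw [lintegral_sub_left_eq_self (fun y => ENNReal.ofReal (φ.normed volume y))] at this
    rw [this, one_mul]
  · refine AEMeasurable.mul ?_ ?_
    · exact (hkm.comp (measurable_fst.sub measurable_snd)).aemeasurable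
    · exact (hGm.mono_measure Measure.restrict_le_self).comp_snd

end Mollification

/-- Morrey's inequality for continuous functions with a weak gradient. -/
theorem IsWeakGradient.morrey (hn : 0 < n) {q : ℝ} (hq : (n : ℝ) < q) {u : (Fin n → ℝ) → ℝ}
    {G : (Fin n → ℝ) → (Fin n → ℝ)} (h : IsWeakGradient u G) (hu : Continuous u)
    (x₀ : Fin n → ℝ) {r : ℝ} (hr : 0 < r) {x y : Fin n → ℝ}
    (hx : x ∈ Metric.closedBall x₀ r) (hy : y ∈ Metric.closedBall x₀ r) :
    ‖u x - u y‖ₑ ^ q ≤ (4 * morreyIntegral n q) ^ q * (n : ℝ≥0∞) ^ q *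
      ENNReal.ofReal (r ^ (q - n)) * ∫⁻ w in Metric.closedBall x₀ (2 * r), ‖G w‖ₑ ^ q := by
  have hq1 : 1 ≤ q := le_trans (by exact_mod_cast hn) hq.le
  let φ : ℕ → ContDiffBump (0 : Fin n → ℝ) := fun j =>
    ⟨r / (2 * (j + 1)), r / (j + 1), by positivity, by
      refine div_lt_div_of_pos_left hr (by positivity) ?_
      have : (0 : ℝ) < j + 1 := by positivity
      linarith⟩
  have hφ : Filter.Tendsto (fun j => (φ j).rOut) Filter.atTop (nhds 0) := by
    have := (tendsto_one_div_add_atTop_nhds_zero_nat (𝕜 := ℝ)).const_mul r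
    simpa [φ, div_eq_mul_inv] using this
  have hlim : ∀ z, Filter.Tendsto (fun j => mollify (φ j) u z) Filter.atTop (nhds (u z)) :=
    fun z => ContDiffBump.convolution_tendsto_right_of_continuous hφ hu z
  have hlim2 : Filter.Tendsto (fun j => ‖mollify (φ j) u x - mollify (φ j) u y‖ₑ ^ q) Filter.atTop
      (nhds (‖u x - u y‖ₑ ^ q)) :=
    (ENNReal.continuous_rpow_const.tendsto _).comp ((hlim x).sub (hlim y)).enorm
  refine le_of_tendsto' hlim2 fun j => ?_
  have hj : (φ j).rOut ≤ r := div_le_self hr.le (by linarith [Nat.cast_nonneg (α := ℝ) j])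
  refine (morrey_of_contDiff hn hq (contDiff_mollify (φ j) h.locallyIntegrable_left) x₀ hr
    hx hy).trans ?_
  refine (mul_le_mul_right (lintegral_fderiv_mollify_le (φ j) hq1 h x₀ hj) _).trans (le_of_eq ?_)
  ring



/-! ### A discrete maximal inequality. -/

theorem Cube.volume_dilate {a : ℝ} (ha : 0 ≤ a) (Q : Cube n) :
    volume (Q.dilate a) = ENNReal.ofReal (a ^ n * (2 * Q.radius) ^ n) := by
  rw [Cube.dilate, Real.volume_pi_closedBall _ (mul_nonneg ha Q.radius_pos.le), Fintype.card_fin,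
    ← mul_pow]
  congr 2
  ring

theorem Cube.volume_toSet (Q : Cube n) :
    volume Q.toSet = ENNReal.ofReal ((2 * Q.radius) ^ n) := by
  rw [Cube.toSet, Real.volume_pi_closedBall _ Q.radius_pos.le, Fintype.card_fin]

section DiscreteMaximal

variable {g : (Fin n → ℝ) → ℝ} {γ : ℝ}

/-- A cube where the mean of `g` exceeds `t` sees a fair share of the superlevel set of `g`. -/
theorem le_withDensity_superlevel (hg : Measurable g) (hγ : 0 < γ) (Q : Cube n) {a t : ℝ}
    (ht : 0 < t) (hta : t < a)
    (ha : ENNReal.ofReal (a * (2 * Q.radius) ^ n) ≤ ∫⁻ z in Q.dilate γ, ENNReal.ofReal (g z)) :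
    ENNReal.ofReal (t * (2 * Q.radius) ^ n / 2) ≤
      (volume.withDensity fun z => ENNReal.ofReal (g z))
        (Q.dilate γ ∩ {z | t < 2 * γ ^ n * g z}) := by
  set V := (2 * Q.radius) ^ n with hV
  have hr := Q.radius_pos
  have hV0 : 0 < V := by positivity
  set T := {z | t < 2 * γ ^ n * g z} with hT
  have hTm : MeasurableSet T := measurableSet_lt measurable_const (hg.const_mul _)
  have hDm : MeasurableSet (Q.dilate γ) := measurableSet_closedBall
  rw [withDensity_apply _ (hDm.inter hTm)]
  -- Off the superlevel set `g ≤ t / (2 * γ ^ n)`, so that part contributes at most `t / 2` times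
  -- the volume of `Q`.
  have h1 : ∫⁻ z in Q.dilate γ, ENNReal.ofReal (g z) ≤
      ENNReal.ofReal (t * V / 2) + ∫⁻ z in Q.dilate γ ∩ T, ENNReal.ofReal (g z) := by
    rw [← lintegral_inter_add_sdiff _ (Q.dilate γ) hTm, add_comm]
    refine add_le_add_left ?_ _
    calc ∫⁻ z in Q.dilate γ \ T, ENNReal.ofReal (g z)
        ≤ ∫⁻ _ in Q.dilate γ \ T, ENNReal.ofReal (t / (2 * γ ^ n)) := by
          refine setLIntegral_mono' (hDm.diff hTm) fun z hz => ENNReal.ofReal_le_ofReal ?_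
          rw [le_div_iff₀ (by positivity), mul_comm]
          exact not_lt.1 hz.2
      _ ≤ ENNReal.ofReal (t / (2 * γ ^ n)) * volume (Q.dilate γ) := by
          rw [setLIntegral_const]
          gcongr
          exact Set.sdiff_subset
      _ = ENNReal.ofReal (t * V / 2) := by
          rw [Q.volume_dilate hγ.le, ← ENNReal.ofReal_mul (by positivity)]
          congr 1
          field_simp
          exact hV.symm
  have h2 : ENNReal.ofReal (t * V / 2) + ENNReal.ofReal (t * V / 2) ≤
      ENNReal.ofReal (t * V / 2) + ∫⁻ z in Q.dilate γ ∩ T, ENNReal.ofReal (g z) := by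
    refine le_trans ?_ (ha.trans h1)
    rw [← ENNReal.ofReal_add (by positivity) (by positivity), add_halves]
    exact ENNReal.ofReal_le_ofReal (by nlinarith)
  exact (ENNReal.add_le_add_iff_left ENNReal.ofReal_ne_top).1 h2

/-- The weak type inequality for means of `g` over dilations of disjoint cubes. -/
theorem sum_volume_le_withDensity_superlevel (hg : Measurable g) (hγ : 0 < γ)
    (F : Finset (Cube n)) (a : Cube n → ℝ) {t : ℝ} (ht : 0 < t)
    (hdisj : ∀ Q ∈ F, ∀ K ∈ F, Q ≠ K → Disjoint Q.toSet K.toSet) (hγ1 : 1 ≤ γ)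
    (hta : ∀ Q ∈ F, t < a Q)
    (ha : ∀ Q ∈ F, ENNReal.ofReal (a Q * (2 * Q.radius) ^ n) ≤
      ∫⁻ z in Q.dilate γ, ENNReal.ofReal (g z)) :
    ∑ Q ∈ F, ENNReal.ofReal ((2 * Q.radius) ^ n) ≤ ENNReal.ofReal (2 * (5 * γ) ^ n / t) *
      (volume.withDensity fun z => ENNReal.ofReal (g z)) {z | t < 2 * γ ^ n * g z} := by
  classical
  obtain ⟨M, hM⟩ := (F.finite_toSet.image fun Q : Cube n => γ * Q.radius).bddAbove
  -- Vitali's lemma is applied to the dilated cubes, which may overlap; the enlargement factor 5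
  -- enters the constant.
  obtain ⟨u, huF, hu, hcov⟩ := Vitali.exists_disjoint_subfamily_covering_enlargement_closedBall
    (F : Set (Cube n)) Cube.center (fun Q => γ * Q.radius) M
    (fun Q hQ => hM (Set.mem_image_of_mem _ hQ)) 5 (by norm_num)
  set U := (F.finite_toSet.subset huF).toFinset with hU
  have hmemU : ∀ Q, Q ∈ U ↔ Q ∈ u := fun Q => by simp [hU]
  set ν := volume.withDensity fun z => ENNReal.ofReal (g z) with hν
  set T := {z | t < 2 * γ ^ n * g z} with hT
  have hTm : MeasurableSet T := measurableSet_lt measurable_const (hg.const_mul _)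
  calc ∑ Q ∈ F, ENNReal.ofReal ((2 * Q.radius) ^ n) = ∑ Q ∈ F, volume Q.toSet :=
        Finset.sum_congr rfl fun Q _ => Q.volume_toSet.symm
    _ = volume (⋃ Q ∈ F, Q.toSet) := by
        rw [measure_biUnion_finset hdisj fun Q _ => Q.measurableSet_toSet]
    _ ≤ volume (⋃ Q ∈ U, Q.dilate (5 * γ)) := by
        refine measure_mono (Set.iUnion₂_subset fun Q hQ => ?_)
        obtain ⟨K, hK, hQK⟩ := hcov Q hQ
        refine Set.Subset.trans ?_ (Set.subset_biUnion_of_mem (u := fun Q : Cube n =>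
          Q.dilate (5 * γ)) ((hmemU K).2 hK))
        refine (Metric.closedBall_subset_closedBall ?_).trans (hQK.trans
          (Metric.closedBall_subset_closedBall (by linarith)))
        nlinarith [Q.radius_pos]
    _ ≤ ∑ Q ∈ U, volume (Q.dilate (5 * γ)) := measure_biUnion_finset_le _ _
    _ = ∑ Q ∈ U, ENNReal.ofReal (2 * (5 * γ) ^ n / t) *
          ENNReal.ofReal (t * (2 * Q.radius) ^ n / 2) := by
        refine Finset.sum_congr rfl fun Q _ => ?_
        rw [Q.volume_dilate (by positivity), ← ENNReal.ofReal_mul (by positivity)]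
        congr 1
        field_simp
    _ ≤ ∑ Q ∈ U, ENNReal.ofReal (2 * (5 * γ) ^ n / t) * ν (Q.dilate γ ∩ T) := by
        gcongr with Q hQ
        have hQF : Q ∈ F := huF ((hmemU Q).1 hQ)
        exact le_withDensity_superlevel hg hγ Q ht (hta Q hQF) (ha Q hQF)
    _ = ENNReal.ofReal (2 * (5 * γ) ^ n / t) * ν (⋃ Q ∈ U, Q.dilate γ ∩ T) := by
        rw [← Finset.mul_sum, measure_biUnion_finset]
        · intro Q hQ K hK hQK
          exact (hu ((hmemU Q).1 hQ) ((hmemU K).1 hK) hQK).mono Set.inter_subset_left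
            Set.inter_subset_left
        · exact fun Q _ => measurableSet_closedBall.inter hTm
    _ ≤ _ := by
        gcongr
        exact Set.iUnion₂_subset fun Q _ => Set.inter_subset_right

theorem ofReal_rpow_eq_lintegral_lt {a s : ℝ} (ha : 0 ≤ a) (hs : 0 < s) :
    ENNReal.ofReal (a ^ s) = ENNReal.ofReal s * ∫⁻ t in Set.Ioi (0 : ℝ),
      (if t < a then 1 else 0) * ENNReal.ofReal (t ^ (s - 1)) := by
  have h := lintegral_rpow_eq_lintegral_meas_lt_mul (Measure.dirac ()) (f := fun _ => a)
    (Filter.Eventually.of_forall fun _ => ha) aemeasurable_const hs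
  simp only [lintegral_dirac] at h
  rw [h]
  congr 1
  refine lintegral_congr fun t => ?_
  by_cases hta : t < a <;> simp [hta]

/-- A discrete form of the Hardy–Littlewood maximal inequality: the means of `g` over dilations of
disjoint cubes. -/
theorem sum_volume_mul_rpow_le (hg : Measurable g) (hg0 : ∀ z, 0 ≤ g z) (hγ1 : 1 ≤ γ) {s : ℝ}
    (hs : 1 < s) (F : Finset (Cube n)) (a : Cube n → ℝ)
    (hdisj : ∀ Q ∈ F, ∀ K ∈ F, Q ≠ K → Disjoint Q.toSet K.toSet) (ha0 : ∀ Q ∈ F, 0 ≤ a Q)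
    (ha : ∀ Q ∈ F, ENNReal.ofReal (a Q * (2 * Q.radius) ^ n) ≤
      ∫⁻ z in Q.dilate γ, ENNReal.ofReal (g z)) :
    ∑ Q ∈ F, ENNReal.ofReal ((2 * Q.radius) ^ n * a Q ^ s) ≤
      ENNReal.ofReal (2 * (5 * γ) ^ n * s / (s - 1) * (2 * γ ^ n) ^ (s - 1)) *
        ∫⁻ z, ENNReal.ofReal (g z ^ s) := by
  classical
  have hγ : 0 < γ := by linarith
  have hs0 : 0 < s := by linarith
  have hs1 : 0 < s - 1 := by linarith
  set ν := volume.withDensity fun z => ENNReal.ofReal (g z) with hν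
  have hmeas : Measurable fun t : ℝ => ENNReal.ofReal (t ^ (s - 1)) := by fun_prop
  have hind : ∀ b : ℝ, Measurable fun t : ℝ => (if t < b then (1 : ℝ≥0∞) else 0) := fun b =>
    Measurable.ite measurableSet_Iio measurable_const measurable_const
  have hprod : ∀ b : ℝ, Measurable fun t : ℝ =>
      (if t < b then (1 : ℝ≥0∞) else 0) * ENNReal.ofReal (t ^ (s - 1)) := fun b =>
    (hind b).mul hmeas
  -- Layer cake in the level `t`: the weak type bound is used for each `t`, and `h4` reassembles the
  -- levels with respect to the measure with density `g`.
  have h1 : ∀ Q ∈ F, ENNReal.ofReal ((2 * Q.radius) ^ n * a Q ^ s) = ENNReal.ofReal s *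
      ∫⁻ t in Set.Ioi (0 : ℝ), ENNReal.ofReal ((2 * Q.radius) ^ n) *
        ((if t < a Q then 1 else 0) * ENNReal.ofReal (t ^ (s - 1))) := by
    intro Q hQ
    have := Q.radius_pos
    rw [ENNReal.ofReal_mul (by positivity), ofReal_rpow_eq_lintegral_lt (ha0 Q hQ) hs0,
      lintegral_const_mul _ (hprod _)]
    ring
  have h2 : ∀ t ∈ Set.Ioi (0 : ℝ), ∑ Q ∈ F, ENNReal.ofReal ((2 * Q.radius) ^ n) *
        ((if t < a Q then 1 else 0) * ENNReal.ofReal (t ^ (s - 1))) ≤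
      ENNReal.ofReal (2 * (5 * γ) ^ n) * (ν {z | t < 2 * γ ^ n * g z} *
        ENNReal.ofReal (t ^ (s - 1 - 1))) := by
    intro t ht
    have ht : 0 < t := ht
    have h3 := sum_volume_le_withDensity_superlevel hg hγ (F.filter fun Q => t < a Q) a ht
      (fun Q hQ K hK => hdisj Q (Finset.mem_filter.1 hQ).1 K (Finset.mem_filter.1 hK).1) hγ1
      (fun Q hQ => (Finset.mem_filter.1 hQ).2) fun Q hQ => ha Q (Finset.mem_filter.1 hQ).1
    calc ∑ Q ∈ F, ENNReal.ofReal ((2 * Q.radius) ^ n) *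
          ((if t < a Q then 1 else 0) * ENNReal.ofReal (t ^ (s - 1)))
        = (∑ Q ∈ F.filter fun Q => t < a Q, ENNReal.ofReal ((2 * Q.radius) ^ n)) *
            ENNReal.ofReal (t ^ (s - 1)) := by
          rw [Finset.sum_filter, Finset.sum_mul]
          refine Finset.sum_congr rfl fun Q _ => ?_
          split_ifs <;> simp
      _ ≤ ENNReal.ofReal (2 * (5 * γ) ^ n / t) * ν {z | t < 2 * γ ^ n * g z} *
            ENNReal.ofReal (t ^ (s - 1)) := by gcongr
      _ = _ := by
          rw [mul_right_comm, ← ENNReal.ofReal_mul (by positivity), mul_comm (ν _), ← mul_assoc,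
            ← ENNReal.ofReal_mul (by positivity), Real.rpow_sub_one ht.ne' (s - 1)]
          congr 2
          ring
  have h4 := lintegral_rpow_eq_lintegral_meas_lt_mul ν (f := fun z => 2 * γ ^ n * g z)
    (Filter.Eventually.of_forall fun z => mul_nonneg (by positivity) (hg0 z))
    (hg.const_mul _).aemeasurable hs1
  have h5 : ∫⁻ z, ENNReal.ofReal ((2 * γ ^ n * g z) ^ (s - 1)) ∂ν =
      ENNReal.ofReal ((2 * γ ^ n) ^ (s - 1)) * ∫⁻ z, ENNReal.ofReal (g z ^ s) := by
    rw [hν, lintegral_withDensity_eq_lintegral_mul _ hg.ennreal_ofReal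
      ((hg.const_mul _).pow_const _).ennreal_ofReal,
      ← lintegral_const_mul _ (hg.pow_const s).ennreal_ofReal]
    refine lintegral_congr fun z => ?_
    rw [Pi.mul_apply, ← ENNReal.ofReal_mul (hg0 z), ← ENNReal.ofReal_mul (by positivity),
      Real.mul_rpow (by positivity) (hg0 z)]
    congr 1
    rcases (hg0 z).eq_or_lt with h0 | h0
    · rw [← h0, Real.zero_rpow hs0.ne']; ring
    · rw [Real.rpow_sub_one h0.ne']
      field_simp
  set J := ∫⁻ t in Set.Ioi (0 : ℝ), ν {z | t < 2 * γ ^ n * g z} *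
    ENNReal.ofReal (t ^ (s - 1 - 1)) with hJ
  have h6 : J = ENNReal.ofReal (1 / (s - 1)) * (ENNReal.ofReal ((2 * γ ^ n) ^ (s - 1)) *
      ∫⁻ z, ENNReal.ofReal (g z ^ s)) := by
    rw [← h5, h4, ← mul_assoc, ← ENNReal.ofReal_mul (by positivity),
      one_div_mul_cancel hs1.ne', ENNReal.ofReal_one, one_mul]
  rw [Finset.sum_congr rfl h1, ← Finset.mul_sum, ← lintegral_finsetSum _
    fun Q _ => (hprod (a Q)).const_mul _]
  refine (mul_le_mul_right (setLIntegral_mono' measurableSet_Ioi h2) _).trans ?_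
  rw [lintegral_const_mul' _ _ ENNReal.ofReal_ne_top, ← hJ, h6]
  simp only [← mul_assoc]
  refine mul_le_mul_left (le_of_eq ?_) _
  rw [← ENNReal.ofReal_mul (by positivity), ← ENNReal.ofReal_mul (by positivity),
    ← ENNReal.ofReal_mul (by positivity)]
  congr 1
  ring

end DiscreteMaximal



/-! ### Summation of the L_p(μ) part and of the Sobolev part. -/

/-- The scaling of the integral of a negative power. -/
theorem lintegral_norm_sub_add_rpow {p : ℝ} (x : Fin n → ℝ) {r : ℝ} (hr : 0 < r) :
    ∫⁻ z : Fin n → ℝ, ENNReal.ofReal ((‖z - x‖ + r) ^ (-p)) = ENNReal.ofReal (r ^ ((n : ℝ) - p)) *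
      ∫⁻ w : Fin n → ℝ, ENNReal.ofReal ((1 + ‖w‖) ^ (-p)) := by
  set h : (Fin n → ℝ) → ℝ≥0∞ := fun w => ENNReal.ofReal ((1 + ‖w‖) ^ (-p)) with hh
  have hhm : Measurable h := by fun_prop
  calc ∫⁻ z : Fin n → ℝ, ENNReal.ofReal ((‖z - x‖ + r) ^ (-p))
      = ∫⁻ z : Fin n → ℝ, ENNReal.ofReal ((‖z‖ + r) ^ (-p)) :=
        lintegral_sub_right_eq_self (fun z : Fin n → ℝ => ENNReal.ofReal ((‖z‖ + r) ^ (-p))) x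
    _ = ∫⁻ z : Fin n → ℝ, ENNReal.ofReal (r ^ (-p)) * h (r⁻¹ • z) := by
        refine lintegral_congr fun z => ?_
        rw [hh, ← ENNReal.ofReal_mul (by positivity), ← Real.mul_rpow hr.le (by positivity),
          norm_smul, norm_inv, Real.norm_of_nonneg hr.le]
        congr 2
        field_simp
        ring
    _ = ENNReal.ofReal (r ^ (-p)) * ∫⁻ w, h w ∂(volume.map fun z : Fin n → ℝ => r⁻¹ • z) := by
        rw [lintegral_const_mul' _ _ ENNReal.ofReal_ne_top,
          lintegral_map hhm (measurable_const_smul _)]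
    _ = ENNReal.ofReal (r ^ ((n : ℝ) - p)) * ∫⁻ w, h w := by
        rw [Measure.map_addHaar_smul _ (inv_ne_zero hr.ne'), lintegral_smul_measure,
          Module.finrank_fin_fun, inv_pow, inv_inv, abs_of_pos (by positivity), smul_eq_mul,
          ← mul_assoc, ← ENNReal.ofReal_mul (by positivity), Real.rpow_sub hr, Real.rpow_natCast,
          Real.rpow_neg hr.le]
        congr 2
        field_simp

/-- Disjoint cubes whose dilations contain a given cube have summable weights. -/
theorem sum_diamPow_le (hn : 0 < n) {p γ : ℝ} (hp : (n : ℝ) < p) (hγ : 1 ≤ γ) (K : Cube n)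
    (F : Finset (Cube n)) (hdisj : ∀ Q ∈ F, ∀ L ∈ F, Q ≠ L → Disjoint Q.toSet L.toSet)
    (hK : ∀ Q ∈ F, K.toSet ⊆ Q.dilate γ) :
    ∑ Q ∈ F, Q.diamPow p ≤ ENNReal.ofReal ((2 * γ) ^ p * 2⁻¹ ^ ((n : ℝ) - p)) *
      (∫⁻ w : Fin n → ℝ, ENNReal.ofReal ((1 + ‖w‖) ^ (-p))) * K.diamPow p := by
  have : Nonempty (Fin n) := ⟨⟨0, hn⟩⟩
  have hKr := K.radius_pos
  have hn0 : (0 : ℝ) ≤ n := n.cast_nonneg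
  set H : (Fin n → ℝ) → ℝ≥0∞ := fun z =>
    ENNReal.ofReal ((‖z - K.center‖ + K.radius) ^ (-p)) with hH
  -- On `Q` the function `‖z - K.center‖ + K.radius` is at most `2 * γ` times the diameter, so the
  -- weight is dominated by the integral over `Q` of its power `-p`; disjointness then sums these
  -- integrals.
  have hterm : ∀ Q ∈ F, Q.diamPow p ≤
      ENNReal.ofReal ((2 * γ) ^ p) * ∫⁻ z in Q.toSet, H z := by
    intro Q hQ
    have hr := Q.radius_pos
    have hc : dist K.center Q.center ≤ γ * Q.radius := hK Q hQ K.center_mem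
    have hrK : K.radius ≤ γ * Q.radius := by
      have := Metric.diam_mono (hK Q hQ) Metric.isBounded_closedBall
      rw [K.diam_toSet hn, Cube.dilate, Metric.diam_closedBall_eq _ (by positivity)] at this
      linarith
    rw [← lintegral_const_mul' _ _ ENNReal.ofReal_ne_top, Q.diamPow_eq hn]
    calc ENNReal.ofReal ((2 * Q.radius) ^ ((n : ℝ) - p))
        = ∫⁻ _ in Q.toSet, ENNReal.ofReal ((2 * Q.radius) ^ (-p)) := by
          rw [setLIntegral_const, Q.volume_toSet, ← ENNReal.ofReal_mul (by positivity),
            sub_eq_neg_add, Real.rpow_add (by positivity), Real.rpow_natCast]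
      _ ≤ _ := by
          refine setLIntegral_mono' Q.measurableSet_toSet fun z hz => ?_
          have hzc : dist z Q.center ≤ Q.radius := hz
          have hle : ‖z - K.center‖ + K.radius ≤ 2 * γ * (2 * Q.radius) := by
            rw [← dist_eq_norm]
            nlinarith [dist_triangle_right z K.center Q.center]
          rw [← ENNReal.ofReal_mul (by positivity)]
          refine ENNReal.ofReal_le_ofReal ?_
          have h1 := Real.rpow_le_rpow_of_nonpos (show 0 < ‖z - K.center‖ + K.radius by positivity)
            hle (show -p ≤ 0 by linarith)
          refine le_trans (le_of_eq ?_) (mul_le_mul_of_nonneg_left h1 (by positivity))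
          rw [Real.mul_rpow (x := 2 * γ) (y := 2 * Q.radius) (by positivity) (by positivity),
            ← mul_assoc, ← Real.rpow_add (by positivity), add_neg_cancel, Real.rpow_zero, one_mul]
  refine (Finset.sum_le_sum hterm).trans ?_
  rw [← Finset.mul_sum, ← lintegral_biUnion_finset hdisj fun Q _ => Q.measurableSet_toSet]
  refine (mul_le_mul_right (setLIntegral_le_lintegral _ _) _).trans (le_of_eq ?_)
  rw [hH, lintegral_norm_sub_add_rpow _ hKr, K.diamPow_eq hn, mul_right_comm (ENNReal.ofReal _),
    ← ENNReal.ofReal_mul (by positivity), ← mul_assoc, ← ENNReal.ofReal_mul (by positivity)]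
  congr 2
  rw [mul_assoc, ← Real.mul_rpow (by positivity) (by positivity)]
  congr 2
  ring

/-- The part of the sums in `OscBound` that comes from the function in `L_p(μ)`. -/
theorem sum_diamPow_div_mul_lintegral_le (hn : 0 < n) {p γ : ℝ} (hp : (n : ℝ) < p) (hγ : 1 ≤ γ)
    (μ : Measure (Fin n → ℝ)) (h : (Fin n → ℝ) → ℝ≥0∞) (F : Finset (Cube n)) (A : Cube n → Cube n)
    (hdisj : ∀ Q ∈ F, ∀ L ∈ F, Q ≠ L → Disjoint Q.toSet L.toSet)
    (hA : ∀ Q ∈ F, A Q ∈ F ∧ (A Q).toSet ⊆ Q.dilate γ) :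
    ∑ Q ∈ F, Q.diamPow p * ((∫⁻ x in (A Q).toSet, h x ∂μ) / (A Q).diamPow p) ≤
      ENNReal.ofReal ((2 * γ) ^ p * 2⁻¹ ^ ((n : ℝ) - p)) *
      (∫⁻ w : Fin n → ℝ, ENNReal.ofReal ((1 + ‖w‖) ^ (-p))) * ∫⁻ x, h x ∂μ := by
  classical
  set M := ENNReal.ofReal ((2 * γ) ^ p * 2⁻¹ ^ ((n : ℝ) - p)) *
      (∫⁻ w : Fin n → ℝ, ENNReal.ofReal ((1 + ‖w‖) ^ (-p))) with hM
  -- Cubes with the same partner `K` are grouped; their weights sum to a multiple of that of `K`,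
  -- which cancels the divisor.
  rw [← Finset.sum_fiberwise_of_maps_to (t := F) (g := A) fun Q hQ => (hA Q hQ).1]
  calc ∑ K ∈ F, ∑ Q ∈ F with A Q = K,
        Q.diamPow p * ((∫⁻ x in (A Q).toSet, h x ∂μ) / (A Q).diamPow p)
      ≤ ∑ K ∈ F, M * ∫⁻ x in K.toSet, h x ∂μ := by
        refine Finset.sum_le_sum fun K _ => ?_
        have h1 : ∑ Q ∈ F with A Q = K,
            Q.diamPow p * ((∫⁻ x in (A Q).toSet, h x ∂μ) / (A Q).diamPow p) =
            (∑ Q ∈ F with A Q = K, Q.diamPow p) * ((∫⁻ x in K.toSet, h x ∂μ) / K.diamPow p) := by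
          rw [Finset.sum_mul]
          refine Finset.sum_congr rfl fun Q hQ => ?_
          rw [(Finset.mem_filter.1 hQ).2]
        rw [h1]
        have h2 := sum_diamPow_le hn hp hγ K (F.filter fun Q => A Q = K)
          (fun Q hQ L hL => hdisj Q (Finset.mem_filter.1 hQ).1 L (Finset.mem_filter.1 hL).1)
          fun Q hQ => by
            have := (hA Q (Finset.mem_filter.1 hQ).1).2
            rwa [(Finset.mem_filter.1 hQ).2] at this
        refine (mul_le_mul_left h2 _).trans (le_of_eq ?_)
        rw [← hM, mul_assoc, ENNReal.mul_div_cancel (K.diamPow_ne_zero hn p) (K.diamPow_ne_top p)]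
    _ = M * ∫⁻ x in ⋃ K ∈ F, K.toSet, h x ∂μ := by
        rw [← Finset.mul_sum, lintegral_biUnion_finset hdisj fun Q _ => Q.measurableSet_toSet]
    _ ≤ _ := mul_le_mul_right (setLIntegral_le_lintegral _ _) _

/-- The part of the sums in `OscBound` that comes from the Sobolev function. -/
theorem exists_sum_oscillation_le (hn : 0 < n) {p γ : ℝ} (hp : (n : ℝ) < p) (hγ : 1 ≤ γ) :
    ∃ C : ℝ≥0∞, C ≠ ⊤ ∧ ∀ (u : (Fin n → ℝ) → ℝ) (G : (Fin n → ℝ) → (Fin n → ℝ)), Continuous u →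
      IsWeakGradient u G → ∫⁻ z, ‖G z‖ₑ ^ p ≠ ⊤ → ∀ F : Finset (Cube n),
        (∀ Q ∈ F, ∀ L ∈ F, Q ≠ L → Disjoint Q.toSet L.toSet) →
          ∃ o : Cube n → ℝ≥0∞,
            (∀ Q ∈ F, ∀ x ∈ Q.dilate γ, ∀ y ∈ Q.dilate γ, ‖u x - u y‖ₑ ^ p ≤ o Q) ∧
            ∑ Q ∈ F, Q.diamPow p * o Q ≤ C * ∫⁻ z, ‖G z‖ₑ ^ p := by
  have hn0 : (0 : ℝ) < n := by exact_mod_cast hn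
  -- Morrey's inequality needs `q > n` and the maximal inequality needs `p / q > 1`.
  set q := ((n : ℝ) + p) / 2 with hq
  have hnq : (n : ℝ) < q := by rw [hq]; linarith
  have hqp : q < p := by rw [hq]; linarith
  have hq0 : 0 < q := by linarith
  have hp0 : 0 < p := by linarith
  set s := p / q with hs
  have hs1 : 1 < s := (one_lt_div hq0).2 hqp
  have hqs : q * s = p := by rw [hs]; field_simp
  set M := (4 * morreyIntegral n q) ^ q * (n : ℝ≥0∞) ^ q with hM
  have hMt : M ≠ ⊤ := ENNReal.mul_ne_top
    (ENNReal.rpow_ne_top_of_nonneg hq0.le (ENNReal.mul_ne_top (by simp)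
      (morreyIntegral_ne_top hn hnq)))
    (ENNReal.rpow_ne_top_of_nonneg hq0.le (ENNReal.natCast_ne_top n))
  set c := ENNReal.ofReal (2 * (5 * (2 * γ)) ^ n * s / (s - 1) * (2 * (2 * γ) ^ n) ^ (s - 1))
  refine ⟨M ^ s * ENNReal.ofReal ((γ / 2) ^ ((q - n) * s)) * c, ENNReal.mul_ne_top
    (ENNReal.mul_ne_top (ENNReal.rpow_ne_top_of_nonneg (by linarith) hMt) ENNReal.ofReal_ne_top)
    ENNReal.ofReal_ne_top, ?_⟩
  intro u G hu hG hfin F hdisj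
  have hGm := hG.locallyIntegrable_right.aestronglyMeasurable
  set g : (Fin n → ℝ) → ℝ := fun z => ‖hGm.mk G z‖ ^ q with hg
  have hgm : Measurable g := hGm.stronglyMeasurable_mk.measurable.norm.pow_const q
  have hg0 : ∀ z, 0 ≤ g z := fun z => by positivity
  have hGg : ∀ᵐ z, ‖G z‖ₑ ^ q = ENNReal.ofReal (g z) := by
    filter_upwards [hGm.ae_eq_mk] with z hz
    rw [hz, hg, ← ofReal_norm, ENNReal.ofReal_rpow_of_nonneg (norm_nonneg _) hq0.le]
  have hgs : ∫⁻ z, ENNReal.ofReal (g z ^ s) = ∫⁻ z, ‖G z‖ₑ ^ p := by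
    refine lintegral_congr_ae ?_
    filter_upwards [hGg] with z hz
    rw [← ENNReal.ofReal_rpow_of_nonneg (hg0 z) (by linarith), ← hz, ← ENNReal.rpow_mul, hqs]
  set I : Cube n → ℝ≥0∞ := fun Q => ∫⁻ z in Q.dilate (2 * γ), ENNReal.ofReal (g z) with hI
  have hIt : ∀ Q, I Q ≠ ⊤ := by
    intro Q h
    have h1 := lintegral_rpow_le (ν := volume.restrict (Q.dilate (2 * γ)))
      hgm.ennreal_ofReal.aemeasurable hs1.le
    change I Q ^ s ≤ _ at h1
    rw [h, ENNReal.top_rpow_of_pos (by linarith), Measure.restrict_apply_univ, top_le_iff] at h1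
    refine ENNReal.mul_ne_top (ENNReal.rpow_ne_top_of_nonneg (by linarith) ?_) ?_ h1
    · rw [Q.volume_dilate (by linarith)]; exact ENNReal.ofReal_ne_top
    · refine ne_top_of_le_ne_top hfin ((setLIntegral_le_lintegral _ _).trans (le_of_eq ?_))
      rw [← hgs]
      exact lintegral_congr fun z => ENNReal.ofReal_rpow_of_nonneg (hg0 z) (by linarith)
  set a : Cube n → ℝ := fun Q => (I Q).toReal / (2 * Q.radius) ^ n with ha
  have ha0 : ∀ Q, 0 ≤ a Q := fun Q => by
    have := Q.radius_pos
    positivity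
  have haI : ∀ Q, ENNReal.ofReal (a Q * (2 * Q.radius) ^ n) = I Q := by
    intro Q
    have := Q.radius_pos
    rw [ha, div_mul_cancel₀ _ (by positivity), ENNReal.ofReal_toReal (hIt Q)]
  refine ⟨fun Q => (M * ENNReal.ofReal ((γ * Q.radius) ^ (q - n)) * I Q) ^ s, ?_, ?_⟩
  · intro Q _ x hx y hy
    have h1 := hG.morrey hn hnq hu Q.center (r := γ * Q.radius)
      (mul_pos (by linarith) Q.radius_pos) hx hy
    rw [← hqs, ENNReal.rpow_mul]
    refine ENNReal.rpow_le_rpow (h1.trans (le_of_eq ?_)) (by linarith)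
    congr 1
    rw [hI, ← mul_assoc]
    exact setLIntegral_congr_fun_ae measurableSet_closedBall (hGg.mono fun z hz _ => hz)
  · have hterm : ∀ Q ∈ F, Q.diamPow p * (M * ENNReal.ofReal ((γ * Q.radius) ^ (q - n)) * I Q) ^ s =
        M ^ s * ENNReal.ofReal ((γ / 2) ^ ((q - n) * s)) *
          ENNReal.ofReal ((2 * Q.radius) ^ n * a Q ^ s) := by
      intro Q _
      have hr := Q.radius_pos
      have hs0 : 0 ≤ s := by linarith
      rw [Q.diamPow_eq hn, ← haI, mul_assoc M, ← ENNReal.ofReal_mul (by positivity),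
        ENNReal.mul_rpow_of_nonneg _ _ hs0, ENNReal.ofReal_rpow_of_nonneg
          (mul_nonneg (by positivity) (mul_nonneg (ha0 Q) (by positivity))) hs0, mul_left_comm,
        ← ENNReal.ofReal_mul (by positivity), mul_assoc, ← ENNReal.ofReal_mul (by positivity)]
      congr 2
      set R := 2 * Q.radius with hR
      have hR0 : 0 < R := by positivity
      rw [show γ * Q.radius = γ / 2 * R by rw [hR]; ring, Real.mul_rpow (by positivity)
        (mul_nonneg (ha0 Q) (by positivity)), Real.mul_rpow (ha0 Q) (by positivity),
        ← Real.rpow_mul (by positivity), Real.mul_rpow (by positivity) hR0.le, ← Real.rpow_natCast,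
        ← Real.rpow_mul hR0.le]
      -- Since `q * s = p`, the powers of the diameter combine to the volume of `Q`.
      have h5 : R ^ ((n : ℝ) - p) * R ^ ((q - n) * s) * R ^ ((n : ℝ) * s) = R ^ (n : ℝ) := by
        rw [← Real.rpow_add hR0, ← Real.rpow_add hR0]
        congr 1
        rw [← hqs]
        ring
      rw [← h5]
      ring
    rw [Finset.sum_congr rfl hterm, ← Finset.mul_sum, mul_assoc (M ^ s * _), ← hgs]
    refine mul_le_mul_right ?_ _
    exact sum_volume_mul_rpow_le hgm hg0 (by linarith) hs1 F a hdisj (fun Q _ => ha0 Q)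
      fun Q _ => (haI Q).le



/-! ### Necessity of the oscillation condition. -/

section Necessity

variable {p : ℝ} {μ : Measure (Fin n → ℝ)} [IsLocallyFiniteMeasure μ] {f u h : (Fin n → ℝ) → ℝ}

theorem enorm_add_add_rpow_le (hp : 1 ≤ p) (a b c : ℝ) :
    ‖a + (b - c)‖ₑ ^ p ≤ 2 ^ (p - 1) * 2 ^ (p - 1) * (‖a‖ₑ ^ p + (‖b‖ₑ ^ p + ‖c‖ₑ ^ p)) := by
  have h1 : (1 : ℝ≥0∞) ≤ 2 ^ (p - 1) := by
    rw [← ENNReal.one_rpow (p - 1)]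
    exact ENNReal.rpow_le_rpow (by norm_num) (by linarith)
  calc ‖a + (b - c)‖ₑ ^ p ≤ (‖a‖ₑ + (‖b‖ₑ + ‖c‖ₑ)) ^ p := by
        refine ENNReal.rpow_le_rpow ((enorm_add_le _ _).trans ?_) (by linarith)
        gcongr
        exact enorm_sub_le
    _ ≤ 2 ^ (p - 1) * (‖a‖ₑ ^ p + (‖b‖ₑ + ‖c‖ₑ) ^ p) :=
        ENNReal.rpow_add_le_mul_rpow_add_rpow _ _ hp
    _ ≤ 2 ^ (p - 1) * (2 ^ (p - 1) * ‖a‖ₑ ^ p + 2 ^ (p - 1) * (‖b‖ₑ ^ p + ‖c‖ₑ ^ p)) := by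
        gcongr
        · exact le_mul_of_one_le_left zero_le h1
        · exact ENNReal.rpow_add_le_mul_rpow_add_rpow _ _ hp
    _ = _ := by ring

theorem lintegral_prod_diff_le (hp : 1 ≤ p) (hf : AEMeasurable f μ) (hh : AEMeasurable h μ)
    (hfu : ∀ᵐ x ∂μ, f x = u x + h x) {D : Set (Fin n → ℝ)} {o : ℝ≥0∞}
    (ho : ∀ x ∈ D, ∀ y ∈ D, ‖u x - u y‖ₑ ^ p ≤ o) {W K : Set (Fin n → ℝ)} (hW : MeasurableSet W)
    (hK : MeasurableSet K) (hWD : W ⊆ D) (hKD : K ⊆ D) :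
    ∫⁻ z in W ×ˢ K, ‖f z.1 - f z.2‖ₑ ^ p ∂(μ.prod μ) ≤ 2 ^ (p - 1) * 2 ^ (p - 1) *
      (o * (μ W * μ K) + ((∫⁻ x in W, ‖h x‖ₑ ^ p ∂μ) * μ K +
        μ W * ∫⁻ x in K, ‖h x‖ₑ ^ p ∂μ)) := by
  have h2t : (2 : ℝ≥0∞) ^ (p - 1) * 2 ^ (p - 1) ≠ ⊤ := ENNReal.mul_ne_top
    (ENNReal.rpow_ne_top_of_nonneg (by linarith) ENNReal.ofNat_ne_top)
    (ENNReal.rpow_ne_top_of_nonneg (by linarith) ENNReal.ofNat_ne_top)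
  have hhp : AEMeasurable (fun x => ‖h x‖ₑ ^ p) μ := hh.enorm.pow_const p
  have hhW : AEMeasurable (fun x => ‖h x‖ₑ ^ p) (μ.restrict W) :=
    hhp.mono_measure Measure.restrict_le_self
  have hhK : AEMeasurable (fun x => ‖h x‖ₑ ^ p) (μ.restrict K) :=
    hhp.mono_measure Measure.restrict_le_self
  rw [lintegral_prod_diff hf]
  calc ∫⁻ x in W, ∫⁻ y in K, ‖f x - f y‖ₑ ^ p ∂μ ∂μ
      ≤ ∫⁻ x in W, ∫⁻ y in K, 2 ^ (p - 1) * 2 ^ (p - 1) *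
          (o + (‖h x‖ₑ ^ p + ‖h y‖ₑ ^ p)) ∂μ ∂μ := by
        refine lintegral_mono_ae ?_
        filter_upwards [ae_restrict_of_ae hfu, ae_restrict_mem hW] with x hx hxW
        refine lintegral_mono_ae ?_
        filter_upwards [ae_restrict_of_ae hfu, ae_restrict_mem hK] with y hy hyK
        rw [hx, hy, show u x + h x - (u y + h y) = (u x - u y) + (h x - h y) by ring]
        refine (enorm_add_add_rpow_le hp _ _ _).trans ?_
        gcongr
        exact ho x (hWD hxW) y (hKD hyK)
    _ = ∫⁻ x in W, 2 ^ (p - 1) * 2 ^ (p - 1) * ((o * μ K + ∫⁻ y in K, ‖h y‖ₑ ^ p ∂μ) +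
          ‖h x‖ₑ ^ p * μ K) ∂μ := by
        refine lintegral_congr fun x => ?_
        rw [lintegral_const_mul' _ _ h2t, lintegral_add_left measurable_const, setLIntegral_const,
          lintegral_add_left measurable_const, setLIntegral_const]
        ring
    _ = 2 ^ (p - 1) * 2 ^ (p - 1) * ((o * μ K + ∫⁻ y in K, ‖h y‖ₑ ^ p ∂μ) * μ W +
          (∫⁻ x in W, ‖h x‖ₑ ^ p ∂μ) * μ K) := by
        rw [lintegral_const_mul' _ _ h2t, lintegral_add_left measurable_const, setLIntegral_const,
          lintegral_mul_const'' _ hhW]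
    _ = _ := by ring

/-- The upper bound for a single term. -/
theorem oscTerm_le (hn : 0 < n) (hp : 1 ≤ p) (hf : AEMeasurable f μ) (hh : AEMeasurable h μ)
    (hfu : ∀ᵐ x ∂μ, f x = u x + h x) {D : Set (Fin n → ℝ)} {o : ℝ≥0∞}
    (ho : ∀ x ∈ D, ∀ y ∈ D, ‖u x - u y‖ₑ ^ p ≤ o) (Q W K : Cube n) (hWD : W.toSet ⊆ D)
    (hKD : K.toSet ⊆ D) :
    oscTerm p μ f Q W K ≤ 2 ^ (p - 1) * 2 ^ (p - 1) * (Q.diamPow p * o +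
      (Q.diamPow p * ((∫⁻ x in W.toSet, ‖h x‖ₑ ^ p ∂μ) / W.diamPow p) +
        Q.diamPow p * ((∫⁻ x in K.toSet, ‖h x‖ₑ ^ p ∂μ) / K.diamPow p))) := by
  rw [oscTerm]
  refine ENNReal.div_le_of_le_mul ?_
  set I := ∫⁻ x in W.toSet, ‖h x‖ₑ ^ p ∂μ
  set J := ∫⁻ x in K.toSet, ‖h x‖ₑ ^ p ∂μ
  set w := W.diamPow p with hw
  set k := K.diamPow p with hk
  have hI : I / w * w = I := ENNReal.div_mul_cancel (W.diamPow_ne_zero hn p) (W.diamPow_ne_top p)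
  have hJ : J / k * k = J := ENNReal.div_mul_cancel (K.diamPow_ne_zero hn p) (K.diamPow_ne_top p)
  refine (mul_le_mul_right (lintegral_prod_diff_le hp hf hh hfu ho W.measurableSet_toSet
    K.measurableSet_toSet hWD hKD) _).trans ?_
  -- Each of the three products of measures and powers is one of the terms in the expanded product
  -- of the brackets, so the brackets cancel.
  calc Q.diamPow p * (2 ^ (p - 1) * 2 ^ (p - 1) *
        (o * (μ W.toSet * μ K.toSet) + (I * μ K.toSet + μ W.toSet * J)))
      = 2 ^ (p - 1) * 2 ^ (p - 1) * (Q.diamPow p * o * (μ W.toSet * μ K.toSet) +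
        (Q.diamPow p * (I / w) * (w * μ K.toSet) + Q.diamPow p * (J / k) * (μ W.toSet * k))) := by
        conv_lhs => rw [← hI, ← hJ]
        ring
    _ ≤ 2 ^ (p - 1) * 2 ^ (p - 1) * (Q.diamPow p * o * ((w + μ W.toSet) * (k + μ K.toSet)) +
        (Q.diamPow p * (I / w) * ((w + μ W.toSet) * (k + μ K.toSet)) +
          Q.diamPow p * (J / k) * ((w + μ W.toSet) * (k + μ K.toSet)))) := by
        gcongr
        · exact le_add_self
        · exact le_add_self
        · exact le_self_add
        · exact le_add_self
        · exact le_add_self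
        · exact le_self_add
    _ = _ := by ring

end Necessity

/-- The necessity of the oscillation condition. -/
theorem exists_sum_oscTerm_le (hn : 0 < n) {p γ : ℝ} (hp : (n : ℝ) < p) (hγ : 1 ≤ γ) :
    ∃ C : ℝ≥0∞, C ≠ ⊤ ∧ ∀ μ : Measure (Fin n → ℝ), IsLocallyFiniteMeasure μ →
      ∀ f u h : (Fin n → ℝ) → ℝ, ∀ G : (Fin n → ℝ) → (Fin n → ℝ), AEMeasurable f μ →
        IsDecomposition p μ f u h → IsWeakGradient u G →
        ∀ lam : ℝ, C * (eLpNorm G (ENNReal.ofReal p) volume +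
          eLpNorm h (ENNReal.ofReal p) μ) ^ p ≤ ENNReal.ofReal lam →
        eLpNorm G (ENNReal.ofReal p) volume ≠ ⊤ → OscBound γ p μ f lam := by
  have hp1 : 1 ≤ p := le_trans (by exact_mod_cast hn) hp.le
  have hp0 : 0 < p := by linarith
  obtain ⟨C₁, hC₁, hosc⟩ := exists_sum_oscillation_le hn hp hγ
  set C₂ := ENNReal.ofReal ((2 * γ) ^ p * 2⁻¹ ^ ((n : ℝ) - p)) *
      (∫⁻ w : Fin n → ℝ, ENNReal.ofReal ((1 + ‖w‖) ^ (-p))) with hC₂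
  have hC₂t : C₂ ≠ ⊤ := ENNReal.mul_ne_top ENNReal.ofReal_ne_top
    (finite_integral_one_add_norm (by simpa using hp)).ne
  have h2t : (2 : ℝ≥0∞) ^ (p - 1) * 2 ^ (p - 1) ≠ ⊤ := ENNReal.mul_ne_top
    (ENNReal.rpow_ne_top_of_nonneg (by linarith) ENNReal.ofNat_ne_top)
    (ENNReal.rpow_ne_top_of_nonneg (by linarith) ENNReal.ofNat_ne_top)
  refine ⟨2 ^ (p - 1) * 2 ^ (p - 1) * (C₁ + (C₂ + C₂)), by
    exact ENNReal.mul_ne_top h2t (by finiteness), ?_⟩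
  intro μ _ f u h G hf hdec hG lam hlam hGt F A B hdisj hAB
  have hpow : ∀ {I : ℝ≥0∞}, (I ^ (1 / p)) ^ p = I := fun {I} => by
    rw [← ENNReal.rpow_mul, one_div_mul_cancel hp0.ne', ENNReal.rpow_one]
  rw [eLpNorm_eq_lintegral hp0] at hGt
  rw [eLpNorm_eq_lintegral hp0, eLpNorm_eq_lintegral hp0] at hlam
  set X := ∫⁻ z, ‖G z‖ₑ ^ p with hX
  set Y := ∫⁻ z, ‖h z‖ₑ ^ p ∂μ with hY
  have hXt : X ≠ ⊤ := fun h => hGt (by rw [h]; exact ENNReal.top_rpow_of_pos (by positivity))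
  have hXY : X ≤ (X ^ (1 / p) + Y ^ (1 / p)) ^ p := by
    conv_lhs => rw [← hpow (I := X)]
    exact ENNReal.rpow_le_rpow le_self_add hp0.le
  have hYX : Y ≤ (X ^ (1 / p) + Y ^ (1 / p)) ^ p := by
    conv_lhs => rw [← hpow (I := Y)]
    exact ENNReal.rpow_le_rpow le_add_self hp0.le
  refine le_trans ?_ hlam
  obtain ⟨o, ho, hosum⟩ := hosc u G hdec.continuous_left hG hXt F hdisj
  have hA : ∀ Q ∈ F, A Q ∈ F ∧ (A Q).toSet ⊆ Q.dilate γ := fun Q hQ =>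
    ⟨(hAB Q hQ).1, Set.subset_union_left.trans (hAB Q hQ).2.2⟩
  have hB : ∀ Q ∈ F, B Q ∈ F ∧ (B Q).toSet ⊆ Q.dilate γ := fun Q hQ =>
    ⟨(hAB Q hQ).2.1, Set.subset_union_right.trans (hAB Q hQ).2.2⟩
  refine (Finset.sum_le_sum fun Q hQ => oscTerm_le hn hp1 hf hdec.memLp_right.1.aemeasurable
    hdec.ae_eq (ho Q hQ) Q (A Q) (B Q) (hA Q hQ).2 (hB Q hQ).2).trans ?_
  rw [← Finset.mul_sum, Finset.sum_add_distrib, Finset.sum_add_distrib,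
    mul_assoc ((2 : ℝ≥0∞) ^ (p - 1) * 2 ^ (p - 1))]
  refine mul_le_mul_right ?_ _
  rw [add_mul, add_mul]
  refine add_le_add (hosum.trans (mul_le_mul_right hXY _)) (add_le_add ?_ ?_)
  · exact (sum_diamPow_div_mul_lintegral_le hn hp hγ μ _ F A hdisj hA).trans
      (mul_le_mul_right hYX _)
  · exact (sum_diamPow_div_mul_lintegral_le hn hp hγ μ _ F B hdisj hB).trans
      (mul_le_mul_right hYX _)

/-- The infimum in `oscNorm` is bounded by any admissible bound. -/
theorem oscNorm_le {γ p : ℝ} (hp : 0 < p) {μ : Measure (Fin n → ℝ)} {f : (Fin n → ℝ) → ℝ}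
    {T : ℝ≥0∞} (h : ∀ lam : ℝ, T ^ p ≤ ENNReal.ofReal lam → OscBound γ p μ f lam) :
    oscNorm γ p μ f ≤ T := by
  -- The slack `ε` makes the admissible bound strictly positive even when `T = 0`.
  refine ENNReal.le_of_forall_pos_le_add fun ε hε hT => ?_
  have hε : (0 : ℝ) < ε := hε
  have hT0 : 0 ≤ T.toReal := ENNReal.toReal_nonneg
  have hTε : T ≤ ENNReal.ofReal (T.toReal + ε) := by
    rw [ENNReal.ofReal_add hT0 hε.le, ENNReal.ofReal_toReal hT.ne]
    exact le_self_add
  refine (iInf_le_of_le ((T.toReal + ε) ^ p) (iInf₂_le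
    (show 0 < (T.toReal + ε) ^ p by positivity) (h _ ?_))).trans ?_
  · rw [← ENNReal.ofReal_rpow_of_nonneg (by positivity) hp.le]
    exact ENNReal.rpow_le_rpow hTε hp.le
  · rw [← Real.rpow_mul (by positivity), mul_one_div_cancel hp.ne', Real.rpow_one,
      ENNReal.ofReal_add hT0 hε.le, ENNReal.ofReal_toReal hT.ne, ENNReal.ofReal_coe_nnreal]

end SobolevSum

/-! ### The main theorem. -/

theorem theorem1p3 :
    ∃ γ : ℝ, 0 < γ ∧
      ∀ (n : ℕ) (p : ℝ), 0 < n → (n : ℝ) < p →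
        ∃ C : ℝ, 1 ≤ C ∧
          ∀ μ : Measure (Fin n → ℝ), IsLocallyFiniteMeasure μ → μ ≠ 0 →
            ∀ f : (Fin n → ℝ) → ℝ, SobolevSum.MemLpLoc p μ f →
              (SobolevSum.MemSum p μ f ↔
                ∃ lam : ℝ, 0 < lam ∧ SobolevSum.OscBound γ p μ f lam) ∧
              SobolevSum.sumNorm p μ f ≤ ENNReal.ofReal C * SobolevSum.oscNorm γ p μ f ∧
              SobolevSum.oscNorm γ p μ f ≤ ENNReal.ofReal C * SobolevSum.sumNorm p μ f := by
  refine ⟨100000, by norm_num, fun n p hn hp => ?_⟩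
  have hp0 : 0 < p := lt_of_le_of_lt (Nat.cast_nonneg n) hp
  obtain ⟨C₁, hC₁, hsuff⟩ := SobolevSum.exists_decomposition hn hp
  obtain ⟨C₂, hC₂, hnec⟩ := SobolevSum.exists_sum_oscTerm_le hn hp
    (show (1 : ℝ) ≤ 100000 by norm_num)
  have hC₂' : C₂ ^ (1 / p) ≠ ⊤ := ENNReal.rpow_ne_top_of_nonneg (by positivity) hC₂
  obtain ⟨C, hC, hC1, hC2⟩ : ∃ C : ℝ, 1 ≤ C ∧ C₁ ≤ ENNReal.ofReal C ∧
      C₂ ^ (1 / p) ≤ ENNReal.ofReal C := by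
    refine ⟨1 + C₁.toReal + (C₂ ^ (1 / p)).toReal, ?_, ?_, ?_⟩
    · linarith [ENNReal.toReal_nonneg (a := C₁), ENNReal.toReal_nonneg (a := C₂ ^ (1 / p))]
    · rw [ENNReal.le_ofReal_iff_toReal_le hC₁ (by positivity)]
      linarith [ENNReal.toReal_nonneg (a := C₁), ENNReal.toReal_nonneg (a := C₂ ^ (1 / p))]
    · rw [ENNReal.le_ofReal_iff_toReal_le hC₂' (by positivity)]
      linarith [ENNReal.toReal_nonneg (a := C₁), ENNReal.toReal_nonneg (a := C₂ ^ (1 / p))]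
  have hC0 : ENNReal.ofReal C ≠ 0 := by
    simp only [ne_eq, ENNReal.ofReal_eq_zero, not_le]; linarith
  refine ⟨C, hC, fun μ hμl hμ f hf => ⟨⟨?_, ?_⟩, ?_, ?_⟩⟩
  · rintro ⟨f₁, f₂, hdec⟩
    obtain ⟨-, G, hG, hGp⟩ := hdec.memSobolev_left
    set T := C₂ * (eLpNorm G (ENNReal.ofReal p) volume +
      eLpNorm f₂ (ENNReal.ofReal p) μ) ^ p with hT
    have hTt : T ≠ ⊤ := ENNReal.mul_ne_top hC₂ (ENNReal.rpow_ne_top_of_nonneg hp0.le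
      (ENNReal.add_ne_top.2 ⟨hGp.2.ne, hdec.memLp_right.2.ne⟩))
    have hT0 : 0 ≤ T.toReal := ENNReal.toReal_nonneg
    refine ⟨T.toReal + 1, by positivity,
      hnec μ hμl f f₁ f₂ G hf.aemeasurable hdec hG _ ?_ hGp.2.ne⟩
    rw [← hT, ENNReal.le_ofReal_iff_toReal_le hTt (by positivity)]
    linarith
  · rintro ⟨lam, hlam, hosc⟩
    obtain ⟨f₁, f₂, hdec, -⟩ := hsuff μ hμl hμ f hf lam hlam hosc
    exact ⟨f₁, f₂, hdec⟩
  · rw [SobolevSum.oscNorm]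
    simp only [ENNReal.mul_iInf_of_ne hC0 ENNReal.ofReal_ne_top]
    refine le_iInf fun lam => le_iInf₂ fun hlam hosc => ?_
    obtain ⟨f₁, f₂, hdec, hle⟩ := hsuff μ hμl hμ f hf lam hlam hosc
    refine (iInf_le_of_le f₁ (iInf₂_le f₂ hdec)).trans (hle.trans ?_)
    gcongr
  · rw [SobolevSum.sumNorm]
    simp only [SobolevSum.sobolevSeminorm, ENNReal.iInf_add,
      ENNReal.mul_iInf_of_ne hC0 ENNReal.ofReal_ne_top]
    refine le_iInf fun f₁ => le_iInf₂ fun f₂ hdec => le_iInf₂ fun G hG => ?_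
    -- The infimum in `sobolevSeminorm` runs over weak gradients without any integrability; those of
    -- infinite norm give a trivial bound.
    by_cases hGt : eLpNorm G (ENNReal.ofReal p) volume = ⊤
    · rw [hGt, top_add, ENNReal.mul_top hC0]
      exact le_top
    · refine SobolevSum.oscNorm_le hp0 fun lam hlam =>
        hnec μ hμl f f₁ f₂ G hf.aemeasurable hdec hG lam (le_trans ?_ hlam) hGt
      rw [ENNReal.mul_rpow_of_nonneg _ _ hp0.le]
      gcongr
      have := ENNReal.rpow_le_rpow hC2 hp0.le
      rwa [← ENNReal.rpow_mul, one_div_mul_cancel hp0.ne', ENNReal.rpow_one] at this
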